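/- **Setting.** Let $(\Lambda,d_\Lambda)$ be a metric space with its Borel $\sigma$-algebra (for instance a Riemannian manifold) and $T:\Lambda\to\Lambda$ a measurable map. Let $Y\subset\Lambda$ be measurable, with a countable measurable partition $\{Y_j\}$, an inducing time $\tau:Y\to\{1,2,\dots\}$ that is constant on each $Y_j$ and satisfies $F(y)=T^{\tau(y)}y\in Y$ for all $y\in Y$ (it need not be the first return time), a partition of $Y$ into "stable leaves" $W^s_y\ni y$, and an "unstable leaf" $W^u\subset Y$ that meets each stable leaf in exactly one point; let $\rho$ be a measure on $W^u$. The separation time $s(y,y')\in\{0,1,\dots,\infty\}$ is the least $n\ge0$ such that $F^ny,F^ny'$ lie in distinct partition elements, and $\gamma^\infty=0$. Let $\psi_j(y)=\#\{k=0,\dots,j-1:T^ky\in Y\}$. Let $D_0,D_1\ge1$, $\gamma\in(0,1)$, $p\ge1$. We say that $T$ is *nonuniformly hyperbolic* with these constants if: * (A1) each $Y_j$ is a union of stable leaves and $F(W^s_y)\subset W^s_{Fy}$ for all $y\in Y$; * (A2) for all $j\ge0$: $d_\Lambda(T^jy,T^jy')\le D_0\gamma^j$ for all $y\in Y$, $y'\in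 W^s_y$, and $d_\Lambda(T^jy,T^jy')\le D_0\gamma^{s(y,y')-\psi_j(y)}$ for all $y,y'\in W^u$; * (A3) $\int_{W^u}\tau^p\,d\rho<\infty$; * (A4) let $\bar Y$ be the quotient of $Y$ by the stable leaves, $\bar\pi:Y\to\bar Y$ the projection, $\bar F$, $\tau$, $s$ the induced objects on $\bar Y$, $\bar\rho=\bar\pi_*\rho$, and $\alpha$ the partition of $\bar Y$ induced by $\{Y_j\}$. Then $\bar F$ maps each $a\in\alpha$ bijectively onto $\bar Y$, and $\zeta_0=\frac{d\bar\rho}{d\bar\rho\circ\bar F}$ is positive with $|\log\zeta_0(y)-\log\zeta_0(y')|\le D_1\gamma^{s(y,y')}$ for all $y,y'\in a$, $a\in\alpha$. Let $\mu_Y$ be the $F$-invariant probability measure on $Y$ for which $\bar\mu_Y=\bar\pi_*\mu_Y$ is the absolutely continuous (with respect to $\bar\rho$) $\bar F$-invariant probability measure on $\bar Y$ (the results below hold for every such $\mu_Y$). Let $\Delta=\{(y,\ell)\in Y\times\mathbb Z:0\le\ell<\tau(y)\}$, $f(y,\ell)=(y,\ell+1)$ if $\ell\le\tau(y)-2$ and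 $f(y,\tau(y)-1)=(Fy,0)$, $\pi_\Delta(y,\ell)=T^\ell y$, $\mu_\Delta=(\mu_Y\times\text{counting})/\int_Y\tau\,d\mu_Y$ and $\mu=(\pi_\Delta)_*\mu_\Delta$. The quotient tower $\bar\Delta$, the map $\bar f:\bar\Delta\to\bar\Delta$ and the measure $\bar\mu_\Delta=(\bar\mu_Y\times\text{counting})/\int_{\bar Y}\tau\,d\bar\mu_Y$ are defined in the same way from $\bar F$, $\tau$ and $\bar\mu_Y$; let $\bar\pi(y,\ell)=(\bar\pi y,\ell)$. Fix $\eta\in(0,1]$. For $v:\Lambda\to\mathbb R^d$ put $\|v\|_\eta=\sup|v|+\sup_{x\ne y}|v(x)-v(y)|/d_\Lambda(x,y)^\eta$; $v$ is called Hölder if $\|v\|_\eta<\infty$. For $q=(y,\ell)\in\Delta$ let $\hat q=(\hat y,\ell)$, where $\hat y$ is the point of $W^s_y\cap W^u$. The function $$\hat v(q)=v(\pi_\Delta\hat q)+\sum_{j=0}^\infty\big\{v(\pi_\Delta f^{j+1}\hat q)-v(\pi_\Delta f^j\widehat{fq})\big\}$$ is constant on the fibres of $\bar\pi:\Delta\to\bar\Delta$,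 so $\hat v=\bar v\circ\bar\pi$ for a function $\bar v:\bar\Delta\to\mathbb R^d$, the quotient observable corresponding to $v$. **Statement.** Fix $p\ge1$ and $\eta\in(0,1]$. (a) There is a function $C\ge1$ of $(D_0,D_1,\gamma,K)\in[1,\infty)^2\times(0,1)\times[1,\infty)$, continuous and depending only on $p$ and $\eta$, such that for every $T$ that is nonuniformly hyperbolic with constants $D_0,D_1,\gamma,p$ as above and every Hölder $v:\Lambda\to\mathbb R^d$, $d\ge 0$, with $\int_\Lambda v\,d\mu=0$, $$\Big|\max_{j\le n}\Big|\sum_{k=0}^{j-1}v\circ T^k\Big|\Big|_{L^{p^*}(\mu)}\le C\big(D_0,D_1,\gamma,|\tau|_{L^p(\mu_Y)}\big)\,\|v\|_\eta\,n^{\max\{1/2,\,1/p\}}\quad\text{for all }n\ge1,$$ where $p^*=\max\{p,2(p-1)\}$. (b) Suppose that $p\ge2$, and let $T$, $v$ be as in (a). Then, with $S_nv=\sum_{j=0}^{n-1}v\circ T^j$ and $S_n\bar v=\sum_{j=0}^{n-1}\bar v\circ\bar f^j$, the limits $$\lim_{n\to\infty}n^{-1}\int_\Lambda S_nv\,(S_nv)^T\,d\mu\qquad\text{and}\qquad\lim_{n\to\infty}n^{-1}\int_{\bar\Delta}S_n\bar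 v\,(S_n\bar v)^T\,d\bar\mu_\Delta$$ exist in $\mathbb R^{d\times d}$ and coincide. -/

import Mathlib

open MeasureTheory Filter Topology
open scoped ENNReal NNReal

universe u

noncomputable section

namespace NUH

/-! ### Symbolic separation and Young towers -/

/-- Separation time: the least `n ≥ 0` such that `F^n x` and `F^n y` carry different labels,
and `⊤` if there is no such `n`. -/
def sepTime {α : Type*} (F : α → α) (label : α → ℕ) (x y : α) : ℕ∞ :=
  ⨅ (n : ℕ) (_ : label (F^[n] x) ≠ label (F^[n] y)), (n : ℕ∞)

/-- `θ ^ s` for `s ∈ {0, 1, …, ∞}`, with `θ ^ ∞ = 0` (meant for `0 < θ < 1`). -/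
def powENat (θ : ℝ) (s : ℕ∞) : ℝ := if s = ⊤ then 0 else θ ^ s.toNat

/-- The tower `{(y, ℓ) : 0 ≤ ℓ < τ y}`. -/
abbrev Tower {α : Type*} (τ : α → ℕ) : Type _ := {q : α × ℕ // q.2 < τ q.1}

/-- The tower map: `(y, ℓ) ↦ (y, ℓ + 1)` below the top level, `(y, τ y - 1) ↦ (F y, 0)`. -/
def towerMap {α : Type*} (F : α → α) (τ : α → ℕ) (hτ : ∀ a, 0 < τ a) (q : Tower τ) : Tower τ :=
  if h : q.1.2 + 1 < τ q.1.1 then ⟨(q.1.1, q.1.2 + 1), h⟩ else ⟨(F q.1.1, 0), hτ _⟩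

/-- The measure `(μ × counting) / ∫ τ dμ` on the tower. -/
def towerMeasure {α : Type*} [MeasurableSpace α] (τ : α → ℕ) (μ : Measure α) :
    Measure (Tower τ) :=
  (∫⁻ a, (τ a : ℝ≥0∞) ∂μ)⁻¹ • (μ.prod Measure.count).comap Subtype.val

/-! ### Nonuniformly hyperbolic transformations -/

/-- The objects entering the definition of a nonuniformly hyperbolic transformation `T`: the set
`Y`, its countable measurable partition (`piece y` is the number `j` of the element `Y_j` that
contains `y`), the inducing time `τ`, the partition of `Y` into stable leaves (the classes of
`stable`), the part in `Y` of the unstable leaf `W^u`, and the reference measure `ρ` on it.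
The last two conditions on `stable` say that each `Y_j` is a union of stable leaves and that
`F = T^τ` maps the leaf of `y` into the leaf of `F y`. -/
structure InducingScheme {Λ : Type u} [MetricSpace Λ] [MeasurableSpace Λ] (T : Λ → Λ) where
  Y : Set Λ
  measurableSet_Y : MeasurableSet Y
  piece : Y → ℕ
  measurable_piece : Measurable piece
  τ : Y → ℕ
  τ_pos : ∀ y, 0 < τ y
  τ_const : ∀ y y', piece y = piece y' → τ y = τ y'
  return_mem : ∀ y : Y, T^[τ y] (y : Λ) ∈ Y
  stable : Setoid Y
  stable_piece : ∀ y y', stable y y' → piece y = piece y'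
  stable_return : ∀ y y', stable y y' →
    stable ⟨T^[τ y] (y : Λ), return_mem y⟩ ⟨T^[τ y'] (y' : Λ), return_mem y'⟩
  Wu : Set Y
  Wu_inter_leaf : ∀ y, ∃! w, w ∈ Wu ∧ stable y w
  ρ : Measure Wu

namespace InducingScheme

variable {Λ : Type u} [MetricSpace Λ] [MeasurableSpace Λ] {T : Λ → Λ} (S : InducingScheme T)

/-- The induced map `F = T^τ : Y → Y`. -/
def F (y : S.Y) : S.Y := ⟨T^[S.τ y] (y : Λ), S.return_mem y⟩

/-- Number of visits of `x` to `Y` by time `j`: `#{k = 0, …, j - 1 : T^k x ∈ Y}`. -/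
def visits (j : ℕ) (x : Λ) : ℕ := {k : ℕ | k < j ∧ T^[k] x ∈ S.Y}.ncard

/-- The quotient `Y / ∼` along stable leaves, with the quotient `σ`-algebra. -/
abbrev Ybar : Type u := Quotient S.stable

/-- The projection `Y → Y / ∼`. -/
def proj (y : S.Y) : S.Ybar := Quotient.mk S.stable y

/-- The quotient of the induced map. -/
def Fbar : S.Ybar → S.Ybar := Quotient.map S.F S.stable_return

/-- The quotient of the inducing time. -/
def τbar : S.Ybar → ℕ :=
  Quotient.lift S.τ fun y y' h => S.τ_const y y' (S.stable_piece y y' h)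

/-- The label of the element of the quotient partition that contains a given point. -/
def pieceBar : S.Ybar → ℕ := Quotient.lift S.piece S.stable_piece

lemma τbar_pos (x : S.Ybar) : 0 < S.τbar x := by
  induction x using Quotient.inductionOn with
  | h y => exact S.τ_pos y

/-- The reference measure on the quotient, the push-forward of `ρ`. -/
def ρbar : Measure S.Ybar := S.ρ.map fun w => S.proj w.1

/-- The point in which the stable leaf `x` meets `W^u`. -/
def leafPoint (x : S.Ybar) : S.Y := (S.Wu_inter_leaf x.out).choose

lemma leafPoint_mem (x : S.Ybar) : S.leafPoint x ∈ S.Wu :=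
  (S.Wu_inter_leaf x.out).choose_spec.1.1

lemma proj_leafPoint (x : S.Ybar) : S.proj (S.leafPoint x) = x := by
  have h : S.stable x.out (S.leafPoint x) := (S.Wu_inter_leaf x.out).choose_spec.1.2
  calc S.proj (S.leafPoint x) = S.proj x.out := Quotient.sound (S.stable.symm h)
    _ = x := Quotient.out_eq x

lemma τ_leafPoint (x : S.Ybar) : S.τ (S.leafPoint x) = S.τbar x :=
  congrArg S.τbar (S.proj_leafPoint x)

/-- The conditions (beyond those in the structure itself) which make `T` nonuniformly hyperbolic
with constants `D₀, D₁, γ, p`. -/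
structure IsHyperbolic (D₀ D₁ γ p : ℝ) : Prop where
  /-- contraction along stable leaves -/
  contract : ∀ y y' : S.Y, S.stable y y' → ∀ j : ℕ,
    dist (T^[j] (y : Λ)) (T^[j] (y' : Λ)) ≤ D₀ * γ ^ j
  /-- `d(T^j y, T^j y') ≤ D₀ γ ^ (s(y, y') - ψ_j(y))` on `W^u`, where `ψ_j` counts visits to `Y` -/
  expand : ∀ y ∈ S.Wu, ∀ y' ∈ S.Wu, ∀ j : ℕ,
    dist (T^[j] (y : Λ)) (T^[j] (y' : Λ)) ≤
      D₀ * (powENat γ (sepTime S.F S.piece y y') / γ ^ S.visits j (y : Λ))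
  /-- `∫ τ^p dρ < ∞` -/
  integrable : ∫⁻ w : S.Wu, ENNReal.ofReal ((S.τ w : ℝ) ^ p) ∂S.ρ < ∞
  /-- the quotient map sends each (nonempty) partition element bijectively onto `Ybar` -/
  full_branch : ∀ j ∈ Set.range S.pieceBar, Set.BijOn S.Fbar {x | S.pieceBar x = j} Set.univ
  /-- On each partition element `a`, the measure `ρbar ∘ Fbar : A ↦ ρbar (Fbar A)` has density
  `1 / ζ` with respect to `ρbar`, that is, `ζ = dρbar / d(ρbar ∘ Fbar)`, where `ζ` is positive
  and has bounded distortion. -/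
  distortion : ∃ ζ : S.Ybar → ℝ, Measurable ζ ∧ (∀ x, 0 < ζ x) ∧
    (∀ (j : ℕ) (A : Set S.Ybar), A ⊆ {x | S.pieceBar x = j} → MeasurableSet A →
      S.ρbar (S.Fbar '' A) = ∫⁻ x in A, ENNReal.ofReal (ζ x)⁻¹ ∂S.ρbar) ∧
    ∀ x x' : S.Ybar, S.pieceBar x = S.pieceBar x' →
      |Real.log (ζ x) - Real.log (ζ x')| ≤ D₁ * powENat γ (sepTime S.Fbar S.pieceBar x x')

/-- `μY` is the invariant measure of the induced map: a probability measure on `Y`, invariant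
under `F`, whose projection is the absolutely continuous `Fbar`-invariant measure on `Ybar`. -/
structure IsInducedMeasure (μY : Measure S.Y) : Prop where
  prob : IsProbabilityMeasure μY
  invariant : MeasurePreserving S.F μY μY
  absCont : μY.map S.proj ≪ S.ρbar

/-! ### The tower, the quotient tower and the measure on `Λ` -/

/-- The tower `Δ` over `Y`. -/
abbrev Δ : Type u := Tower S.τ

/-- The quotient tower over `Ybar`. -/
abbrev Δbar : Type u := Tower S.τbar

/-- The tower map on `Δ`. -/
def f : S.Δ → S.Δ := towerMap S.F S.τ S.τ_pos

/-- The tower map on the quotient tower. -/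
def fbar : S.Δbar → S.Δbar := towerMap S.Fbar S.τbar S.τbar_pos

/-- The semiconjugacy `(y, ℓ) ↦ T^ℓ y` from the tower map to `T`. -/
def πΔ (q : S.Δ) : Λ := T^[q.1.2] (q.1.1 : Λ)

/-- The projection `(y, ℓ) ↦ (proj y, ℓ)` of `Δ` onto the quotient tower. -/
def towerProj (q : S.Δ) : S.Δbar := ⟨(S.proj q.1.1, q.1.2), q.2⟩

/-- The section `(x, ℓ) ↦ (leafPoint x, ℓ)` of the projection. -/
def leafSection (q : S.Δbar) : S.Δ :=
  ⟨(S.leafPoint q.1.1, q.1.2), (S.τ_leafPoint q.1.1).symm ▸ q.2⟩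

/-- The projection `(y, ℓ) ↦ (ŷ, ℓ)` of `Δ` along stable leaves, where `ŷ` is the point in which
the leaf of `y` meets `W^u`. -/
def hat (q : S.Δ) : S.Δ := S.leafSection (S.towerProj q)

/-- The measure on `Λ`: the push-forward of `μY × counting / ∫ τ dμY`. -/
def μΛ (μY : Measure S.Y) : Measure Λ := (towerMeasure S.τ μY).map S.πΔ

/-- The measure on the quotient tower built from the projection of `μY`. -/
def μΔbar (μY : Measure S.Y) : Measure S.Δbar := towerMeasure S.τbar (μY.map S.proj)

/-- `v̂(q) = v(π q̂) + ∑_j (v(π f^{j+1} q̂) - v(π f^j (f q)^))`. -/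
def vhat {E : Type*} [NormedAddCommGroup E] (v : Λ → E) (q : S.Δ) : E :=
  v (S.πΔ (S.hat q)) +
    ∑' j : ℕ, (v (S.πΔ (S.f^[j + 1] (S.hat q))) - v (S.πΔ (S.f^[j] (S.hat (S.f q)))))

/-- The quotient observable: the function on the quotient tower through which `vhat v` factors
(see `vbar_towerProj`). -/
def vbar {E : Type*} [NormedAddCommGroup E] (v : Λ → E) (q : S.Δbar) : E :=
  S.vhat v (S.leafSection q)

lemma towerProj_leafSection (q : S.Δbar) : S.towerProj (S.leafSection q) = q :=
  Subtype.ext (Prod.ext (S.proj_leafPoint q.1.1) rfl)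

lemma towerProj_f (q : S.Δ) : S.towerProj (S.f q) = S.fbar (S.towerProj q) := by
  by_cases h : q.1.2 + 1 < S.τ q.1.1
  · have h' : (S.towerProj q).1.2 + 1 < S.τbar (S.towerProj q).1.1 := h
    simp only [f, fbar, towerMap, dif_pos h, dif_pos h']
    rfl
  · have h' : ¬ (S.towerProj q).1.2 + 1 < S.τbar (S.towerProj q).1.1 := h
    simp only [f, fbar, towerMap, dif_neg h, dif_neg h']
    rfl

lemma vbar_towerProj {E : Type*} [NormedAddCommGroup E] (v : Λ → E) (q : S.Δ) :
    S.vbar v (S.towerProj q) = S.vhat v q := by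
  simp only [vbar, vhat, hat, towerProj_f, towerProj_leafSection]

end InducingScheme

/-! ### Hölder observables -/

/-- The norm `‖v‖_η = |v|_∞ + |v|_η` of a bounded `η`-Hölder function. -/
def holderNorm {Λ E : Type*} [MetricSpace Λ] [NormedAddCommGroup E] (η : ℝ≥0) (v : Λ → E) : ℝ :=
  (⨆ x, ‖v x‖) + (nnHolderNorm η v : ℝ)

/-- `v` is bounded and `η`-Hölder, i.e. `‖v‖_η < ∞`. -/
def IsHolder {Λ E : Type*} [MetricSpace Λ] [NormedAddCommGroup E] (η : ℝ≥0) (v : Λ → E) : Prop :=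
  BddAbove (Set.range fun x => ‖v x‖) ∧ MemHolder η v

/-- `max_{j ≤ n} |∑_{k < j} v ∘ T^k|`. -/
def maxBirkhoff {Λ E : Type*} [NormedAddCommGroup E] (T : Λ → Λ) (v : Λ → E) (n : ℕ) (x : Λ) :
    ℝ :=
  (Finset.range (n + 1)).sup' Finset.nonempty_range_add_one fun j => ‖birkhoffSum T v j x‖

/-- The matrix `n⁻¹ ∫ (S_n v) (S_n v)ᵀ dμ`, where `S_n v = ∑_{k < n} v ∘ T^k`. -/
def covMatrix {Λ : Type*} [MeasurableSpace Λ] {d : ℕ} (T : Λ → Λ) (μ : Measure Λ)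
    (v : Λ → EuclideanSpace ℝ (Fin d)) (n : ℕ) : Matrix (Fin d) (Fin d) ℝ :=
  Matrix.of fun i j => (n : ℝ)⁻¹ * ∫ x, birkhoffSum T v n x i * birkhoffSum T v n x j ∂μ

end NUH

end

/-! Reduction to the quotient. The series in the definition of `v̂` is a telescoped comparison of
orbits on the same stable leaf, so `v̂` equals `v ∘ π_Δ` plus the coboundary of the bounded function
`leafCorr` (`IsHolderData.vhat_eq`). Birkhoff sums of `v` and of the quotient observable therefore
differ by a bounded amount, and both parts of the theorem become statements about a bounded
observable on the quotient tower. This observable is Hölder in the symbolic metric, with a loss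
depending on the column height (`IsHolderData.isTowerObservable`), and the quotient base map has
full branches with bounded distortion for its invariant measure (`IsHyperbolic.gibbsMarkov`).

Martingale approximation. A coupling argument shows that cylinders mix exponentially
(`GibbsMarkov.cylinder_mixing`). Let `Φ` be the sum of the observable over a column. Although `Φ` is
unbounded, its images under powers of the transfer operator are bounded and summable in the supremum
norm when the weighted second moment of `τ` is finite. Hence `Φ = m - χ + χ ∘ F` with `χ` bounded
and `m` orthogonal to all functions of `F` (`GibbsMarkov.exists_corrector`). On the tower the
observable becomes `m`, placed on the top level, plus the coboundary of a function that grows at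
most linearly with the level (`birkhoffSum_tower`); the first term is a reverse martingale
difference for the tower map (`IsReverseDiff.topLift`).

Moments for `p ≥ 2`. The conditional variance of `m` is bounded, so Kolmogorov's inequality can be
iterated `M` times, which gives a tail `(n s / λ²)^M` as long as no column higher than `λ` is
visited up to time `n` (`GibbsMarkov.tail_of_sq_integrable`). The exceptional event is paid for by
the maximal column height cut off at `n`, whose moment of order `2(p - 1)` is at most `2 n^(p-1) ∫
τ^p` (`lintegral_min_maxHeight_le`).

Moments for `1 < p < 2`. The observable is truncated to columns of height at most `λ`, Kolmogorov's
inequality is applied once to the truncation and Markov's inequality to the rest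
(`GibbsMarkov.tail_of_integrable`). This works because the variance of the martingale depends only
linearly on the bound of `χ` (`GibbsMarkov.variance_le`). Integration of the tail against `λ^(p-1)`
converges at infinity because `p < 2` and at zero because `p > 1`. For `p = 1` the trivial bound of
the sums by `n` suffices.

Constants. Every estimate is monotone in `D₀, D₁, γ, K`, so one constant serves a neighbourhood of
each parameter, and a partition of unity turns such local constants into a continuous function
(`exists_continuous_momentBound`).

Covariance. The covariance of the martingale sums is exactly linear in `n`. The coboundary
increments are `o(√n)` in `L²` (`norm_sq_corrLift_sub_le`, `tendsto_average_lintegral_min`) and the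
difference between `v` and its quotient observable is bounded; such perturbations do not affect the
limit (`tendsto_covariance_of_sub`). -/

namespace NUH

set_option linter.unusedSectionVars false

/-! ### Reverse martingale differences for a measure preserving map -/

section ReverseMartingale

variable {X E : Type*} [NormedAddCommGroup E] {f : X → X} {m : X → E}

/-- The set where some backward partial sum `∑_{i ≤ k < n} m ∘ f^k` has norm at least `lam`. -/
def crossing (f : X → X) (m : X → E) (lam : ℝ) : ℕ → Set X
  | 0 => ∅
  | n + 1 => {x | lam ≤ ‖birkhoffSum f m (n + 1) x‖} ∪ f ⁻¹' crossing f m lam n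

lemma mem_crossing {lam : ℝ} {n : ℕ} {x : X} :
    x ∈ crossing f m lam n ↔ ∃ i < n, lam ≤ ‖birkhoffSum f m (n - i) (f^[i] x)‖ := by
  induction n generalizing x with
  | zero => simp [crossing]
  | succ n ih =>
    simp only [crossing, Set.mem_union, Set.mem_ofPred_eq, Set.mem_preimage, ih]
    constructor
    · rintro (h | ⟨i, hi, h⟩)
      · exact ⟨0, n.succ_pos, h⟩
      · refine ⟨i + 1, by omega, ?_⟩
        rwa [Function.iterate_succ_apply, Nat.add_sub_add_right]
    · rintro ⟨i, hi, h⟩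
      rcases i with _ | i
      · exact Or.inl h
      · refine Or.inr ⟨i, by omega, ?_⟩
        rwa [Function.iterate_succ_apply, Nat.add_sub_add_right] at h

/-- The sum over times before `j` is the difference of the two backward sums that start at `0` and
at `j` and end at `n`; if both were below `lam`, it would be below `2 * lam`. This converts control
of backward sums, natural for reverse martingales, into control of forward maxima. -/
lemma mem_crossing_of_le {lam : ℝ} (hl : 0 < lam) {n j : ℕ} (hj : j ≤ n) {x : X}
    (h : 2 * lam ≤ ‖birkhoffSum f m j x‖) : x ∈ crossing f m lam n := by
  by_contra hx
  rw [mem_crossing] at hx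
  push Not at hx
  have key : ∀ i ≤ n, ‖birkhoffSum f m (n - i) (f^[i] x)‖ < lam := fun i hi => by
    rcases hi.lt_or_eq with h | rfl
    · exact hx i h
    · simpa using hl
  have h0 := key 0 n.zero_le
  have h1 := key j hj
  have : birkhoffSum f m n x = birkhoffSum f m j x + birkhoffSum f m (n - j) (f^[j] x) := by
    rw [← birkhoffSum_add, Nat.add_sub_cancel' hj]
  simp only [Nat.sub_zero, Function.iterate_zero, id_eq] at h0
  have h2 : birkhoffSum f m j x = birkhoffSum f m n x - birkhoffSum f m (n - j) (f^[j] x) := by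
    rw [this]; abel
  have := norm_sub_le (birkhoffSum f m n x) (birkhoffSum f m (n - j) (f^[j] x))
  rw [← h2] at this
  linarith

/-- The points of `f⁻ⁿ B` at which the first crossing of level `lam` (going backwards from time
`n + 1`) happens at time `0`. -/
def firstCrossing (f : X → X) (m : X → E) (lam : ℝ) (B : Set X) (n : ℕ) : Set X :=
  ({x | lam ≤ ‖birkhoffSum f m (n + 1) x‖} \ f ⁻¹' crossing f m lam n) ∩ f^[n + 1] ⁻¹' B

/-- The event that `‖m ∘ f^k‖ ≤ b` for all `k < n`. -/
def smallJumps (f : X → X) (m : X → E) (b : ℝ) (n : ℕ) : Set X :=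
  {x | ∀ k < n, ‖m (f^[k] x)‖ ≤ b}

/-- A stopping time argument in reversed time. Going back from time `n`, stop at the first sum that
reaches `lam`. Since the jumps are at most `b`, this sum is at most `lam + b`, so the earlier part
of the orbit still has to reach `M * (lam + b)`. -/
lemma crossing_subset_iUnion {lam b : ℝ} (hl : 0 < lam) (hb : 0 ≤ b) {M : ℕ} (hM : 1 ≤ M)
    (n : ℕ) (B : Set X) :
    crossing f m ((M + 1 : ℕ) * (lam + b)) n ∩ smallJumps f m b n ∩ f^[n] ⁻¹' B ⊆
      ⋃ k ∈ Finset.range n, crossing f m (M * (lam + b)) (n - 1 - k) ∩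
        smallJumps f m b (n - 1 - k) ∩ f^[n - 1 - k] ⁻¹' firstCrossing f m lam B k := by
  classical
  rintro x ⟨⟨h1, h2⟩, h3⟩
  obtain ⟨i, hi, h⟩ := mem_crossing.1 h1
  have hM' : (1 : ℝ) ≤ M := by exact_mod_cast hM
  push_cast at h
  have hex : ∃ k, k < n ∧ lam ≤ ‖birkhoffSum f m (k + 1) (f^[n - 1 - k] x)‖ := by
    refine ⟨n - 1 - i, by omega, ?_⟩
    have e1 : n - 1 - i + 1 = n - i := by omega
    have e2 : n - 1 - (n - 1 - i) = i := by omega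
    rw [e1, e2]
    nlinarith
  -- `k + 1` is the length of the shortest sum ending at time `n - 1` that reaches `lam`.
  set k := Nat.find hex with hk
  obtain ⟨hkn, hkl⟩ := Nat.find_spec hex
  have hmin : ∀ l < k, ‖birkhoffSum f m (l + 1) (f^[n - 1 - l] x)‖ < lam := fun l hl => by
    have := Nat.find_min hex hl
    push Not at this
    exact this (by omega)
  have hki : k ≤ n - 1 - i := Nat.find_min' hex ⟨by omega, by
    have e1 : n - 1 - i + 1 = n - i := by omega
    have e2 : n - 1 - (n - 1 - i) = i := by omega
    rw [e1, e2]
    nlinarith⟩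
  have hle : ‖birkhoffSum f m (k + 1) (f^[n - 1 - k] x)‖ ≤ lam + b := by
    rw [birkhoffSum_succ']
    refine (norm_add_le _ _).trans ?_
    have a1 : ‖m (f^[n - 1 - k] x)‖ ≤ b := h2 _ (by omega)
    have a2 : ‖birkhoffSum f m k (f (f^[n - 1 - k] x))‖ ≤ lam := by
      rw [← Function.iterate_succ_apply' f]
      rcases Nat.eq_zero_or_pos k with h0 | h0
      · rw [h0]; simpa using hl.le
      · have := hmin (k - 1) (by omega)
        have e1 : k - 1 + 1 = k := by omega
        have e2 : n - 1 - (k - 1) = (n - 1 - k).succ := by omega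
        rw [e1, e2] at this
        exact this.le
    linarith
  -- In the case of equality the sum that reaches `(M + 1) * (lam + b)` would be the stopped sum,
  -- which is at most `lam + b`.
  have hlt : i < n - 1 - k := by
    rcases (show i ≤ n - 1 - k by omega).lt_or_eq with h' | h'
    · exact h'
    · exfalso
      have e1 : n - i = k + 1 := by omega
      rw [e1, h'] at h
      nlinarith
  refine Set.mem_biUnion (Finset.mem_coe.2 (Finset.mem_range.2 hkn)) ⟨⟨?_, ?_⟩, ?_⟩
  · refine mem_crossing.2 ⟨i, hlt, ?_⟩
    have e1 : n - i = (n - 1 - k - i) + (k + 1) := by omega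
    rw [e1, birkhoffSum_add, ← Function.iterate_add_apply] at h
    have e2 : n - 1 - k - i + i = n - 1 - k := by omega
    rw [e2] at h
    have := norm_add_le (birkhoffSum f m (n - 1 - k - i) (f^[i] x))
      (birkhoffSum f m (k + 1) (f^[n - 1 - k] x))
    show (M : ℝ) * (lam + b) ≤ ‖birkhoffSum f m (n - 1 - k - i) (f^[i] x)‖
    linarith
  · exact fun l hl => h2 l (by omega)
  · refine ⟨⟨hkl, fun hc => ?_⟩, ?_⟩
    · obtain ⟨l, hl, hl'⟩ := mem_crossing.1 hc
      rw [← Function.iterate_succ_apply' f, ← Function.iterate_add_apply] at hl'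
      have := hmin (k - l - 1) (by omega)
      have e1 : k - l - 1 + 1 = k - l := by omega
      have e2 : n - 1 - (k - l - 1) = l + (n - 1 - k).succ := by omega
      rw [e1, e2] at this
      linarith
    · rw [Set.mem_preimage, ← Function.iterate_add_apply]
      have e1 : k + 1 + (n - 1 - k) = n := by omega
      rw [e1]
      exact h3

variable [MeasurableSpace X] {P : Measure X}

lemma measurable_birkhoffSum [MeasurableSpace E] [MeasurableAdd₂ E] (hf : Measurable f)
    (hm : Measurable m) (n : ℕ) : Measurable (birkhoffSum f m n) := by
  unfold birkhoffSum
  exact Finset.measurable_sum _ fun i _ => hm.comp (hf.iterate i)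

lemma memLp_birkhoffSum (hf : MeasurePreserving f P P) {q : ℝ≥0∞} (hm : MemLp m q P) (n : ℕ) :
    MemLp (birkhoffSum f m n) q P := by
  unfold birkhoffSum
  exact memLp_finsetSum _ fun i _ => hm.comp_measurePreserving (hf.iterate i)

variable [InnerProductSpace ℝ E] [MeasurableSpace E] [BorelSpace E] [SecondCountableTopology E]

lemma integrable_inner_of_memLp {g h : X → E} (hg : MemLp g 2 P) (hh : MemLp h 2 P) :
    Integrable (fun x => inner ℝ (g x) (h x)) P := by
  refine ((hg.integrable_norm_pow two_ne_zero).add (hh.integrable_norm_pow two_ne_zero)).mono'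
    (hg.1.inner hh.1) (.of_forall fun x => ?_)
  have h1 := norm_inner_le_norm (𝕜 := ℝ) (g x) (h x)
  have h2 := two_mul_le_add_sq ‖g x‖ ‖h x‖
  have h3 : 0 ≤ ‖g x‖ * ‖h x‖ := by positivity
  show _ ≤ ‖g x‖ ^ 2 + ‖h x‖ ^ 2
  linarith

/-- `m ∈ L²` is orthogonal to all functions of `f x`; so `m, m ∘ f, m ∘ f², …` are reverse
martingale differences. -/
structure IsReverseDiff (f : X → X) (P : Measure X) (m : X → E) : Prop where
  measurable : Measurable m
  memLp : MemLp m 2 P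
  orthogonal : ∀ G : X → E, MemLp G 2 P → ∫ x, inner ℝ (m x) (G (f x)) ∂P = 0

lemma measurableSet_crossing (hf : Measurable f) (hm : Measurable m) (lam : ℝ) (n : ℕ) :
    MeasurableSet (crossing f m lam n) := by
  induction n with
  | zero => exact MeasurableSet.empty
  | succ n ih =>
    exact (measurableSet_le measurable_const (measurable_birkhoffSum hf hm _).norm).union (hf ih)

variable [IsProbabilityMeasure P]

/-- Pythagoras, localised to a preimage: the mixed term vanishes because orthogonality may be tested
on `C.indicator G` in place of `G`. -/
lemma IsReverseDiff.setIntegral_norm_sq_add (hf : MeasurePreserving f P P)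
    (hm : IsReverseDiff f P m) {G : X → E} (hG : MemLp G 2 P) {C : Set X}
    (hC : MeasurableSet C) :
    ∫ x in f ⁻¹' C, ‖m x + G (f x)‖ ^ 2 ∂P =
      ∫ x in f ⁻¹' C, ‖m x‖ ^ 2 ∂P + ∫ x in C, ‖G x‖ ^ 2 ∂P := by
  have hGf : MemLp (fun x => G (f x)) 2 P := hG.comp_measurePreserving hf
  have i1 : Integrable (fun x => ‖m x‖ ^ 2) P := hm.memLp.integrable_norm_pow two_ne_zero
  have i2 : Integrable (fun x => ‖G (f x)‖ ^ 2) P := hGf.integrable_norm_pow two_ne_zero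
  have i3 : Integrable (fun x => inner ℝ (m x) (G (f x))) P := integrable_inner_of_memLp hm.memLp hGf
  have h0 : ∫ x in f ⁻¹' C, inner ℝ (m x) (G (f x)) ∂P = 0 := by
    rw [← integral_indicator (hf.measurable hC),
      ← hm.orthogonal (C.indicator G) (hG.indicator hC)]
    refine integral_congr_ae (.of_forall fun x => ?_)
    by_cases hx : f x ∈ C
    · simp [Set.indicator, hx]
    · simp [Set.indicator, hx]
  have h1 : ∫ x in f ⁻¹' C, ‖G (f x)‖ ^ 2 ∂P = ∫ x in C, ‖G x‖ ^ 2 ∂P := by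
    conv_rhs => rw [← hf.map_eq]
    rw [setIntegral_map hC _ hf.measurable.aemeasurable]
    rw [hf.map_eq]
    exact (hG.1.norm.aemeasurable.pow_const 2).aestronglyMeasurable
  calc ∫ x in f ⁻¹' C, ‖m x + G (f x)‖ ^ 2 ∂P
      = ∫ x in f ⁻¹' C, (‖m x‖ ^ 2 + 2 * inner ℝ (m x) (G (f x)) + ‖G (f x)‖ ^ 2) ∂P := by
        simp_rw [norm_add_sq_real]
    _ = _ := by
        rw [integral_add (f := fun x => ‖m x‖ ^ 2 + 2 * inner ℝ (m x) (G (f x)))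
          (show IntegrableOn (fun x => ‖m x‖ ^ 2 + 2 * inner ℝ (m x) (G (f x))) _ P from
            (i1.add (i3.const_mul 2)).integrableOn) i2.integrableOn, integral_add i1.integrableOn (i3.const_mul 2).integrableOn, integral_const_mul, h0, h1]
        ring

lemma IsReverseDiff.setIntegral_birkhoffSum_le (hf : MeasurePreserving f P P)
    (hm : IsReverseDiff f P m) {B : Set X} (hB : MeasurableSet B) {s : ℝ}
    (hs : ∀ k, ∫ x in f^[k + 1] ⁻¹' B, ‖m x‖ ^ 2 ∂P ≤ s * P.real B) (n : ℕ) :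
    ∫ x in f^[n] ⁻¹' B, ‖birkhoffSum f m n x‖ ^ 2 ∂P ≤ n * (s * P.real B) := by
  induction n with
  | zero => simp
  | succ n ih =>
    have h := hm.setIntegral_norm_sq_add hf (memLp_birkhoffSum hf hm.memLp n)
      ((hf.measurable.iterate n) hB)
    simp_rw [birkhoffSum_succ']
    rw [← Set.preimage_comp, ← Function.iterate_succ] at h
    rw [h]
    push_cast
    linarith [hs n]

/-- Kolmogorov's maximal inequality for reverse martingale differences. -/
lemma IsReverseDiff.kolmogorov (hf : MeasurePreserving f P P)
    (hm : IsReverseDiff f P m) {B : Set X} (hB : MeasurableSet B) {s lam : ℝ} (hl : 0 < lam)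
    (hs : ∀ k, ∫ x in f^[k + 1] ⁻¹' B, ‖m x‖ ^ 2 ∂P ≤ s * P.real B) (n : ℕ) :
    P.real (crossing f m lam n ∩ f^[n] ⁻¹' B) ≤ n * s / lam ^ 2 * P.real B := by
  have hS : ∀ n, Integrable (fun x => ‖birkhoffSum f m n x‖ ^ 2) P := fun n =>
    (memLp_birkhoffSum hf hm.memLp n).integrable_norm_pow two_ne_zero
  have hc := measurableSet_crossing hf.measurable hm.measurable lam
  have hBn : ∀ n, MeasurableSet (f^[n] ⁻¹' B) := fun n => (hf.measurable.iterate n) hB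
  have key : ∀ n, lam ^ 2 * P.real (crossing f m lam n ∩ f^[n] ⁻¹' B) ≤
      ∫ x in crossing f m lam n ∩ f^[n] ⁻¹' B, ‖birkhoffSum f m n x‖ ^ 2 ∂P := by
    intro n
    induction n with
    | zero => simp [crossing]
    | succ n ih =>
      set A := crossing f m lam n ∩ f^[n] ⁻¹' B
      have hA : MeasurableSet A := (hc n).inter (hBn n)
      -- On `f ⁻¹' A` the new term only adds a nonnegative amount to the second moment, so the
      -- induction hypothesis applies; on the remaining set `D` the full sum itself is at least
      -- `lam`.
      set D := (crossing f m lam (n + 1) ∩ f^[n + 1] ⁻¹' B) \ f ⁻¹' A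
      have hD : MeasurableSet D := ((hc (n + 1)).inter (hBn _)).diff (hf.measurable hA)
      have hsub : f ⁻¹' A ⊆ crossing f m lam (n + 1) ∩ f^[n + 1] ⁻¹' B := by
        rintro x ⟨h1, h2⟩
        exact ⟨Or.inr h1, by simpa [Function.iterate_succ_apply] using h2⟩
      have hun : crossing f m lam (n + 1) ∩ f^[n + 1] ⁻¹' B = f ⁻¹' A ∪ D :=
        (Set.union_sdiff_cancel hsub).symm
      have hdisj : Disjoint (f ⁻¹' A) D := Set.disjoint_sdiff_right
      rw [hun, measureReal_union hdisj hD,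
        setIntegral_union hdisj hD (hS _).integrableOn (hS _).integrableOn, mul_add]
      refine add_le_add ?_ ?_
      · simp_rw [birkhoffSum_succ']
        rw [hm.setIntegral_norm_sq_add hf (memLp_birkhoffSum hf hm.memLp n) hA,
          hf.measureReal_preimage hA.nullMeasurableSet]
        have : 0 ≤ ∫ x in f ⁻¹' A, ‖m x‖ ^ 2 ∂P := integral_nonneg fun _ => by positivity
        linarith
      · have : ∫ x in D, lam ^ 2 ∂P ≤ ∫ x in D, ‖birkhoffSum f m (n + 1) x‖ ^ 2 ∂P := by
          refine setIntegral_mono_on (integrable_const _).integrableOn (hS _).integrableOn hD ?_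
          rintro x ⟨⟨h1 | h1, h2⟩, h3⟩
          · exact pow_le_pow_left₀ hl.le h1 2
          · exact absurd ⟨h1, by simpa [Function.iterate_succ_apply] using h2⟩ h3
        simpa [mul_comm] using this
  have h1 := key n
  have h2 : ∫ x in crossing f m lam n ∩ f^[n] ⁻¹' B, ‖birkhoffSum f m n x‖ ^ 2 ∂P ≤
      ∫ x in f^[n] ⁻¹' B, ‖birkhoffSum f m n x‖ ^ 2 ∂P :=
    setIntegral_mono_set (hS n).integrableOn (.of_forall fun _ => by positivity)
      (Set.inter_subset_right.eventuallyLE)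
  have h3 := hm.setIntegral_birkhoffSum_le hf hB hs n
  rw [div_mul_eq_mul_div, le_div_iff₀ (by positivity)]
  linarith

lemma measurableSet_firstCrossing (hf : Measurable f) (hm : Measurable m) (lam : ℝ)
    {B : Set X} (hB : MeasurableSet B) (n : ℕ) :
    MeasurableSet (firstCrossing f m lam B n) :=
  ((measurableSet_le measurable_const (measurable_birkhoffSum hf hm _).norm).diff
    (hf (measurableSet_crossing hf hm lam n))).inter ((hf.iterate _) hB)

/-- The crossing event is the disjoint union of shifts of the first-crossing sets, and shifts do not
change the measure. -/
lemma sum_measureReal_firstCrossing (hf : MeasurePreserving f P P) (hm : Measurable m) (lam : ℝ)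
    {B : Set X} (hB : MeasurableSet B) (n : ℕ) :
    ∑ k ∈ Finset.range n, P.real (firstCrossing f m lam B k) =
      P.real (crossing f m lam n ∩ f^[n] ⁻¹' B) := by
  induction n with
  | zero => simp [crossing]
  | succ n ih =>
    have hc := measurableSet_crossing hf.measurable hm lam n
    have hA : MeasurableSet (crossing f m lam n ∩ f^[n] ⁻¹' B) :=
      hc.inter ((hf.measurable.iterate n) hB)
    rw [Finset.sum_range_succ, ih, ← hf.measureReal_preimage hA.nullMeasurableSet,
      ← measureReal_union _ (measurableSet_firstCrossing hf.measurable hm lam hB n)]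
    · congr 1
      ext x
      simp only [crossing, firstCrossing, Set.mem_union, Set.mem_inter_iff, Set.mem_preimage,
        Set.mem_sdiff, Set.mem_ofPred_eq, Function.iterate_succ_apply]
      tauto
    · rw [Set.disjoint_left]
      rintro x ⟨h1, _⟩ ⟨⟨_, h2⟩, _⟩
      exact h2 h1

/-- Iterated maximal inequality for reverse martingale differences with bounded conditional
variance. -/
lemma IsReverseDiff.iterated_kolmogorov (hf : MeasurePreserving f P P)
    (hm : IsReverseDiff f P m) {s lam b : ℝ} (hs0 : 0 ≤ s) (hl : 0 < lam) (hb : 0 ≤ b)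
    (hs : ∀ B, MeasurableSet B → ∫ x in f ⁻¹' B, ‖m x‖ ^ 2 ∂P ≤ s * P.real B)
    (N : ℕ) {M : ℕ} (hM : 1 ≤ M) :
    ∀ n ≤ N, ∀ B, MeasurableSet B →
      P.real (crossing f m (M * (lam + b)) n ∩ smallJumps f m b n ∩ f^[n] ⁻¹' B) ≤
        (N * s / lam ^ 2) ^ M * P.real B := by
  have hs' : ∀ B, MeasurableSet B → ∀ k, ∫ x in f^[k + 1] ⁻¹' B, ‖m x‖ ^ 2 ∂P ≤ s * P.real B := by
    intro B hB k
    have := hs (f^[k] ⁻¹' B) ((hf.measurable.iterate k) hB)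
    rwa [(hf.iterate k).measureReal_preimage hB.nullMeasurableSet, ← Set.preimage_comp,
      ← Function.iterate_succ] at this
  have hK : ∀ n ≤ N, ∀ B, MeasurableSet B →
      P.real (crossing f m lam n ∩ f^[n] ⁻¹' B) ≤ N * s / lam ^ 2 * P.real B := by
    intro n hn B hB
    refine (hm.kolmogorov hf hB hl (hs' B hB) n).trans ?_
    gcongr
  induction M, hM using Nat.le_induction with
  | base =>
    intro n hn B hB
    rw [pow_one]
    refine (measureReal_mono ?_).trans (hK n hn B hB)
    rintro x ⟨⟨h1, _⟩, h3⟩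
    refine ⟨?_, h3⟩
    obtain ⟨i, hi, h⟩ := mem_crossing.1 h1
    exact mem_crossing.2 ⟨i, hi, by push_cast at h; linarith⟩
  | succ M hM ih =>
    intro n hn B hB
    have hC := measurableSet_firstCrossing hf.measurable hm.measurable lam hB
    -- The induction hypothesis is used with `B` replaced by the first-crossing sets. Their measures
    -- add up to that of a crossing event, so each level contributes one Kolmogorov factor; this is
    -- why the estimate is carried along with an arbitrary `B`.
    calc _ ≤ P.real (⋃ k ∈ Finset.range n, crossing f m (M * (lam + b)) (n - 1 - k) ∩
        smallJumps f m b (n - 1 - k) ∩ f^[n - 1 - k] ⁻¹' firstCrossing f m lam B k) :=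
          measureReal_mono (crossing_subset_iUnion hl hb hM n B) (measure_ne_top _ _)
      _ ≤ ∑ k ∈ Finset.range n, P.real (crossing f m (M * (lam + b)) (n - 1 - k) ∩
        smallJumps f m b (n - 1 - k) ∩ f^[n - 1 - k] ⁻¹' firstCrossing f m lam B k) :=
          measureReal_biUnion_finset_le _ _
      _ ≤ ∑ k ∈ Finset.range n, (N * s / lam ^ 2) ^ M * P.real (firstCrossing f m lam B k) :=
          Finset.sum_le_sum fun k _ => ih _ (by omega) _ (hC k)
      _ = (N * s / lam ^ 2) ^ M * P.real (crossing f m lam n ∩ f^[n] ⁻¹' B) := by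
          rw [← Finset.mul_sum, sum_measureReal_firstCrossing hf hm.measurable lam hB]
      _ ≤ (N * s / lam ^ 2) ^ M * (N * s / lam ^ 2 * P.real B) := by
          gcongr
          exact hK n hn B hB
      _ = _ := by ring

end ReverseMartingale

/-! ### Distortion of full branch maps -/

section Distortion

lemma hasSum_setIntegral_fiber {α ι E : Type*} [MeasurableSpace α] [MeasurableSpace ι]
    [Countable ι] [MeasurableSingletonClass ι] [NormedAddCommGroup E] [NormedSpace ℝ E]
    {μ : Measure α} {X : α → ι} (hX : Measurable X) {A : Set α} (hA : MeasurableSet A)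
    {f : α → E} (hf : IntegrableOn f A μ) :
    HasSum (fun i => ∫ x in X ⁻¹' {i} ∩ A, f x ∂μ) (∫ x in A, f x ∂μ) := by
  have hun : ⋃ i, X ⁻¹' {i} ∩ A = A := by
    ext x
    simp
  have h := hasSum_integral_iUnion (μ := μ) (f := f) (s := fun i => X ⁻¹' {i} ∩ A)
    (fun i => (hX (measurableSet_singleton i)).inter hA)
    (fun i j hij => Set.disjoint_left.2 fun x hi hj => hij (hi.1.symm.trans hj.1))
    (by rwa [hun])
  rwa [hun] at h

lemma hasSum_measureReal_fiber {α ι : Type*} [MeasurableSpace α] [MeasurableSpace ι]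
    [Countable ι] [MeasurableSingletonClass ι] {μ : Measure α} [IsFiniteMeasure μ] {X : α → ι}
    (hX : Measurable X) {A : Set α} (hA : MeasurableSet A) :
    HasSum (fun i => μ.real (X ⁻¹' {i} ∩ A)) (μ.real A) := by
  have := hasSum_setIntegral_fiber hX hA (μ := μ) (f := fun _ => (1 : ℝ))
    (integrable_const _).integrableOn
  simpa using this

variable {α : Type*} {F : α → α} {label : α → ℕ}

/-- The labels of the first `n` points of the orbit of `x`. -/
def word (F : α → α) (label : α → ℕ) (n : ℕ) (x : α) : Fin n → ℕ := fun i => label (F^[i] x)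

/-- Each point of `B` has the same first `n` labels as each point of `B'`. -/
def Agree (F : α → α) (label : α → ℕ) (n : ℕ) (B B' : Set α) : Prop :=
  ∀ x ∈ B, ∀ x' ∈ B', ∀ i < n, label (F^[i] x) = label (F^[i] x')

lemma Agree.symm {n : ℕ} {B B' : Set α} (h : Agree F label n B B') : Agree F label n B' B :=
  fun x hx x' hx' i hi => (h x' hx' x hx i hi).symm

lemma agree_zero (B B' : Set α) : Agree F label 0 B B' := fun _ _ _ _ i hi => absurd hi (by simp)

/-- The preimage of `B` under the inverse branch with label `j`. -/
def pre (F : α → α) (label : α → ℕ) (j : ℕ) (B : Set α) : Set α := label ⁻¹' {j} ∩ F ⁻¹' B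

/-- The preimage of `B` under the inverse branch of `F^n` with word `w`. -/
def cylPre (F : α → α) (label : α → ℕ) (n : ℕ) (w : Fin n → ℕ) (B : Set α) : Set α :=
  word F label n ⁻¹' {w} ∩ F^[n] ⁻¹' B

lemma Agree.pre {n : ℕ} {B B' : Set α} (h : Agree F label n B B') (j : ℕ) :
    Agree F label (n + 1) (pre F label j B) (pre F label j B') := by
  intro x hx x' hx' i hi
  rcases i with _ | i
  · exact hx.1.trans hx'.1.symm
  · exact h _ hx.2 _ hx'.2 i (by omega)

lemma Agree.cylPre {n : ℕ} {B B' : Set α} (h : Agree F label n B B') (k : ℕ) (w : Fin k → ℕ) :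
    Agree F label (n + k) (cylPre F label k w B) (cylPre F label k w B') := by
  intro x hx x' hx' i hi
  rcases lt_or_ge i k with hik | hik
  · exact congrFun (hx.1.trans hx'.1.symm) ⟨i, hik⟩
  · have := h _ hx.2 _ hx'.2 (i - k) (by omega)
    rwa [← Function.iterate_add_apply, ← Function.iterate_add_apply, Nat.sub_add_cancel hik] at this

lemma cylPre_zero (w : Fin 0 → ℕ) (B : Set α) : cylPre F label 0 w B = B := by
  ext x
  simp only [cylPre, Set.mem_inter_iff, Set.mem_preimage, Set.mem_singleton_iff]
  exact ⟨fun h => h.2, fun h => ⟨Subsingleton.elim _ _, h⟩⟩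

lemma cylPre_succ (k : ℕ) (w : Fin (k + 1) → ℕ) (B : Set α) :
    cylPre F label (k + 1) w B = pre F label (w 0) (cylPre F label k (Fin.tail w) B) := by
  ext x
  simp only [cylPre, pre, Set.mem_inter_iff, Set.mem_preimage, Set.mem_singleton_iff,
    Function.iterate_succ_apply, ← and_assoc]
  refine and_congr_left fun _ => ⟨fun h => ⟨congrFun h 0, funext fun i => congrFun h i.succ⟩,
    fun h => funext fun i => ?_⟩
  refine Fin.cases h.1 (fun i => congrFun h.2 i) i

variable [MeasurableSpace α]

lemma measurable_word (hF : Measurable F) (hl : Measurable label) (n : ℕ) :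
    Measurable (word F label n) :=
  measurable_pi_lambda _ fun i => hl.comp (hF.iterate i)

lemma measurableSet_pre (hF : Measurable F) (hl : Measurable label) (j : ℕ) {B : Set α}
    (hB : MeasurableSet B) : MeasurableSet (pre F label j B) :=
  (hl (measurableSet_singleton j)).inter (hF hB)

lemma measurableSet_cylPre (hF : Measurable F) (hl : Measurable label) (k : ℕ) (w : Fin k → ℕ)
    {B : Set α} (hB : MeasurableSet B) : MeasurableSet (cylPre F label k w B) :=
  (measurable_word hF hl k (measurableSet_singleton w)).inter (hF.iterate k hB)

/-- The bounded distortion property of a measure under the inverse branches of `F`. -/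
def HasDistortion (F : α → α) (label : α → ℕ) (μ : Measure α) (L γ : ℝ) : Prop :=
  ∀ (j n : ℕ) (B B' : Set α), MeasurableSet B → MeasurableSet B' → Agree F label n B B' →
    μ.real (pre F label j B) * μ.real B' ≤
      Real.exp (L * γ ^ n) * (μ.real (pre F label j B') * μ.real B)

/-- Composes the ratio bounds `a / a' ≤ s * (b / b')` and `b / b' ≤ t * (c / c')` in
cross-multiplied form, so that denominators may vanish. The hypothesis `hab` covers the case in
which `b` cannot be cancelled. -/
lemma mul_le_mul_chain {a a' b b' c c' s t : ℝ} (ha' : 0 ≤ a') (hb : 0 ≤ b) (hb' : 0 ≤ b')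
    (hc : 0 ≤ c) (hc' : 0 ≤ c') (hs : 0 ≤ s) (ht : 0 ≤ t)
    (h1 : a * b' ≤ s * (a' * b)) (h2 : b * c' ≤ t * (b' * c)) (hab : b = 0 → a ≤ 0) :
    a * c' ≤ s * t * (a' * c) := by
  have hr : 0 ≤ s * t * (a' * c) := by positivity
  rcases hb.eq_or_lt with h0 | hb
  · exact (mul_nonpos_of_nonpos_of_nonneg (hab h0.symm) hc').trans hr
  rcases hb'.eq_or_lt with h0 | hb'
  · have : c' ≤ 0 := by
      rw [← h0, zero_mul, mul_zero] at h2
      exact nonpos_of_mul_nonpos_right h2 hb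
    rw [le_antisymm this hc', mul_zero]
    exact hr
  · refine le_of_mul_le_mul_right ?_ (mul_pos hb hb')
    calc a * c' * (b * b') = (a * b') * (b * c') := by ring
      _ ≤ (s * (a' * b)) * (t * (b' * c)) := by gcongr
      _ = s * t * (a' * c) * (b * b') := by ring

/-- For `n = 0` the agreement condition is empty, so a null set may be compared with the whole
space. -/
lemma HasDistortion.null {μ : Measure α} [IsFiniteMeasure μ] {L γ : ℝ}
    (h : HasDistortion F label μ L γ) (j : ℕ) {B : Set α} (hB : MeasurableSet B)
    (h0 : μ.real B = 0) : μ.real (pre F label j B) = 0 := by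
  have := h j 0 B Set.univ hB .univ (agree_zero _ _)
  rw [h0, mul_zero, mul_zero] at this
  rcases eq_zero_or_neZero μ with rfl | _
  · simp
  · exact le_antisymm (nonpos_of_mul_nonpos_left this (by
      simp [Measure.real, ENNReal.toReal_pos_iff, NeZero.ne, measure_lt_top, pos_iff_ne_zero]))
      measureReal_nonneg

/-- Each pullback adds a common label, so the distortions of the `k` successive branches are `L * γ
^ (n + i)` with `i < k`. The induction keeps the partial geometric sum and passes to `L / (1 - γ)`
only at the end. -/
lemma HasDistortion.cylPre {μ : Measure α} [IsFiniteMeasure μ] {L γ : ℝ} (hF : Measurable F)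
    (hl : Measurable label) (hL : 0 ≤ L) (hγ : 0 < γ) (hγ1 : γ < 1)
    (h : HasDistortion F label μ L γ) (k : ℕ) (w : Fin k → ℕ) (n : ℕ) (B B' : Set α)
    (hB : MeasurableSet B) (hB' : MeasurableSet B') (hBB' : Agree F label n B B') :
    μ.real (cylPre F label k w B) * μ.real B' ≤
      Real.exp (L / (1 - γ) * γ ^ n) * (μ.real (cylPre F label k w B') * μ.real B) := by
  have hγ' : 0 < 1 - γ := by linarith
  suffices H : μ.real (NUH.cylPre F label k w B) * μ.real B' ≤
      Real.exp (L * (1 - γ ^ k) / (1 - γ) * γ ^ n) *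
        (μ.real (NUH.cylPre F label k w B') * μ.real B) by
    refine H.trans ?_
    gcongr
    have : 0 ≤ γ ^ k := by positivity
    nlinarith
  induction k with
  | zero => simp [cylPre_zero, mul_comm]
  | succ k ih =>
    set C := NUH.cylPre F label k (Fin.tail w) B
    set C' := NUH.cylPre F label k (Fin.tail w) B'
    have hC : MeasurableSet C := measurableSet_cylPre hF hl _ _ hB
    have hC' : MeasurableSet C' := measurableSet_cylPre hF hl _ _ hB'
    rw [cylPre_succ, cylPre_succ]
    have h1 := h (w 0) (n + k) C C' hC hC' (hBB'.cylPre k _)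
    have e : Real.exp (L * (1 - γ ^ (k + 1)) / (1 - γ) * γ ^ n) =
        Real.exp (L * γ ^ (n + k)) * Real.exp (L * (1 - γ ^ k) / (1 - γ) * γ ^ n) := by
      rw [← Real.exp_add]
      congr 1
      field_simp
      ring
    rw [e]
    exact mul_le_mul_chain measureReal_nonneg measureReal_nonneg measureReal_nonneg
      measureReal_nonneg measureReal_nonneg (Real.exp_nonneg _) (Real.exp_nonneg _) h1
      (ih (Fin.tail w)) fun h0 => (h.null (w 0) hC h0).le

/-- The filtration generated by the labels of the orbit. -/
def wordFiltration (hF : Measurable F) (hl : Measurable label) :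
    Filtration ℕ (inferInstance : MeasurableSpace α) where
  seq n := MeasurableSpace.comap (word F label n) inferInstance
  mono' m n hmn := by
    have : word F label m = (fun w : Fin n → ℕ => fun i => w (Fin.castLE hmn i)) ∘
        word F label n := rfl
    show MeasurableSpace.comap (word F label m) inferInstance ≤ _
    rw [this, ← MeasurableSpace.comap_comp]
    exact MeasurableSpace.comap_mono (measurable_pi_lambda _ fun i => measurable_pi_apply _).comap_le
  le' n := (measurable_word hF hl n).comap_le

/-- An invariant measure which is absolutely continuous with respect to a measure with bounded
distortion has a regular density. -/
lemma HasDistortion.regular_of_invariant {ρ μ : Measure α} [IsFiniteMeasure ρ]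
    [IsFiniteMeasure μ] {L γ : ℝ} (hμ : MeasurePreserving F μ μ)
    (hl : Measurable label) (hL : 0 ≤ L) (hγ : 0 < γ) (hγ1 : γ < 1)
    (h : HasDistortion F label ρ L γ) (hac : μ ≪ ρ)
    (hgen : (inferInstance : MeasurableSpace α) ≤
      ⨆ n, MeasurableSpace.comap (word F label n) inferInstance)
    (n : ℕ) (B B' : Set α) (hB : MeasurableSet B) (hB' : MeasurableSet B')
    (hBB' : Agree F label n B B') :
    μ.real B * ρ.real B' ≤ Real.exp (L / (1 - γ) * γ ^ n) * (μ.real B' * ρ.real B) := by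
  have hF := hμ.measurable
  set g : α → ℝ := fun x => (μ.rnDeriv ρ x).toReal
  have hg : Integrable g ρ := Measure.integrable_toReal_rnDeriv
  have hgA : ∀ A, ∫ x in A, g x ∂ρ = μ.real A := fun A => Measure.setIntegral_toReal_rnDeriv hac A
  have hgm : StronglyMeasurable[⨆ n, wordFiltration hF hl n] g :=
    ((Measure.measurable_rnDeriv μ ρ).ennreal_toReal.mono hgen le_rfl).stronglyMeasurable
  have hlim := hg.tendsto_eLpNorm_condExp hgm
  -- The density conditioned on the first `N` labels. Taking the positive part makes it nonnegative
  -- everywhere and does not increase the distance to `g ≥ 0`.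
  set gN : ℕ → α → ℝ := fun N x => max ((ρ[g | wordFiltration hF hl N]) x) 0
  have hgN : ∀ N, Integrable (gN N) ρ := fun N => integrable_condExp.pos_part
  have hdiff : ∀ N (A : Set α), |∫ x in A, gN N x ∂ρ - μ.real A| ≤
      (eLpNorm (ρ[g | wordFiltration hF hl N] - g) 1 ρ).toReal := by
    intro N A
    rw [← hgA A, ← integral_sub (hgN N).integrableOn hg.integrableOn]
    have hi : Integrable (fun x => |(ρ[g | wordFiltration hF hl N]) x - g x|) ρ :=
      (integrable_condExp.sub hg).abs
    calc |∫ x in A, (gN N x - g x) ∂ρ| ≤ ∫ x in A, |gN N x - g x| ∂ρ := abs_integral_le_integral_abs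
      _ ≤ ∫ x, |gN N x - g x| ∂ρ :=
          setIntegral_le_integral ((hgN N).sub hg).abs (.of_forall fun _ => abs_nonneg _)
      _ ≤ ∫ x, |(ρ[g | wordFiltration hF hl N]) x - g x| ∂ρ := by
          refine integral_mono ((hgN N).sub hg).abs hi fun x => ?_
          have : gN N x - g x = max ((ρ[g | wordFiltration hF hl N]) x) 0 - max (g x) 0 := by
            rw [max_eq_left (show 0 ≤ g x from ENNReal.toReal_nonneg)]
          show |gN N x - g x| ≤ _
          rw [this]
          exact abs_max_sub_max_le_abs _ _ _
      _ = _ := by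
          rw [eLpNorm_one_eq_lintegral_enorm, ← integral_norm_eq_lintegral_enorm
            (integrable_condExp.sub hg).aestronglyMeasurable]
          rfl
  -- By invariance the mass of `A` is that of `F^[N] ⁻¹' A`, where `g` may be replaced by `gN N`:
  -- the error is bounded by the `L¹` distance, uniformly in the set.
  have hlim' : ∀ A : Set α, MeasurableSet A →
      Tendsto (fun N => ∫ x in F^[N] ⁻¹' A, gN N x ∂ρ) atTop (𝓝 (μ.real A)) := by
    intro A hA
    have h0 : Tendsto (fun N => (eLpNorm (ρ[g | wordFiltration hF hl N] - g) 1 ρ).toReal)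
        atTop (𝓝 0) := by
      have := (ENNReal.tendsto_toReal ENNReal.zero_ne_top).comp hlim
      simpa [Function.comp_def] using this
    rw [tendsto_iff_norm_sub_tendsto_zero]
    refine squeeze_zero (fun _ => norm_nonneg _) (fun N => ?_) h0
    have := hdiff N (F^[N] ⁻¹' A)
    rwa [(hμ.iterate N).measureReal_preimage hA.nullMeasurableSet] at this
  refine le_of_tendsto_of_tendsto ((hlim' B hB).mul_const _)
    (((hlim' B' hB').mul_const _).const_mul _) (.of_forall fun N => ?_)
  obtain ⟨c, -, hc⟩ := (stronglyMeasurable_condExp (μ := ρ) (f := g)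
    (m := wordFiltration hF hl N)).exists_eq_measurable_comp
  have hgc : ∀ x, gN N x = max (c (word F label N x)) 0 := fun x => by
    show max ((ρ[g | wordFiltration hF hl N]) x) 0 = _
    rw [hc]; rfl
  -- As `gN N` is constant on cylinders of length `N`, the approximate mass of `A` is a nonnegative
  -- combination of the measures of its pullbacks by the branches of `F^[N]`. All of these have the
  -- same regularity, which survives the sum and the limit.
  have hsum : ∀ A : Set α, MeasurableSet A →
      HasSum (fun w => max (c w) 0 * ρ.real (NUH.cylPre F label N w A))
        (∫ x in F^[N] ⁻¹' A, gN N x ∂ρ) := by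
    intro A hA
    refine (hasSum_setIntegral_fiber (measurable_word hF hl N) (hF.iterate N hA)
      (hgN N).integrableOn).congr_fun fun w => ?_
    rw [show word F label N ⁻¹' {w} ∩ F^[N] ⁻¹' A = NUH.cylPre F label N w A from rfl,
      setIntegral_congr_fun (measurableSet_cylPre hF hl N w hA)
        (g := fun _ => max (c w) 0) (fun x hx => by simp only [hgc, show word F label N x = w from hx.1])]
    simp [mul_comm]
  refine hasSum_le (fun w => ?_) ((hsum B hB).mul_right _)
    (((hsum B' hB').mul_right (ρ.real B)).mul_left _)
  have := h.cylPre hF hl hL hγ hγ1 N w n B B' hB hB' hBB'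
  have h0 : 0 ≤ max (c w) 0 := le_max_right _ _
  nlinarith [mul_le_mul_of_nonneg_left this h0]

/-- The change of a ratio of `μ`-measures along a branch is composed of a density ratio on the
preimages, the distortion of `ρ`, and a density ratio on the images. Each factor is at most `exp (L
/ (1 - γ) * γ ^ n)`, whence the 3. -/
lemma HasDistortion.of_invariant {ρ μ : Measure α} [IsFiniteMeasure ρ]
    [IsFiniteMeasure μ] {L γ : ℝ} (hμ : MeasurePreserving F μ μ)
    (hl : Measurable label) (hL : 0 ≤ L) (hγ : 0 < γ) (hγ1 : γ < 1)
    (h : HasDistortion F label ρ L γ) (hac : μ ≪ ρ)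
    (hgen : (inferInstance : MeasurableSpace α) ≤
      ⨆ n, MeasurableSpace.comap (word F label n) inferInstance) :
    HasDistortion F label μ (3 * (L / (1 - γ))) γ := by
  intro j n B B' hB hB' hBB'
  have hF := hμ.measurable
  have hL' : 0 ≤ L / (1 - γ) := div_nonneg hL (by linarith)
  have hreg := h.regular_of_invariant hμ hl hL hγ hγ1 hac hgen
  have hj := measurableSet_pre hF hl j hB
  have hj' := measurableSet_pre hF hl j hB'
  have hzero : ∀ A : Set α, ρ.real A = 0 → μ.real A = 0 := fun A hA => by
    rw [measureReal_def, ENNReal.toReal_eq_zero_iff] at hA ⊢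
    exact Or.inl (hac (hA.resolve_right (measure_ne_top _ _)))
  have h1 := hreg (n + 1) _ _ hj hj' (hBB'.pre j)
  have h2 := h j n B B' hB hB' hBB'
  have h3 := hreg n B' B hB' hB hBB'.symm
  have h4 := mul_le_mul_chain measureReal_nonneg measureReal_nonneg measureReal_nonneg
    measureReal_nonneg measureReal_nonneg (Real.exp_nonneg _) (Real.exp_nonneg _) h1 h2
    fun h0 => (hzero _ h0).le
  have h5 := mul_le_mul_chain (a := μ.real (NUH.pre F label j B)) (c' := μ.real B')
    measureReal_nonneg measureReal_nonneg measureReal_nonneg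
    measureReal_nonneg measureReal_nonneg (by positivity) (Real.exp_nonneg _) h4
    (show ρ.real B * μ.real B' ≤ Real.exp (L / (1 - γ) * γ ^ n) * (ρ.real B' * μ.real B) by
      linarith)
    fun h0 => (hzero _ (h.null j hB h0)).le
  refine h5.trans (mul_le_mul_of_nonneg_right ?_ (by positivity))
  rw [← Real.exp_add, ← Real.exp_add, Real.exp_le_exp]
  have a1 : γ ^ (n + 1) ≤ γ ^ n := pow_le_pow_of_le_one hγ.le hγ1.le n.le_succ
  have a2 : L ≤ L / (1 - γ) := by
    rw [le_div_iff₀ (by linarith)]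
    nlinarith
  have a3 : 0 ≤ γ ^ n := by positivity
  nlinarith [mul_le_mul_of_nonneg_left a1 hL', mul_le_mul_of_nonneg_right a2 a3]

end Distortion

/-! ### Exponential mixing of cylinders -/

section Mixing

variable {α : Type*} [MeasurableSpace α] {F : α → α} {label : α → ℕ} {μ : Measure α} {L γ : ℝ}

/-- A full branch map which preserves a measure with bounded distortion. -/
structure GibbsMarkov (F : α → α) (label : α → ℕ) (μ : Measure α) (L γ : ℝ) : Prop where
  preserves : MeasurePreserving F μ μ
  measurable_label : Measurable label
  L_nonneg : 0 ≤ L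
  γ_pos : 0 < γ
  γ_lt_one : γ < 1
  distortion : HasDistortion F label μ L γ

lemma GibbsMarkov.measurable (h : GibbsMarkov F label μ L γ) : Measurable F :=
  h.preserves.measurable

/-- A normalised content, additive over countable measurable partitions, which has a regular
density with respect to `μ`. -/
structure IsRegular (F : α → α) (label : α → ℕ) (μ : Measure α) (γ K : ℝ) (ν : Set α → ℝ) :
    Prop where
  nonneg : ∀ A, MeasurableSet A → 0 ≤ ν A
  univ : ν Set.univ = 1
  hasSum : ∀ (X : α → ℕ) (A : Set α), Measurable X → MeasurableSet A →
    HasSum (fun j => ν (X ⁻¹' {j} ∩ A)) (ν A)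
  regular : ∀ (n : ℕ) (B B' : Set α), MeasurableSet B → MeasurableSet B' → Agree F label n B B' →
    ν B * μ.real B' ≤ Real.exp (K * γ ^ n) * (ν B' * μ.real B)

variable [IsProbabilityMeasure μ] {K : ℝ} {ν : Set α → ℝ}

lemma IsRegular.le (h : IsRegular F label μ γ K ν) {A : Set α} (hA : MeasurableSet A) :
    ν A ≤ Real.exp K * μ.real A := by
  simpa [h.univ] using h.regular 0 A Set.univ hA .univ (agree_zero _ _)

lemma IsRegular.ge (h : IsRegular F label μ γ K ν) {A : Set α} (hA : MeasurableSet A) :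
    μ.real A ≤ Real.exp K * ν A := by
  simpa [h.univ] using h.regular 0 Set.univ A .univ hA (agree_zero _ _)

lemma IsRegular.mono (h : IsRegular F label μ γ K ν) {K' : ℝ} (hγ : 0 ≤ γ) (hK : K ≤ K') :
    IsRegular F label μ γ K' ν where
  nonneg := h.nonneg
  univ := h.univ
  hasSum := h.hasSum
  regular n B B' hB hB' hBB' := (h.regular n B B' hB hB' hBB').trans <| by
    have := h.nonneg B' hB'
    gcongr

/-- Pullbacks by a branch share one more label, so the old regularity constant is multiplied by `γ`;
the distortion of the branch adds `L`. -/
lemma IsRegular.push (hG : GibbsMarkov F label μ L γ) (h : IsRegular F label μ γ K ν) :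
    IsRegular F label μ γ (γ * K + L) (fun A => ν (F ⁻¹' A)) where
  nonneg A hA := h.nonneg _ (hG.measurable hA)
  univ := h.univ
  hasSum X A hX hA := h.hasSum (X ∘ F) (F ⁻¹' A) (hX.comp hG.measurable) (hG.measurable hA)
  regular n B B' hB hB' hBB' := by
    have hs : ∀ A, MeasurableSet A → HasSum (fun j => ν (pre F label j A)) (ν (F ⁻¹' A)) :=
      fun A hA => h.hasSum label (F ⁻¹' A) hG.measurable_label (hG.measurable hA)
    refine hasSum_le (fun j => ?_) ((hs B hB).mul_right _)
      (((hs B' hB').mul_right (μ.real B)).mul_left _)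
    have hj := measurableSet_pre hG.measurable hG.measurable_label j hB
    have hj' := measurableSet_pre hG.measurable hG.measurable_label j hB'
    have h1 := h.regular (n + 1) _ _ hj hj' (hBB'.pre j)
    have h2 := hG.distortion j n B B' hB hB' hBB'
    have h3 := mul_le_mul_chain (h.nonneg _ hj') measureReal_nonneg measureReal_nonneg
      measureReal_nonneg measureReal_nonneg (Real.exp_nonneg _) (Real.exp_nonneg _) h1 h2
      fun h0 => by simpa [h0] using h.le hj
    rw [← Real.exp_add] at h3
    rwa [show K * γ ^ (n + 1) + L * γ ^ n = (γ * K + L) * γ ^ n by ring] at h3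

lemma IsRegular.push_iterate (hG : GibbsMarkov F label μ L γ) (h : IsRegular F label μ γ K ν)
    (k : ℕ) : IsRegular F label μ γ (γ ^ k * K + L / (1 - γ)) (fun A => ν (F^[k] ⁻¹' A)) := by
  have hγ : 0 < 1 - γ := by linarith [hG.γ_lt_one]
  induction k with
  | zero =>
    refine IsRegular.mono (by simpa using h) hG.γ_pos.le ?_
    have := div_nonneg hG.L_nonneg hγ.le
    simpa using this
  | succ k ih =>
    have := ih.push hG
    refine IsRegular.mono (K := γ * (γ ^ k * K + L / (1 - γ)) + L) ?_ hG.γ_pos.le ?_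
    · simpa only [← Set.preimage_comp, ← Function.iterate_succ'] using this
    · refine le_of_eq ?_
      field_simp
      ring

/-- The density is at least `exp (-K)`, and only half of this lower bound is removed. What remains
is comparable to the original density, and the regularity constant at most doubles. -/
lemma IsRegular.sub (hG : GibbsMarkov F label μ L γ) (hK : 0 ≤ K)
    (h : IsRegular F label μ γ K ν) :
    IsRegular F label μ γ (2 * K) (fun A => (ν A - Real.exp (-K) / 2 * μ.real A) /
      (1 - Real.exp (-K) / 2)) := by
  set κ := Real.exp (-K) / 2 with hκ
  have hκ0 : 0 < κ := by positivity
  have hκ1 : κ ≤ 1 / 2 := by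
    have : Real.exp (-K) ≤ 1 := Real.exp_le_one_iff.2 (by linarith)
    linarith
  have hd : 0 < 1 - κ := by linarith
  have hlow : ∀ A, MeasurableSet A → 2 * κ * μ.real A ≤ ν A := fun A hA => by
    have := mul_le_mul_of_nonneg_left (h.ge hA) (Real.exp_nonneg (-K))
    rw [← mul_assoc, ← Real.exp_add, neg_add_cancel, Real.exp_zero, one_mul] at this
    rw [hκ]
    linarith
  constructor
  · intro A hA
    have : 0 ≤ μ.real A := measureReal_nonneg
    refine div_nonneg ?_ hd.le
    nlinarith [hlow A hA]
  · rw [h.univ, probReal_univ, mul_one, div_self hd.ne']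
  · intro X A hX hA
    exact ((h.hasSum X A hX hA).sub (HasSum.mul_left _
      (hasSum_measureReal_fiber hX hA))).div_const _
  · intro n B B' hB hB' hBB'
    have h1 := h.regular n B B' hB hB' hBB'
    have hb : 0 ≤ μ.real B := measureReal_nonneg
    have hb' : 0 ≤ μ.real B' := measureReal_nonneg
    have h2 := mul_le_mul_of_nonneg_right (hlow B' hB') hb
    set e := Real.exp (K * γ ^ n)
    have he : 1 ≤ e := Real.one_le_exp (by have := hG.γ_pos; positivity)
    have he2 : Real.exp (2 * K * γ ^ n) = e ^ 2 := by
      rw [← Real.exp_nat_mul]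
      congr 1
      push_cast
      ring
    show (ν B - κ * μ.real B) / (1 - κ) * μ.real B' ≤
      Real.exp (2 * K * γ ^ n) * ((ν B' - κ * μ.real B') / (1 - κ) * μ.real B)
    rw [he2, div_mul_eq_mul_div (ν B - κ * μ.real B), div_mul_eq_mul_div (ν B' - κ * μ.real B'),
      ← mul_div_assoc, div_le_div_iff_of_pos_right hd]
    -- Once `2 * κ * μ B' ≤ ν B'` is used, the claim reduces to `(e² - 1) / 2 ≤ e² - e`, that is, to
    -- `(e - 1)² ≥ 0`.
    have h3 : 0 ≤ (e - 1) ^ 2 * (ν B' * μ.real B) :=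
      mul_nonneg (sq_nonneg _) (mul_nonneg (h.nonneg B' hB') hb)
    have h4 : 0 ≤ (e ^ 2 - 1) * (ν B' * μ.real B - 2 * κ * μ.real B' * μ.real B) :=
      mul_nonneg (by nlinarith) (by linarith)
    nlinarith

/-- The distortion constant that is preserved by the coupling. -/
noncomputable def couplingConst (L γ : ℝ) : ℝ := 2 * (L / (1 - γ))

/-- The proportion of mass that is coupled in one step. -/
noncomputable def couplingMass (L γ : ℝ) : ℝ := Real.exp (-couplingConst L γ) / 2

lemma GibbsMarkov.couplingConst_nonneg (hG : GibbsMarkov F label μ L γ) :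
    0 ≤ couplingConst L γ :=
  mul_nonneg zero_le_two (div_nonneg hG.L_nonneg (by linarith [hG.γ_lt_one]))

lemma couplingMass_pos : 0 < couplingMass L γ := by unfold couplingMass; positivity

lemma couplingMass_le (h : 0 ≤ couplingConst L γ) : couplingMass L γ ≤ 1 / 2 := by
  have : Real.exp (-couplingConst L γ) ≤ 1 := Real.exp_le_one_iff.2 (by linarith)
  unfold couplingMass
  linarith

/-- In each round a fixed fraction of the remaining mass is split off as a multiple of `μ`, and the
rest is pushed forward `r` times. With `K = couplingConst L γ` its constant becomes `2 * γ ^ r * K +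
L / (1 - γ) ≤ K / 2 + K / 2`, so the next round can start from the same class. -/
lemma IsRegular.exists_coupling (hG : GibbsMarkov F label μ L γ)
    (h : IsRegular F label μ γ (couplingConst L γ) ν) {r : ℕ} (hr : 4 * γ ^ r ≤ 1) (k : ℕ) :
    ∃ ν', IsRegular F label μ γ (couplingConst L γ) ν' ∧ ∀ A, MeasurableSet A →
      ν (F^[r * k] ⁻¹' A) = (1 - (1 - couplingMass L γ) ^ k) * μ.real A +
        (1 - couplingMass L γ) ^ k * ν' A := by
  have hK := hG.couplingConst_nonneg
  have hd : 0 < 1 - couplingMass L γ := by linarith [couplingMass_le hK]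
  induction k with
  | zero => exact ⟨ν, h, fun A _ => by simp⟩
  | succ k ih =>
    obtain ⟨ν', hν', hk⟩ := ih
    refine ⟨_, ((hν'.sub hG hK).push_iterate hG r).mono (K' := couplingConst L γ) hG.γ_pos.le ?_,
      fun A hA => ?_⟩
    · have : 0 ≤ L / (1 - γ) := div_nonneg hG.L_nonneg (by linarith [hG.γ_lt_one])
      unfold couplingConst
      nlinarith
    · have hA' := hG.measurable.iterate r hA
      have := hk _ hA'
      rw [← Set.preimage_comp, ← Function.iterate_add,
        (hG.preserves.iterate r).measureReal_preimage hA.nullMeasurableSet] at this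
      rw [mul_add_one, add_comm (r * k) r, this]
      show _ = _ + _ * ((ν' (F^[r] ⁻¹' A) - couplingMass L γ * μ.real (F^[r] ⁻¹' A)) /
        (1 - couplingMass L γ))
      rw [(hG.preserves.iterate r).measureReal_preimage hA.nullMeasurableSet]
      field_simp
      ring

/-- The rate of mixing. -/
noncomputable def mixRate (L γ : ℝ) (r i : ℕ) : ℝ :=
  (1 - couplingMass L γ) ^ (i / r) * Real.exp (couplingConst L γ)

/-- Only the uncoupled mass deviates from `μ`, and its density lies between `0` and `exp
(couplingConst L γ)`. The remainder `i % r` is absorbed into the test set. -/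
lemma IsRegular.mixing (hG : GibbsMarkov F label μ L γ)
    (h : IsRegular F label μ γ (couplingConst L γ) ν) {r : ℕ} (hr : 4 * γ ^ r ≤ 1) (i : ℕ)
    {A : Set α} (hA : MeasurableSet A) :
    |ν (F^[i] ⁻¹' A) - μ.real A| ≤ mixRate L γ r i * μ.real A := by
  have hK := hG.couplingConst_nonneg
  obtain ⟨ν', hν', hk⟩ := h.exists_coupling hG hr (i / r)
  have hA' := hG.measurable.iterate (i % r) hA
  have e : F^[i] ⁻¹' A = F^[r * (i / r)] ⁻¹' (F^[i % r] ⁻¹' A) := by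
    rw [← Set.preimage_comp, ← Function.iterate_add, Nat.mod_add_div]
  have h1 := hk _ hA'
  have h2 := hν'.le hA'
  have h3 := hν'.nonneg _ hA'
  rw [(hG.preserves.iterate _).measureReal_preimage hA.nullMeasurableSet] at h1 h2
  rw [e, h1, mixRate]
  have hb : 0 ≤ μ.real A := measureReal_nonneg
  have hp : 0 ≤ (1 - couplingMass L γ) ^ (i / r) :=
    pow_nonneg (by linarith [couplingMass_le hK]) _
  have he : 1 ≤ Real.exp (couplingConst L γ) := Real.one_le_exp hK
  rw [show ∀ p a b : ℝ, (1 - p) * a + p * b - a = p * (b - a) by intros; ring, abs_mul,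
    abs_of_nonneg hp, mul_assoc]
  refine mul_le_mul_of_nonneg_left ?_ hp
  rw [abs_le]
  constructor <;> nlinarith

/-- Bounded distortion of the inverse branch of `F^[n]` says that the normalised measure on a
cylinder, pushed forward by `F^[n]`, is regular. This makes it a starting point for the coupling. -/
lemma GibbsMarkov.isRegular_cylinder (hG : GibbsMarkov F label μ L γ) {n : ℕ} {w : Fin n → ℕ}
    (hw : 0 < μ.real (word F label n ⁻¹' {w})) :
    IsRegular F label μ γ (couplingConst L γ)
      (fun A => μ.real (cylPre F label n w A) / μ.real (word F label n ⁻¹' {w})) := by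
  have hF := hG.measurable
  refine IsRegular.mono (K := L / (1 - γ)) ?_ hG.γ_pos.le ?_
  · constructor
    · exact fun A _ => by positivity
    · simp only [cylPre, Set.preimage_univ, Set.inter_univ]
      exact div_self hw.ne'
    · intro X A hX hA
      refine HasSum.div_const ((hasSum_measureReal_fiber (μ := μ) (hX.comp (hF.iterate n))
        (measurableSet_cylPre hF hG.measurable_label n w hA)).congr_fun fun j => ?_) _
      congr 1
      ext x
      simp only [cylPre, Set.mem_inter_iff, Set.mem_preimage, Function.comp]
      tauto
    · intro m B B' hB hB' hBB'
      have := hG.distortion.cylPre hF hG.measurable_label hG.L_nonneg hG.γ_pos hG.γ_lt_one n w m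
        B B' hB hB' hBB'
      rw [div_mul_eq_mul_div (c := μ.real B'), div_mul_eq_mul_div (c := μ.real B),
        ← mul_div_assoc, div_le_div_iff_of_pos_right hw]
      exact this
  · have : 0 ≤ L / (1 - γ) := div_nonneg hG.L_nonneg (by linarith [hG.γ_lt_one])
    unfold couplingConst
    linarith

lemma GibbsMarkov.cylinder_mixing (hG : GibbsMarkov F label μ L γ) {r : ℕ} (hr : 4 * γ ^ r ≤ 1)
    (n i : ℕ) (w : Fin n → ℕ) {A : Set α} (hA : MeasurableSet A) :
    |μ.real (word F label n ⁻¹' {w} ∩ F^[i + n] ⁻¹' A) -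
      μ.real (word F label n ⁻¹' {w}) * μ.real A| ≤
      mixRate L γ r i * (μ.real (word F label n ⁻¹' {w}) * μ.real A) := by
  rcases (measureReal_nonneg (μ := μ) (s := word F label n ⁻¹' {w})).eq_or_lt with h0 | h0
  · have : μ.real (word F label n ⁻¹' {w} ∩ F^[i + n] ⁻¹' A) = 0 :=
      le_antisymm ((measureReal_mono Set.inter_subset_left).trans h0.symm.le) measureReal_nonneg
    simp [this, ← h0]
  · have h := (hG.isRegular_cylinder h0).mixing hG hr i hA
    have e : cylPre F label n w (F^[i] ⁻¹' A) = word F label n ⁻¹' {w} ∩ F^[i + n] ⁻¹' A := by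
      rw [cylPre, ← Set.preimage_comp, ← Function.iterate_add]
    rw [e] at h
    have h' := mul_le_mul_of_nonneg_left h h0.le
    rw [← abs_of_pos h0, ← abs_mul, abs_of_pos h0, mul_sub, mul_div_cancel₀ _ h0.ne'] at h'
    linarith

/-- `F^[n]` pushes the measure of a cylinder into a multiple of `μ`. -/
lemma GibbsMarkov.cylinder_le (hG : GibbsMarkov F label μ L γ) (n i : ℕ) (w : Fin n → ℕ)
    {A : Set α} (hA : MeasurableSet A) :
    μ.real (word F label n ⁻¹' {w} ∩ F^[i + n] ⁻¹' A) ≤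
      Real.exp (couplingConst L γ) * (μ.real (word F label n ⁻¹' {w}) * μ.real A) := by
  rcases (measureReal_nonneg (μ := μ) (s := word F label n ⁻¹' {w})).eq_or_lt with h0 | h0
  · have : μ.real (word F label n ⁻¹' {w} ∩ F^[i + n] ⁻¹' A) = 0 :=
      le_antisymm ((measureReal_mono Set.inter_subset_left).trans h0.symm.le) measureReal_nonneg
    simp [this, ← h0]
  · have h := (hG.isRegular_cylinder h0).le (hG.measurable.iterate i hA)
    have e : cylPre F label n w (F^[i] ⁻¹' A) = word F label n ⁻¹' {w} ∩ F^[i + n] ⁻¹' A := by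
      rw [cylPre, ← Set.preimage_comp, ← Function.iterate_add]
    rw [e, (hG.preserves.iterate i).measureReal_preimage hA.nullMeasurableSet, div_le_iff₀ h0] at h
    linarith

lemma summable_mixRate (h : 0 ≤ couplingConst L γ) {r : ℕ} (hr : 0 < r) :
    Summable (mixRate L γ r) := by
  unfold mixRate
  refine Summable.mul_right _ ?_
  have h0 := couplingMass_pos (L := L) (γ := γ)
  have h1 := couplingMass_le h
  have h2 : Summable fun k : ℕ => (1 - couplingMass L γ) ^ k :=
    summable_geometric_of_lt_one (by linarith) (by linarith)
  -- Each power of `1 - couplingMass L γ` occurs `r` times, once for each remainder modulo `r`.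
  have : NeZero r := ⟨hr.ne'⟩
  have h3 : Summable fun p : ℕ × Fin r => (1 - couplingMass L γ) ^ p.1 := by
    rw [summable_prod_of_nonneg fun _ => pow_nonneg (by linarith) _]
    refine ⟨fun _ => (hasSum_fintype _).summable, ?_⟩
    simpa [tsum_fintype] using h2.mul_left (r : ℝ)
  refine ((Nat.divModEquiv r).symm.summable_iff).1 ?_
  refine h3.congr fun p => ?_
  simp only [Function.comp]
  congr 1
  exact (congrArg Prod.fst ((Nat.divModEquiv r).apply_symm_apply p)).symm

end Mixing

/-! ### Martingale-coboundary decomposition with bounded coboundary -/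

section Corrector

variable {α E : Type*} [MeasurableSpace α] {μ : Measure α} [IsProbabilityMeasure μ] {F : α → α}
  [NormedAddCommGroup E] [InnerProductSpace ℝ E] [CompleteSpace E] [MeasurableSpace E]
  [BorelSpace E] [SecondCountableTopology E]

/-- Testing on indicators bounds `inner e (g x)` by `‖e‖ * r` almost everywhere for each fixed `e`.
A countable dense set of `e` and continuity give this for all `e` at once, in particular for `e = g
x`. -/
lemma ae_norm_le_of_inner_indicator_le {g : Lp E 2 μ} {r : ℝ} (hr : 0 ≤ r)
    (h : ∀ (A : Set α) (hA : MeasurableSet A) (e : E),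
      inner ℝ (indicatorConstLp 2 hA (measure_ne_top μ A) e) g ≤ ‖e‖ * (r * μ.real A)) :
    ∀ᵐ x ∂μ, ‖g x‖ ≤ r := by
  have hg : Integrable (g : α → E) μ := (Lp.memLp g).integrable one_le_two
  have h1 : ∀ e : E, ∀ᵐ x ∂μ, inner ℝ e (g x) ≤ ‖e‖ * r := by
    intro e
    refine ae_le_of_forall_setIntegral_le (hg.const_inner e) (integrable_const _)
      fun A hA _ => ?_
    have := h A hA e
    rw [L2.inner_indicatorConstLp_eq_inner_setIntegral, ← integral_inner hg.integrableOn] at this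
    refine this.trans (le_of_eq ?_)
    simp only [integral_const, MeasurableSet.univ, measureReal_restrict_apply, Set.univ_inter,
      smul_eq_mul]
    ring
  have h2 : ∀ᵐ x ∂μ, ∀ i : ℕ, inner ℝ (TopologicalSpace.denseSeq E i) (g x) ≤
      ‖TopologicalSpace.denseSeq E i‖ * r := ae_all_iff.2 fun i => h1 _
  filter_upwards [h2] with x hx
  have hcl : IsClosed {e : E | inner ℝ e (g x) ≤ ‖e‖ * r} :=
    isClosed_le (by fun_prop) (by fun_prop)
  have : g x ∈ {e : E | inner ℝ e (g x) ≤ ‖e‖ * r} := by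
    have hd : closure (Set.range (TopologicalSpace.denseSeq E)) ⊆
        {e : E | inner ℝ e (g x) ≤ ‖e‖ * r} :=
      closure_minimal (by rintro _ ⟨i, rfl⟩; exact hx i) hcl
    exact hd ((TopologicalSpace.denseRange_denseSeq E) _)
  have h3 : ‖g x‖ * ‖g x‖ ≤ ‖g x‖ * r := by
    simpa [real_inner_self_eq_norm_mul_norm, sq] using this
  rcases (norm_nonneg (g x)).eq_or_lt with h0 | h0
  · exact h0.symm.le.trans hr
  · exact le_of_mul_le_mul_left h3 h0

/-- If the correlations of `Φ` with functions of `F^{j+1}` decay summably in the sense of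
`hdec`, then `Φ` is a reverse martingale difference up to a bounded coboundary. -/
lemma exists_bounded_corrector (hF : MeasurePreserving F μ μ) {Φ : α → E} (hΦ : MemLp Φ 2 μ)
    {ρ : ℕ → ℝ} {R : ℝ} (hρ : ∀ j, 0 ≤ ρ j) (hR : ∀ N, ∑ j ∈ Finset.range N, ρ j ≤ R)
    (hdec : ∀ (j : ℕ) (A : Set α), MeasurableSet A →
      ‖∫ x in F^[j + 1] ⁻¹' A, Φ x ∂μ‖ ≤ ρ j * μ.real A) :
    ∃ χ : α → E, Measurable χ ∧ (∀ x, ‖χ x‖ ≤ R) ∧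
      ∀ G : α → E, MemLp G 2 μ → ∫ x, inner ℝ (Φ x + χ x - χ (F x)) (G (F x)) ∂μ = 0 := by
  have hR0 : 0 ≤ R := by simpa using hR 0
  have hsum : Summable ρ := summable_of_sum_range_le hρ hR
  -- `U` is the Koopman operator and its adjoint `P` is the transfer operator. Pairing `P^[j + 1] Φ`
  -- with an indicator integrates `Φ` over a preimage, so `hdec` is a supremum bound by `ρ j`.
  let U : Lp E 2 μ →ₗᵢ[ℝ] Lp E 2 μ := Lp.compMeasurePreservingₗᵢ ℝ F hF
  let Uc : Lp E 2 μ →L[ℝ] Lp E 2 μ := U.toContinuousLinearMap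
  let P : Lp E 2 μ →L[ℝ] Lp E 2 μ := ContinuousLinearMap.adjoint Uc
  have hP : ∀ f g : Lp E 2 μ, inner ℝ g (P f) = inner ℝ (Uc g) f := fun f g =>
    ContinuousLinearMap.adjoint_inner_right Uc g f
  have hPU : ∀ f : Lp E 2 μ, P (Uc f) = f := fun f =>
    ext_inner_left ℝ fun g => by rw [hP]; exact U.inner_map_map g f
  have hU : ∀ (k : ℕ) (A : Set α) (hA : MeasurableSet A) (e : E),
      Uc^[k] (indicatorConstLp 2 hA (measure_ne_top μ A) e) =
        indicatorConstLp 2 (hF.measurable.iterate k hA) (measure_ne_top μ _) e := by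
    intro k
    induction k with
    | zero => intro A hA e; rfl
    | succ k ih =>
      intro A hA e
      rw [Function.iterate_succ_apply', ih]
      rfl
  have hPk : ∀ (k : ℕ) (f g : Lp E 2 μ), inner ℝ g (P^[k] f) = inner ℝ (Uc^[k] g) f := by
    intro k
    induction k with
    | zero => intro f g; rfl
    | succ k ih =>
      intro f g
      rw [Function.iterate_succ_apply' (f := P), hP, ih, Function.iterate_succ_apply]
  let φ : Lp E 2 μ := hΦ.toLp Φ
  let p : ℕ → Lp E 2 μ := fun j => P^[j + 1] φ
  have hp : ∀ (j : ℕ) (A : Set α) (hA : MeasurableSet A) (e : E),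
      inner ℝ (indicatorConstLp 2 hA (measure_ne_top μ A) e) (p j) ≤ ‖e‖ * (ρ j * μ.real A) := by
    intro j A hA e
    rw [hPk, hU, L2.inner_indicatorConstLp_eq_inner_setIntegral]
    refine (real_inner_le_norm _ _).trans (mul_le_mul_of_nonneg_left ?_ (norm_nonneg e))
    rw [setIntegral_congr_ae (g := Φ) (hF.measurable.iterate _ hA)
      (hΦ.coeFn_toLp.mono fun x hx _ => hx)]
    exact hdec j A hA
  have hpn : ∀ j, ‖p j‖ ≤ ρ j := fun j => by
    have := Lp.norm_le_of_ae_bound (hρ j) (ae_norm_le_of_inner_indicator_le (hρ j) (hp j))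
    simpa [measureUnivNNReal] using this
  have hps : Summable p := Summable.of_norm_bounded hsum hpn
  -- The sum of `P^[j] Φ` over `j ≥ 1` satisfies `P (Φ + χ') = χ'`. As `P U = 1`, the operator `P`
  -- annihilates `Φ + χ' - U χ'`, which is the orthogonality required.
  let χ' : Lp E 2 μ := ∑' j, p j
  have hχ' : ∀ᵐ x ∂μ, ‖χ' x‖ ≤ R := by
    refine ae_norm_le_of_inner_indicator_le hR0 fun A hA e => ?_
    have h1 : HasSum (fun j => inner ℝ (indicatorConstLp 2 hA (measure_ne_top μ A) e) (p j))
        (inner ℝ (indicatorConstLp 2 hA (measure_ne_top μ A) e) χ') :=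
      (innerSL ℝ (indicatorConstLp 2 hA (measure_ne_top μ A) e)).hasSum hps.hasSum
    refine (hasSum_le (fun j => hp j A hA e) h1
      ((hsum.hasSum.mul_right (μ.real A)).mul_left ‖e‖)).trans ?_
    have := Real.tsum_le_of_sum_range_le hρ hR
    gcongr
  have hPχ : P (φ + χ') = χ' := by
    have h1 : P χ' = ∑' j, p (j + 1) := by
      rw [P.map_tsum hps]
      refine tsum_congr fun j => ?_
      exact (Function.iterate_succ_apply' P (j + 1) φ).symm
    rw [map_add, h1]
    exact (hps.tsum_eq_zero_add).symm
  -- A modification on a null set, so that the bound holds at every point.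
  let χ : α → E := fun x => if ‖χ' x‖ ≤ R then χ' x else 0
  have hχm : Measurable χ' := (Lp.stronglyMeasurable χ').measurable
  refine ⟨χ, Measurable.ite (measurableSet_le hχm.norm measurable_const) hχm measurable_const,
    fun x => ?_, fun G hG => ?_⟩
  · by_cases hx : ‖χ' x‖ ≤ R
    · simp [χ, hx]
    · simpa [χ, hx] using hR0
  · have hχe : ∀ᵐ x ∂μ, χ x = χ' x := hχ'.mono fun x hx => by simp [χ, hx]
    have hχF : ∀ᵐ x ∂μ, χ (F x) = χ' (F x) := hF.quasiMeasurePreserving.ae hχe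
    have h0 : inner ℝ (Uc (hG.toLp G)) (φ + χ' - Uc χ') = 0 := by
      rw [← hP, map_sub, hPχ, hPU, sub_self, inner_zero_right]
    rw [L2.inner_def] at h0
    rw [← h0]
    refine integral_congr_ae ?_
    have hGF : ∀ᵐ x ∂μ, hG.toLp G (F x) = G (F x) :=
      hF.quasiMeasurePreserving.ae hG.coeFn_toLp
    filter_upwards [hχe, hχF, hGF, hΦ.coeFn_toLp, Lp.coeFn_sub (φ + χ') (Uc χ'),
      Lp.coeFn_add φ χ', Lp.coeFn_compMeasurePreserving (hG.toLp G) hF,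
      Lp.coeFn_compMeasurePreserving χ' hF] with x h1 h2 h3 h4 h5 h6 h7 h8
    have h7' : Uc (hG.toLp G) x = G (F x) := h7.trans h3
    have h8' : Uc χ' x = χ' (F x) := h8
    rw [h5, Pi.sub_apply, h6, Pi.add_apply, h7', h8', h1, h2, h4, real_inner_comm]

end Corrector

/-! ### Decay of correlations of symbolically Hölder functions -/

section Decay

variable {α E : Type*} [MeasurableSpace α] {μ : Measure α} [IsProbabilityMeasure μ] {F : α → α}
  {label : α → ℕ} {L γ : ℝ}
  [NormedAddCommGroup E] [InnerProductSpace ℝ E] [CompleteSpace E] [MeasurableSpace E]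
  [BorelSpace E] [SecondCountableTopology E]

/-- `Φ` is bounded by a multiple of `t` and depends on the `n`-th label, `n ≥ τ`, only by an amount
of order `t θ ^ (n - τ)`. -/
structure IsSymbolicHolder (F : α → α) (label : α → ℕ) (τ : α → ℕ) (t : α → ℝ) (B θ : ℝ)
    (Φ : α → E) : Prop where
  measurable : Measurable Φ
  bound : ∀ x, ‖Φ x‖ ≤ B * t x
  holder : ∀ (n : ℕ) (x x' : α), 1 ≤ n → (∀ i < n, label (F^[i] x) = label (F^[i] x')) →
    ‖Φ x - Φ x'‖ ≤ B * (t x * θ ^ (n - τ x))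

/-- The weights `t` and `τ` are constant on partition elements and `0 ≤ t ≤ τ`. -/
structure IsWeight (label : α → ℕ) (τ : α → ℕ) (t : α → ℝ) : Prop where
  measurable_τ : Measurable τ
  measurable_t : Measurable t
  τ_pos : ∀ x, 0 < τ x
  τ_const : ∀ x x', label x = label x' → τ x = τ x'
  t_const : ∀ x x', label x = label x' → t x = t x'
  t_nonneg : ∀ x, 0 ≤ t x
  t_le : ∀ x, t x ≤ τ x

/-- Subtraction is truncated: the first `k` terms equal one, and a geometric series follows. This is
where a factor `τ` is lost in the bound of the coboundary. -/
lemma sum_pow_sub_le {θ : ℝ} (hθ : 0 < θ) (hθ1 : θ < 1) (k N : ℕ) :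
    ∑ n ∈ Finset.range N, θ ^ (n + 1 - k) ≤ k + 1 / (1 - θ) := by
  have h1 : 0 < 1 - θ := by linarith
  induction k generalizing N with
  | zero =>
    have h2 : ∑ n ∈ Finset.range N, θ ^ (n + 1 - 0) ≤ ∑ n ∈ Finset.range N, θ ^ n :=
      Finset.sum_le_sum fun n _ => pow_le_pow_of_le_one hθ.le hθ1.le (by omega)
    have h3 := (summable_geometric_of_lt_one hθ.le hθ1).sum_le_tsum (Finset.range N)
      fun _ _ => by positivity
    rw [tsum_geometric_of_lt_one hθ.le hθ1] at h3
    simpa using h2.trans h3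
  | succ k ih =>
    rcases N with _ | N
    · simp only [Finset.range_zero, Finset.sum_empty]
      positivity
    · rw [Finset.sum_range_succ']
      have := ih N
      rw [show 0 + 1 - (k + 1) = 0 by omega, pow_zero]
      simp only [Nat.add_sub_add_right]
      push_cast
      linarith

lemma sum_range_half_le {f : ℕ → ℝ} (hf : ∀ n, 0 ≤ f n) {S : ℝ}
    (hS : ∀ N, ∑ n ∈ Finset.range N, f n ≤ S) (N : ℕ) :
    ∑ j ∈ Finset.range N, f (j / 2) ≤ 2 * S := by
  have h : ∀ N, ∑ j ∈ Finset.range (2 * N), f (j / 2) = 2 * ∑ n ∈ Finset.range N, f n := by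
    intro N
    induction N with
    | zero => simp
    | succ N ih =>
      rw [show 2 * (N + 1) = 2 * N + 1 + 1 by ring, Finset.sum_range_succ, Finset.sum_range_succ,
        ih, Finset.sum_range_succ, show (2 * N) / 2 = N by omega,
        show (2 * N + 1) / 2 = N by omega]
      ring
  have h1 : ∑ j ∈ Finset.range N, f (j / 2) ≤ ∑ j ∈ Finset.range (2 * N), f (j / 2) :=
    Finset.sum_le_sum_of_subset_of_nonneg (Finset.range_subset_range.2 (by omega))
      fun _ _ _ => hf _
  rw [h] at h1
  linarith [hS N]

variable {τ : α → ℕ} {t : α → ℝ} {B θ : ℝ} {Φ : α → E}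

lemma word_eq_iff {n : ℕ} {x x' : α} :
    word F label n x = word F label n x' ↔ ∀ i < n, label (F^[i] x) = label (F^[i] x') :=
  ⟨fun h i hi => congrFun h ⟨i, hi⟩, fun h => funext fun i => h i i.2⟩

/-- On each cylinder of length `n` the function is replaced by its value at one point. The error is
controlled by the oscillation, and the values are compared with the help of cylinder mixing across a
gap of `i` steps. -/
lemma GibbsMarkov.norm_setIntegral_preimage_le (hG : GibbsMarkov F label μ L γ)
    (hw : IsWeight label τ t) (ht : Integrable t μ)
    (hθ : 0 < θ) (hθ1 : θ < 1) (hB : 0 ≤ B) (hΦ : IsSymbolicHolder F label τ t B θ Φ)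
    (h0 : ∫ x, Φ x ∂μ = 0) {r : ℕ} (hr : 4 * γ ^ r ≤ 1) {n : ℕ} (hn : 1 ≤ n) (i : ℕ)
    {A : Set α} (hA : MeasurableSet A) :
    ‖∫ x in F^[i + n] ⁻¹' A, Φ x ∂μ‖ ≤
      ((Real.exp (couplingConst L γ) + 1) * B * ∫ x, t x * θ ^ (n - τ x) ∂μ +
        mixRate L γ r i * B * ∫ x, t x ∂μ) * μ.real A := by
  set K := Real.exp (couplingConst L γ)
  set δ := mixRate L γ r i
  have hF := hG.measurable
  have hX := measurable_word hF hG.measurable_label n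
  have hA' := hF.iterate (i + n) hA
  have hΦi : Integrable Φ μ := (ht.const_mul B).mono' hΦ.measurable.aestronglyMeasurable
    (.of_forall hΦ.bound)
  set g : α → ℝ := fun x => (K + 1) * B * (t x * θ ^ (n - τ x)) + δ * B * t x
  have hti : Integrable (fun x => t x * θ ^ (n - τ x)) μ := by
    refine ht.mono' ?_ (.of_forall fun x => ?_)
    · exact (hw.measurable_t.mul (measurable_const.pow
        (measurable_const.sub hw.measurable_τ))).aestronglyMeasurable
    · have h1 : θ ^ (n - τ x) ≤ 1 := pow_le_one₀ hθ.le hθ1.le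
      have h2 := hw.t_nonneg x
      rw [Real.norm_eq_abs, abs_of_nonneg (by positivity)]
      nlinarith
  have hgi : Integrable g μ := (hti.const_mul _).add (ht.const_mul _)
  have hg : ∫ x, g x ∂μ = (K + 1) * B * ∫ x, t x * θ ^ (n - τ x) ∂μ + δ * B * ∫ x, t x ∂μ := by
    rw [integral_add (hti.const_mul _) (ht.const_mul _), integral_const_mul, integral_const_mul]
  rw [← hg]
  have hs1 := hasSum_setIntegral_fiber hX hA' (μ := μ) (f := Φ) hΦi.integrableOn
  have hs2 := hasSum_setIntegral_fiber hX MeasurableSet.univ (μ := μ) (f := Φ) hΦi.integrableOn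
  have hs3 := hasSum_setIntegral_fiber hX MeasurableSet.univ (μ := μ) (f := g) hgi.integrableOn
  simp only [Measure.restrict_univ, Set.inter_univ] at hs2 hs3
  rw [h0] at hs2
  -- Subtracting `μ.real A` times the vanishing integral of `Φ`, cylinder by cylinder, makes every
  -- summand a correlation.
  have hs := hs1.sub (hs2.const_smul (μ.real A))
  rw [smul_zero, sub_zero] at hs
  refine (hs.norm_le_of_bounded (hs3.mul_right (μ.real A)) fun w => ?_)
  set c := word F label n ⁻¹' {w}
  have hc : MeasurableSet c := hX (measurableSet_singleton w)
  rcases c.eq_empty_or_nonempty with he | ⟨x0, hx0⟩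
  · simp [he]
  have hosc : ∀ x ∈ c, ‖Φ x - Φ x0‖ ≤ B * (t x0 * θ ^ (n - τ x0)) := fun x hx => by
    have := hΦ.holder n x0 x hn (word_eq_iff.1 (hx0.trans hx.symm))
    rwa [norm_sub_rev] at this
  have hlab : ∀ x ∈ c, label x = label x0 := fun x hx =>
    word_eq_iff.1 (hx.trans hx0.symm) 0 (by omega)
  have hgc : ∫ x in c, g x ∂μ = g x0 * μ.real c := by
    rw [setIntegral_congr_fun hc (g := fun _ => g x0) fun x hx => by
      simp only [g, hw.t_const x x0 (hlab x hx), hw.τ_const x x0 (hlab x hx)]]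
    simp [mul_comm]
  have hsplit : ∀ D ⊆ c, MeasurableSet D →
      ∫ x in D, Φ x ∂μ = ∫ x in D, (Φ x - Φ x0) ∂μ + μ.real D • Φ x0 := fun D _ hD => by
    rw [integral_sub hΦi.integrableOn (integrable_const _), setIntegral_const, sub_add_cancel]
  have hn1 : ∀ D ⊆ c, ‖∫ x in D, (Φ x - Φ x0) ∂μ‖ ≤ B * (t x0 * θ ^ (n - τ x0)) * μ.real D :=
    fun D hD => norm_setIntegral_le_of_norm_le_const (measure_lt_top _ _)
      fun x hx => hosc x (hD hx)
  set D := c ∩ F^[i + n] ⁻¹' A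
  have hDc : D ⊆ c := Set.inter_subset_left
  rw [hsplit D hDc (hc.inter hA'), hsplit c subset_rfl hc, hgc]
  have e1 := hn1 D hDc
  have e2 := hn1 c subset_rfl
  have e3 : |μ.real D - μ.real c * μ.real A| ≤ δ * (μ.real c * μ.real A) :=
    hG.cylinder_mixing hr n i w hA
  have e4 : μ.real D ≤ K * (μ.real c * μ.real A) := hG.cylinder_le n i w hA
  have ht0 := hw.t_nonneg x0
  have hu : 0 ≤ B * (t x0 * θ ^ (n - τ x0)) := by positivity
  have hA0 : 0 ≤ μ.real A := measureReal_nonneg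
  have hre : ∫ x in D, (Φ x - Φ x0) ∂μ + μ.real D • Φ x0 -
      μ.real A • (∫ x in c, (Φ x - Φ x0) ∂μ + μ.real c • Φ x0) =
      ∫ x in D, (Φ x - Φ x0) ∂μ - μ.real A • ∫ x in c, (Φ x - Φ x0) ∂μ +
        (μ.real D - μ.real c * μ.real A) • Φ x0 := by
    rw [smul_add, smul_smul, sub_smul, mul_comm (μ.real A)]
    abel
  rw [hre]
  calc _ ≤ ‖∫ x in D, (Φ x - Φ x0) ∂μ‖ + ‖μ.real A • ∫ x in c, (Φ x - Φ x0) ∂μ‖ +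
        ‖(μ.real D - μ.real c * μ.real A) • Φ x0‖ :=
        (norm_add_le _ _).trans (add_le_add_left (norm_sub_le _ _) _)
    _ ≤ B * (t x0 * θ ^ (n - τ x0)) * (K * (μ.real c * μ.real A)) +
        μ.real A * (B * (t x0 * θ ^ (n - τ x0)) * μ.real c) +
        δ * (μ.real c * μ.real A) * (B * t x0) := by
        refine add_le_add (add_le_add (e1.trans (mul_le_mul_of_nonneg_left e4 hu)) ?_) ?_
        · rw [norm_smul, Real.norm_eq_abs, abs_of_nonneg hA0]
          exact mul_le_mul_of_nonneg_left e2 hA0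
        · rw [norm_smul, Real.norm_eq_abs]
          exact mul_le_mul e3 (hΦ.bound x0) (norm_nonneg _) ((abs_nonneg _).trans e3)
    _ = g x0 * μ.real c * μ.real A := by
        simp only [g]
        ring

end Decay

/-! ### Martingale-coboundary decomposition: bounds of the coboundary and of the variance. -/

section Decomposition

variable {α E : Type*} [MeasurableSpace α] {μ : Measure α} [IsProbabilityMeasure μ] {F : α → α}
  {label : α → ℕ} {L γ : ℝ}
  [NormedAddCommGroup E] [InnerProductSpace ℝ E] [CompleteSpace E] [MeasurableSpace E]
  [BorelSpace E] [SecondCountableTopology E]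
  {τ : α → ℕ} {t : α → ℝ} {B θ : ℝ} {Φ : α → E}

/-- The number of iterates after which the coupling restores the regularity of densities. -/
noncomputable def couplingTime (γ : ℝ) : ℕ := sInf {r | 0 < r ∧ 4 * γ ^ r ≤ 1}

lemma couplingTime_spec (hγ : 0 < γ) (hγ1 : γ < 1) :
    0 < couplingTime γ ∧ 4 * γ ^ couplingTime γ ≤ 1 := by
  refine Nat.sInf_mem (s := {r | 0 < r ∧ 4 * γ ^ r ≤ 1}) ?_
  obtain ⟨r, hr⟩ := exists_pow_lt_of_lt_one (show (0 : ℝ) < 1 / 4 by norm_num) hγ1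
  refine ⟨r + 1, r.succ_pos, ?_⟩
  have : γ ^ (r + 1) ≤ γ ^ r := pow_le_pow_of_le_one hγ.le hγ1.le r.le_succ
  linarith

/-- The constant in the bound of the coboundary. -/
noncomputable def correctorConst (L γ θ : ℝ) : ℝ :=
  2 * ((Real.exp (couplingConst L γ) + 1) * (1 + 1 / (1 - θ)) +
    ∑' i, mixRate L γ (couplingTime γ) i)

lemma mixRate_nonneg (h : 0 ≤ couplingConst L γ) (r i : ℕ) : 0 ≤ mixRate L γ r i :=
  mul_nonneg (pow_nonneg (by linarith [couplingMass_le h]) _) (Real.exp_nonneg _)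

lemma mixRate_anti (h : 0 ≤ couplingConst L γ) (r : ℕ) {i j : ℕ} (hij : i ≤ j) :
    mixRate L γ r j ≤ mixRate L γ r i := by
  unfold mixRate
  have h0 := couplingMass_pos (L := L) (γ := γ)
  have h1 := couplingMass_le h
  exact mul_le_mul_of_nonneg_right (pow_le_pow_of_le_one (by linarith) (by linarith)
    (Nat.div_le_div_right hij)) (Real.exp_nonneg _)

lemma GibbsMarkov.correctorConst_nonneg (hG : GibbsMarkov F label μ L γ) (hθ1 : θ < 1) :
    0 ≤ correctorConst L γ θ := by
  have h1 : 0 < 1 - θ := by linarith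
  have h2 : 0 ≤ ∑' i, mixRate L γ (couplingTime γ) i :=
    tsum_nonneg fun i => mixRate_nonneg hG.couplingConst_nonneg _ _
  unfold correctorConst
  positivity

lemma IsWeight.t_le_mul (hw : IsWeight label τ t) (x : α) : t x ≤ t x * τ x := by
  have h1 : (1 : ℝ) ≤ τ x := by exact_mod_cast hw.τ_pos x
  exact le_mul_of_one_le_right (hw.t_nonneg x) h1

lemma IsWeight.integrable (hw : IsWeight label τ t) (h : Integrable (fun x => t x * τ x) μ) :
    Integrable t μ := by
  refine h.mono' hw.measurable_t.aestronglyMeasurable (.of_forall fun x => ?_)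
  rw [Real.norm_eq_abs, abs_of_nonneg (hw.t_nonneg x)]
  exact hw.t_le_mul x

lemma IsWeight.integrable_sq (hw : IsWeight label τ t) (h : Integrable (fun x => t x * τ x) μ) :
    Integrable (fun x => t x ^ 2) μ := by
  refine h.mono' (hw.measurable_t.pow_const 2).aestronglyMeasurable (.of_forall fun x => ?_)
  rw [Real.norm_eq_abs, abs_of_nonneg (by positivity), sq]
  exact mul_le_mul_of_nonneg_left (hw.t_le x) (hw.t_nonneg x)

lemma IsWeight.integral_sq_le (hw : IsWeight label τ t)
    (h : Integrable (fun x => t x * τ x) μ) :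
    ∫ x, t x ^ 2 ∂μ ≤ ∫ x, t x * τ x ∂μ :=
  integral_mono (hw.integrable_sq h) h fun x => by
    show t x ^ 2 ≤ t x * τ x
    rw [sq]
    exact mul_le_mul_of_nonneg_left (hw.t_le x) (hw.t_nonneg x)

lemma IsWeight.integral_le (hw : IsWeight label τ t)
    (h : Integrable (fun x => t x * τ x) μ) :
    ∫ x, t x ∂μ ≤ ∫ x, t x * τ x ∂μ :=
  integral_mono (hw.integrable h) h hw.t_le_mul

lemma IsSymbolicHolder.memLp (hw : IsWeight label τ t) (h : Integrable (fun x => t x * τ x) μ)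
    (hΦ : IsSymbolicHolder F label τ t B θ Φ) : MemLp Φ 2 μ := by
  rw [memLp_two_iff_integrable_sq_norm hΦ.measurable.aestronglyMeasurable]
  refine ((hw.integrable_sq h).const_mul (B ^ 2)).mono'
    (hΦ.measurable.norm.pow_const 2).aestronglyMeasurable (.of_forall fun x => ?_)
  rw [Real.norm_eq_abs, abs_of_nonneg (by positivity), ← mul_pow]
  exact pow_le_pow_left₀ (norm_nonneg _) (hΦ.bound x) 2

/-- Martingale-coboundary decomposition with a bounded coboundary. -/
lemma GibbsMarkov.exists_corrector (hG : GibbsMarkov F label μ L γ) (hw : IsWeight label τ t)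
    (ht : Integrable (fun x => t x * τ x) μ) (hθ : 0 < θ) (hθ1 : θ < 1) (hB : 0 ≤ B)
    (hΦ : IsSymbolicHolder F label τ t B θ Φ) (h0 : ∫ x, Φ x ∂μ = 0) :
    ∃ χ : α → E, Measurable χ ∧
      (∀ x, ‖χ x‖ ≤ correctorConst L γ θ * B * ∫ x, t x * τ x ∂μ) ∧
      IsReverseDiff F μ (fun x => Φ x + χ x - χ (F x)) := by
  set r := couplingTime γ
  obtain ⟨hr0, hr⟩ := couplingTime_spec hG.γ_pos hG.γ_lt_one
  have hK := hG.couplingConst_nonneg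
  have ht1 := hw.integrable ht
  set K := Real.exp (couplingConst L γ)
  -- The decay bound for `n + 1` labels and a gap `n`. Summed over `n`, the oscillation part gives
  -- the integral of `t * τ` by `sum_pow_sub_le`, and the mixing part is summable.
  set f : ℕ → ℝ := fun n => (K + 1) * B * ∫ x, t x * θ ^ (n + 1 - τ x) ∂μ +
    mixRate L γ r n * B * ∫ x, t x ∂μ
  have hI : 0 ≤ ∫ x, t x ∂μ := integral_nonneg hw.t_nonneg
  have hI' : 0 ≤ ∫ x, t x * τ x ∂μ :=
    integral_nonneg fun x => mul_nonneg (hw.t_nonneg x) (Nat.cast_nonneg _)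
  have hIle := hw.integral_le ht
  have hmr := mixRate_nonneg hK r
  have hf0 : ∀ n, 0 ≤ f n := fun n => by
    have h1 : 0 ≤ ∫ x, t x * θ ^ (n + 1 - τ x) ∂μ :=
      integral_nonneg fun x => mul_nonneg (hw.t_nonneg x) (by positivity)
    have h2 := hmr n
    have h3 : 0 ≤ K := Real.exp_nonneg _
    show 0 ≤ _ + _
    positivity
  have hti : ∀ n, Integrable (fun x => t x * θ ^ (n + 1 - τ x)) μ := fun n => by
    refine ht1.mono' ?_ (.of_forall fun x => ?_)
    · exact (hw.measurable_t.mul (measurable_const.pow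
        (measurable_const.sub hw.measurable_τ))).aestronglyMeasurable
    · have h1 : θ ^ (n + 1 - τ x) ≤ 1 := pow_le_one₀ hθ.le hθ1.le
      have h2 := hw.t_nonneg x
      rw [Real.norm_eq_abs, abs_of_nonneg (by positivity)]
      nlinarith
  have hθ' : 0 < 1 - θ := by linarith
  have hsum : ∀ N, ∑ n ∈ Finset.range N, f n ≤
      ((K + 1) * (1 + 1 / (1 - θ)) + ∑' i, mixRate L γ r i) * B * ∫ x, t x * τ x ∂μ := by
    intro N
    have e1 : ∑ n ∈ Finset.range N, ∫ x, t x * θ ^ (n + 1 - τ x) ∂μ ≤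
        (1 + 1 / (1 - θ)) * ∫ x, t x * τ x ∂μ := by
      rw [← integral_finsetSum _ fun n _ => hti n]
      calc _ ≤ ∫ x, (t x * τ x + 1 / (1 - θ) * t x) ∂μ := by
            refine integral_mono (integrable_finsetSum _ fun n _ => hti n)
              (ht.add (ht1.const_mul _)) fun x => ?_
            show ∑ n ∈ Finset.range N, t x * θ ^ (n + 1 - τ x) ≤ t x * τ x + 1 / (1 - θ) * t x
            rw [← Finset.mul_sum]
            have := mul_le_mul_of_nonneg_left (sum_pow_sub_le hθ hθ1 (τ x) N) (hw.t_nonneg x)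
            linarith
        _ = ∫ x, t x * τ x ∂μ + 1 / (1 - θ) * ∫ x, t x ∂μ := by
            rw [integral_add ht (ht1.const_mul _), integral_const_mul]
        _ ≤ _ := by
            have : 1 / (1 - θ) * ∫ x, t x ∂μ ≤ 1 / (1 - θ) * ∫ x, t x * τ x ∂μ := by gcongr
            linarith
    have e2 : ∑ n ∈ Finset.range N, mixRate L γ r n ≤ ∑' i, mixRate L γ r i :=
      (summable_mixRate hK hr0).sum_le_tsum _ fun i _ => hmr i
    have e3 : 0 ≤ ∑' i, mixRate L γ r i := tsum_nonneg hmr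
    have hK0 : 0 ≤ K := Real.exp_nonneg _
    calc ∑ n ∈ Finset.range N, f n = (K + 1) * B *
          ∑ n ∈ Finset.range N, ∫ x, t x * θ ^ (n + 1 - τ x) ∂μ +
          (∑ n ∈ Finset.range N, mixRate L γ r n) * B * ∫ x, t x ∂μ := by
          rw [Finset.sum_add_distrib, Finset.mul_sum, Finset.sum_mul, Finset.sum_mul]
      _ ≤ (K + 1) * B * ((1 + 1 / (1 - θ)) * ∫ x, t x * τ x ∂μ) +
          (∑' i, mixRate L γ r i) * B * ∫ x, t x * τ x ∂μ := by gcongr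
      _ = _ := by ring
  have hdec : ∀ (j : ℕ) (A : Set α), MeasurableSet A →
      ‖∫ x in F^[j + 1] ⁻¹' A, Φ x ∂μ‖ ≤ f (j / 2) * μ.real A := by
    intro j A hA
    -- The time `j + 1` is divided into `j / 2 + 1` labels and a mixing gap `j - j / 2`. Every value
    -- of `j / 2` occurs twice, hence the factor 2 in `correctorConst`.
    have := hG.norm_setIntegral_preimage_le hw ht1 hθ hθ1 hB hΦ h0 hr
      (n := j / 2 + 1) (by omega) (j - j / 2) hA
    rw [show j - j / 2 + (j / 2 + 1) = j + 1 by omega] at this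
    refine this.trans ?_
    have := mixRate_anti hK r (show j / 2 ≤ j - j / 2 by omega)
    show (_ + _) * _ ≤ (_ + _) * _
    gcongr
  have hΦ2 := hΦ.memLp hw ht
  obtain ⟨χ, hχm, hχb, hχo⟩ := exists_bounded_corrector hG.preserves hΦ2
    (fun j => hf0 (j / 2)) (sum_range_half_le hf0 hsum) hdec
  have hχ2 : MemLp χ 2 μ := MemLp.of_bound hχm.aestronglyMeasurable _ (.of_forall hχb)
  refine ⟨χ, hχm, fun x => (hχb x).trans (le_of_eq ?_), ?_, ?_, hχo⟩
  · unfold correctorConst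
    ring
  · exact (hΦ.measurable.add hχm).sub (hχm.comp hG.measurable)
  · exact (hΦ2.add hχ2).sub (hχ2.comp_measurePreserving hG.preserves)

/-- The conditional variance of the martingale part. -/
lemma GibbsMarkov.setIntegral_sq_le (hG : GibbsMarkov F label μ L γ) (hw : IsWeight label τ t)
    (ht : Integrable (fun x => t x * τ x) μ) {A : Set α} (hA : MeasurableSet A) :
    ∫ x in F ⁻¹' A, t x ^ 2 ∂μ ≤
      Real.exp (couplingConst L γ) * (∫ x, t x * τ x ∂μ) * μ.real A := by
  have hX := measurable_word hG.measurable hG.measurable_label 1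
  have hA' := hG.measurable hA
  have ht2 := hw.integrable_sq ht
  have hs1 := hasSum_setIntegral_fiber hX hA' (μ := μ) ht2.integrableOn
  have hs2 := hasSum_setIntegral_fiber hX MeasurableSet.univ (μ := μ) ht2.integrableOn
  simp only [Measure.restrict_univ, Set.inter_univ] at hs2
  -- The weight is constant on cylinders of length one, and `F` pushes the measure on such a
  -- cylinder forward to at most a constant multiple of `μ`.
  have key : ∫ x in F ⁻¹' A, t x ^ 2 ∂μ ≤
      Real.exp (couplingConst L γ) * (∫ x, t x ^ 2 ∂μ) * μ.real A := by
    refine hasSum_le (fun w => ?_) hs1 ((hs2.mul_left _).mul_right _)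
    set c := word F label 1 ⁻¹' {w}
    have hc : MeasurableSet c := hX (measurableSet_singleton w)
    rcases c.eq_empty_or_nonempty with he | ⟨x0, hx0⟩
    · simp [he]
    have hcst : ∀ x ∈ c, t x ^ 2 = t x0 ^ 2 := fun x hx => by
      rw [hw.t_const x x0 (word_eq_iff.1 (hx.trans hx0.symm) 0 (by omega))]
    rw [setIntegral_congr_fun hc (g := fun _ => t x0 ^ 2) hcst,
      setIntegral_congr_fun (hc.inter hA') (g := fun _ => t x0 ^ 2) fun x hx => hcst x hx.1]
    have := hG.cylinder_le 1 0 w hA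
    have h0 : 0 ≤ t x0 ^ 2 := by positivity
    simp only [integral_const, MeasurableSet.univ, measureReal_restrict_apply, Set.univ_inter,
      smul_eq_mul]
    have := mul_le_mul_of_nonneg_right this h0
    calc _ ≤ _ := this
      _ = _ := by ring
  refine key.trans ?_
  have := hw.integral_sq_le ht
  gcongr

variable {χ : α → E} {R : ℝ}

/-- Boundedness of `χ` makes the conditional variance bounded, not merely integrable. The iterated
maximal inequality needs exactly this; the quadratic dependence on `R` is harmless there. -/
lemma GibbsMarkov.condVariance_le (hG : GibbsMarkov F label μ L γ) (hw : IsWeight label τ t)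
    (ht : Integrable (fun x => t x * τ x) μ) (hΦ : IsSymbolicHolder F label τ t B θ Φ)
    (hχ : ∀ x, ‖χ x‖ ≤ R) (hm : IsReverseDiff F μ (fun x => Φ x + χ x - χ (F x)))
    {A : Set α} (hA : MeasurableSet A) :
    ∫ x in F ⁻¹' A, ‖Φ x + χ x - χ (F x)‖ ^ 2 ∂μ ≤
      (2 * B ^ 2 * (Real.exp (couplingConst L γ) * ∫ x, t x * τ x ∂μ) + 8 * R ^ 2) *
        μ.real A := by
  have ht2 := hw.integrable_sq ht
  calc ∫ x in F ⁻¹' A, ‖Φ x + χ x - χ (F x)‖ ^ 2 ∂μ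
      ≤ ∫ x in F ⁻¹' A, (2 * B ^ 2 * t x ^ 2 + 8 * R ^ 2) ∂μ := by
        refine setIntegral_mono (hm.memLp.integrable_norm_pow two_ne_zero).integrableOn
          ((ht2.const_mul _).add (integrable_const _)).integrableOn fun x => ?_
        have h1 : ‖Φ x + χ x - χ (F x)‖ ≤ B * t x + 2 * R := by
          have := norm_sub_le (Φ x + χ x) (χ (F x))
          have := norm_add_le (Φ x) (χ x)
          linarith [hΦ.bound x, hχ x, hχ (F x)]
        have h2 := pow_le_pow_left₀ (norm_nonneg _) h1 2
        show ‖Φ x + χ x - χ (F x)‖ ^ 2 ≤ 2 * B ^ 2 * t x ^ 2 + 8 * R ^ 2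
        nlinarith [sq_nonneg (B * t x - 2 * R)]
    _ = 2 * B ^ 2 * ∫ x in F ⁻¹' A, t x ^ 2 ∂μ + 8 * R ^ 2 * μ.real A := by
        rw [integral_add (ht2.const_mul _).integrableOn (integrable_const _).integrableOn,
          integral_const_mul, setIntegral_const, smul_eq_mul,
          hG.preserves.measureReal_preimage hA.nullMeasurableSet, mul_comm (μ.real A)]
    _ ≤ 2 * B ^ 2 * (Real.exp (couplingConst L γ) * (∫ x, t x * τ x ∂μ) * μ.real A) +
        8 * R ^ 2 * μ.real A := by
        have := hG.setIntegral_sq_le hw ht hA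
        gcongr
    _ = _ := by ring

/-- With `m` the martingale part, `m + χ ∘ F = Φ + χ` and `m` is orthogonal to `χ ∘ F`. Hence the
second moment of `χ` cancels and the bound is linear in `R`. The truncation argument depends on
this, since there `R` is allowed to grow with the truncation level. -/
lemma GibbsMarkov.variance_le (hG : GibbsMarkov F label μ L γ) (hw : IsWeight label τ t)
    (ht : Integrable (fun x => t x * τ x) μ) (hB : 0 ≤ B)
    (hΦ : IsSymbolicHolder F label τ t B θ Φ)
    (hχm : Measurable χ) (hχ : ∀ x, ‖χ x‖ ≤ R)
    (hm : IsReverseDiff F μ (fun x => Φ x + χ x - χ (F x))) :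
    ∫ x, ‖Φ x + χ x - χ (F x)‖ ^ 2 ∂μ ≤
      B ^ 2 * (∫ x, t x * τ x ∂μ) + 2 * B * R * ∫ x, t x ∂μ := by
  have hχ2 : MemLp χ 2 μ := MemLp.of_bound hχm.aestronglyMeasurable _ (.of_forall hχ)
  have hΦ2 := hΦ.memLp hw ht
  have h1 := hm.setIntegral_norm_sq_add hG.preserves hχ2 MeasurableSet.univ
  simp only [Set.preimage_univ, Measure.restrict_univ, sub_add_cancel] at h1
  have i1 := hΦ2.integrable_norm_pow two_ne_zero
  have i2 := hχ2.integrable_norm_pow two_ne_zero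
  have i3 := integrable_inner_of_memLp hΦ2 hχ2
  have h2 : ∫ x, ‖Φ x + χ x‖ ^ 2 ∂μ = ∫ x, ‖Φ x‖ ^ 2 ∂μ + 2 * ∫ x, inner ℝ (Φ x) (χ x) ∂μ +
      ∫ x, ‖χ x‖ ^ 2 ∂μ := by
    simp_rw [norm_add_sq_real]
    rw [integral_add (f := fun x => ‖Φ x‖ ^ 2 + 2 * inner ℝ (Φ x) (χ x))
      (show Integrable (fun x => ‖Φ x‖ ^ 2 + 2 * inner ℝ (Φ x) (χ x)) μ from
        i1.add (i3.const_mul 2)) i2, integral_add i1 (i3.const_mul 2), integral_const_mul]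
  have h3 : ∫ x, ‖Φ x‖ ^ 2 ∂μ ≤ B ^ 2 * ∫ x, t x * τ x ∂μ := by
    refine le_trans ?_ (mul_le_mul_of_nonneg_left (hw.integral_sq_le ht) (sq_nonneg B))
    rw [← integral_const_mul]
    refine integral_mono i1 ((hw.integrable_sq ht).const_mul _) fun x => ?_
    show ‖Φ x‖ ^ 2 ≤ B ^ 2 * t x ^ 2
    rw [← mul_pow]
    exact pow_le_pow_left₀ (norm_nonneg _) (hΦ.bound x) 2
  have h4 : ∫ x, inner ℝ (Φ x) (χ x) ∂μ ≤ B * R * ∫ x, t x ∂μ := by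
    rw [← integral_const_mul]
    refine integral_mono i3 ((hw.integrable ht).const_mul _) fun x => ?_
    refine (real_inner_le_norm _ _).trans ?_
    have := mul_le_mul (hΦ.bound x) (hχ x) (norm_nonneg _)
      (mul_nonneg hB (hw.t_nonneg x))
    linarith
  linarith

end Decomposition

/-! ### Integration on towers -/

section Tower

variable {α E : Type*} [MeasurableSpace α] {μ : Measure α} {F : α → α} {τ : α → ℕ}
  [NormedAddCommGroup E] [NormedSpace ℝ E] [CompleteSpace E]

lemma measurableSet_tower (hτ : Measurable τ) : MeasurableSet {q : α × ℕ | q.2 < τ q.1} :=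
  measurableSet_lt measurable_snd (hτ.comp measurable_fst)

lemma lintegral_tower [SFinite μ] (hτ : Measurable τ) {g : α × ℕ → ℝ≥0∞} (hg : Measurable g) :
    ∫⁻ q : Tower τ, g q.1 ∂towerMeasure τ μ =
      (∫⁻ a, (τ a : ℝ≥0∞) ∂μ)⁻¹ * ∫⁻ x, ∑ l ∈ Finset.range (τ x), g (x, l) ∂μ := by
  have hS := measurableSet_tower hτ
  rw [towerMeasure, lintegral_smul_measure, smul_eq_mul]
  congr 1
  refine (lintegral_subtype_comap hS g).trans ?_
  rw [← lintegral_indicator hS, lintegral_prod _ (hg.indicator hS).aemeasurable]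
  refine lintegral_congr fun x => ?_
  rw [lintegral_count, tsum_eq_sum (s := Finset.range (τ x))]
  · refine Finset.sum_congr rfl fun l hl => ?_
    simp [Set.indicator, Finset.mem_range.1 hl]
  · intro l hl
    have : ¬ l < τ x := by simpa using hl
    simp [Set.indicator, this]

lemma lintegral_tower_base [SFinite μ] (hτ : Measurable τ) {g : α → ℝ≥0∞} (hg : Measurable g) :
    ∫⁻ q : Tower τ, g q.1.1 ∂towerMeasure τ μ =
      (∫⁻ a, (τ a : ℝ≥0∞) ∂μ)⁻¹ * ∫⁻ x, τ x * g x ∂μ := by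
  rw [lintegral_tower hτ (g := fun p => g p.1) (hg.comp measurable_fst)]
  simp

/-- The mean of the inducing time. -/
lemma one_le_lintegral_time [IsProbabilityMeasure μ] (hpos : ∀ x, 0 < τ x) :
    1 ≤ ∫⁻ a, (τ a : ℝ≥0∞) ∂μ := by
  calc (1 : ℝ≥0∞) = ∫⁻ _, 1 ∂μ := by simp
    _ ≤ _ := lintegral_mono fun x => Nat.one_le_cast.2 (hpos x)

lemma isProbabilityMeasure_tower [IsProbabilityMeasure μ] (hτ : Measurable τ)
    (hpos : ∀ x, 0 < τ x) (hfin : ∫⁻ a, (τ a : ℝ≥0∞) ∂μ ≠ ∞) :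
    IsProbabilityMeasure (towerMeasure τ μ) := by
  refine ⟨?_⟩
  have := lintegral_tower (μ := μ) hτ (g := fun _ => 1) measurable_const
  simp only [lintegral_const, one_mul, Finset.sum_const, Finset.card_range, nsmul_eq_mul,
    mul_one] at this
  rw [this, ENNReal.inv_mul_cancel _ hfin]
  exact (zero_lt_one.trans_le (one_le_lintegral_time hpos)).ne'

lemma integral_tower [SFinite μ] (hτ : Measurable τ)
    (hfin : ∫⁻ a, (τ a : ℝ≥0∞) ∂μ ≠ ∞) (h0 : ∫⁻ a, (τ a : ℝ≥0∞) ∂μ ≠ 0) {g : α × ℕ → E}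
    (hg : Integrable (fun q : Tower τ => g q.1) (towerMeasure τ μ)) :
    ∫ q : Tower τ, g q.1 ∂towerMeasure τ μ =
      (∫⁻ a, (τ a : ℝ≥0∞) ∂μ).toReal⁻¹ • ∫ x, ∑ l ∈ Finset.range (τ x), g (x, l) ∂μ := by
  have hS := measurableSet_tower hτ
  have hg' : IntegrableOn g {q : α × ℕ | q.2 < τ q.1} (μ.prod Measure.count) := by
    rw [towerMeasure, integrable_smul_measure (ENNReal.inv_ne_zero.2 hfin)
      (ENNReal.inv_ne_top.2 h0)] at hg
    rw [IntegrableOn, ← map_comap_subtype_coe hS]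
    exact (MeasurableEmbedding.subtype_coe hS).integrable_map_iff.2 hg
  rw [towerMeasure, integral_smul_measure, ENNReal.toReal_inv]
  congr 1
  refine (integral_subtype_comap hS g).trans ?_
  rw [← integral_indicator hS, integral_prod _ ((integrable_indicator_iff hS).2 hg')]
  refine integral_congr_ae (.of_forall fun x => ?_)
  have e : (fun l => Set.indicator {q : α × ℕ | q.2 < τ q.1} g (x, l)) =
      Set.indicator (↑(Finset.range (τ x))) fun l => g (x, l) := by
    ext l
    by_cases hl : l < τ x <;> simp [Set.indicator, hl]
  show ∫ l, Set.indicator {q : α × ℕ | q.2 < τ q.1} g (x, l) ∂Measure.count = _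
  rw [e, integral_indicator (Finset.measurableSet _), setIntegral_finset _ _]
  · simp [Measure.real]
  · have : IsFiniteMeasure (Measure.count.restrict (↑(Finset.range (τ x)) : Set ℕ)) :=
      ⟨by simp⟩
    rw [IntegrableOn, ← Measure.restrict_restrict_of_subset subset_rfl]
    exact IntegrableOn.finset

/-- The formula for the tower map, without the restriction to the tower. -/
def towerStep (F : α → α) (τ : α → ℕ) (p : α × ℕ) : α × ℕ :=
  if p.2 + 1 < τ p.1 then (p.1, p.2 + 1) else (F p.1, 0)

lemma towerMap_val (hpos : ∀ x, 0 < τ x) (q : Tower τ) :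
    (towerMap F τ hpos q).1 = towerStep F τ q.1 := by
  unfold towerMap towerStep
  split_ifs <;> rfl

lemma measurable_towerStep (hF : Measurable F) (hτ : Measurable τ) :
    Measurable (towerStep F τ) :=
  Measurable.ite (measurableSet_lt (measurable_snd.add_const 1) (hτ.comp measurable_fst))
    (measurable_fst.prodMk (measurable_snd.add_const 1))
    ((hF.comp measurable_fst).prodMk measurable_const)

lemma measurable_towerMap (hF : Measurable F) (hτ : Measurable τ) (hpos : ∀ x, 0 < τ x) :
    Measurable (towerMap F τ hpos) := by
  refine measurable_comap_iff.2 ?_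
  have : Subtype.val ∘ towerMap F τ hpos = towerStep F τ ∘ Subtype.val :=
    funext (towerMap_val hpos)
  rw [this]
  exact (measurable_towerStep hF hτ).comp measurable_subtype_coe

/-- Within a column the step shifts the summation by one level, and the top goes to the base over `F
x`. The base terms stand on opposite sides to avoid subtraction. -/
lemma sum_towerStep {M : Type*} [AddCommMonoid M] (hpos : ∀ x, 0 < τ x) (g : α × ℕ → M) (x : α) :
    ∑ l ∈ Finset.range (τ x), g (towerStep F τ (x, l)) + g (x, 0) =
      ∑ l ∈ Finset.range (τ x), g (x, l) + g (F x, 0) := by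
  obtain ⟨k, hk⟩ := Nat.exists_eq_succ_of_ne_zero (hpos x).ne'
  rw [hk, Finset.sum_range_succ, Finset.sum_range_succ']
  have h1 : towerStep F τ (x, k) = (F x, 0) := by simp [towerStep, hk]
  have h2 : ∑ l ∈ Finset.range k, g (towerStep F τ (x, l)) = ∑ l ∈ Finset.range k, g (x, l + 1) :=
    Finset.sum_congr rfl fun l hl => by
      have := Finset.mem_range.1 hl
      simp [towerStep, hk, this]
  rw [h1, h2]
  abel

lemma measurePreserving_towerMap [IsProbabilityMeasure μ] (hF : MeasurePreserving F μ μ)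
    (hτ : Measurable τ) (hpos : ∀ x, 0 < τ x) :
    MeasurePreserving (towerMap F τ hpos) (towerMeasure τ μ) (towerMeasure τ μ) := by
  refine ⟨measurable_towerMap hF.measurable hτ hpos, Measure.ext fun A hA => ?_⟩
  rw [Measure.map_apply (measurable_towerMap hF.measurable hτ hpos) hA]
  obtain ⟨A', hA', rfl⟩ := hA
  have hg : Measurable (A'.indicator (1 : α × ℕ → ℝ≥0∞)) := measurable_one.indicator hA'
  have hs := measurable_towerStep hF.measurable hτ
  have h1 : ∀ D : Set (Tower τ), MeasurableSet D → ∀ D' : Set (α × ℕ), MeasurableSet D' →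
      D = Subtype.val ⁻¹' D' → towerMeasure τ μ D = (∫⁻ a, (τ a : ℝ≥0∞) ∂μ)⁻¹ *
        ∫⁻ x, ∑ l ∈ Finset.range (τ x), D'.indicator (1 : α × ℕ → ℝ≥0∞) (x, l) ∂μ := by
    intro D hD D' hD' h
    rw [← lintegral_tower hτ (measurable_one.indicator hD'), ← lintegral_indicator_one hD]
    refine lintegral_congr fun q => ?_
    rw [h]
    rfl
  have hpre : towerMap F τ hpos ⁻¹' (Subtype.val ⁻¹' A') =
      Subtype.val ⁻¹' (towerStep F τ ⁻¹' A') := by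
    ext q
    simp only [Set.mem_preimage, towerMap_val]
  have hm := measurable_towerMap hF.measurable hτ hpos (measurable_subtype_coe hA')
  rw [h1 _ hm _ (hs hA') hpre, h1 _ (measurable_subtype_coe hA') A' hA' rfl]
  congr 1
  set g : α × ℕ → ℝ≥0∞ := A'.indicator 1
  have hg0 : Measurable fun x => g (x, 0) := hg.comp (measurable_id.prodMk measurable_const)
  have hfin : ∫⁻ x, g (x, 0) ∂μ ≠ ∞ := by
    refine ne_top_of_le_ne_top (b := ∫⁻ _, 1 ∂μ) (by simp) (lintegral_mono fun x => ?_)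
    exact Set.indicator_apply_le fun _ => le_rfl
  -- After a finite base term is added to both sides, the columnwise identity `sum_towerStep` and
  -- the invariance of `μ` under `F` finish the proof.
  refine (ENNReal.add_left_inj hfin).1 ?_
  rw [← lintegral_add_right _ hg0]
  conv_rhs => rw [← hF.lintegral_comp hg0]
  rw [← lintegral_add_right (g := fun x => g (F x, 0)) _ (hg0.comp hF.measurable)]
  refine lintegral_congr fun x => ?_
  exact sum_towerStep hpos g x

/-- The section `x ↦ (x, 0)` of the tower. -/
def towerBase (hpos : ∀ x, 0 < τ x) (x : α) : Tower τ := ⟨(x, 0), hpos x⟩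

lemma map_towerBase_le [IsProbabilityMeasure μ] (hτ : Measurable τ) (hpos : ∀ x, 0 < τ x)
    (hfin : ∫⁻ a, (τ a : ℝ≥0∞) ∂μ ≠ ∞) :
    μ.map (towerBase hpos) ≤ (∫⁻ a, (τ a : ℝ≥0∞) ∂μ) • towerMeasure τ μ := by
  have hm : Measurable (towerBase hpos) :=
    measurable_comap_iff.2 (measurable_id.prodMk measurable_const)
  refine Measure.le_iff.2 fun A hA => ?_
  rw [Measure.map_apply hm hA, Measure.smul_apply, smul_eq_mul]
  obtain ⟨A', hA', rfl⟩ := hA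
  have h : towerMeasure τ μ (Subtype.val ⁻¹' A') = (∫⁻ a, (τ a : ℝ≥0∞) ∂μ)⁻¹ *
      ∫⁻ x, ∑ l ∈ Finset.range (τ x), A'.indicator (1 : α × ℕ → ℝ≥0∞) (x, l) ∂μ := by
    rw [← lintegral_tower hτ (measurable_one.indicator hA'),
      ← lintegral_indicator_one (measurable_subtype_coe hA')]
    rfl
  rw [h, ← mul_assoc, ENNReal.mul_inv_cancel
    (zero_lt_one.trans_le (one_le_lintegral_time hpos)).ne' hfin, one_mul,
    ← lintegral_indicator_one (hm (measurable_subtype_coe hA'))]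
  refine lintegral_mono fun x => ?_
  exact (Finset.single_le_sum (f := fun l => A'.indicator (1 : α × ℕ → ℝ≥0∞) (x, l))
    (fun _ _ => zero_le) (Finset.mem_range.2 (hpos x)))

/-- A function of the base point evaluated at time `j` is controlled by its initial value and its
values at the visits to the base. -/
lemma apply_iterate_towerMap_le (hpos : ∀ x, 0 < τ x) (g : α → ℝ≥0∞) (j : ℕ) (q : Tower τ) :
    g ((towerMap F τ hpos)^[j] q).1.1 ≤ g q.1.1 + ∑ i ∈ Finset.range j,
      (if ((towerMap F τ hpos)^[i + 1] q).1.2 = 0 then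
        g ((towerMap F τ hpos)^[i + 1] q).1.1 else 0) := by
  induction j with
  | zero => simp
  | succ j ih =>
    rw [Finset.sum_range_succ, ← add_assoc]
    by_cases h : ((towerMap F τ hpos)^[j + 1] q).1.2 = 0
    · rw [if_pos h]
      exact le_add_self
    · rw [if_neg h, add_zero]
      refine le_of_eq_of_le ?_ ih
      rw [Function.iterate_succ_apply'] at h ⊢
      rw [towerMap_val] at h ⊢
      unfold towerStep at h ⊢
      split_ifs at h ⊢ <;> simp_all

end Tower

/-! ### Lifting the martingale decomposition to the tower -/

section TowerMartingale

variable {α E : Type*} [MeasurableSpace α] {μ : Measure α} [IsProbabilityMeasure μ] {F : α → α}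
  {label : α → ℕ} {τ : α → ℕ}
  [NormedAddCommGroup E] [InnerProductSpace ℝ E] [CompleteSpace E] [MeasurableSpace E]
  [BorelSpace E] [SecondCountableTopology E] {m χ : α → E} {W : α × ℕ → E}

/-- The function on the tower which is `m` on the top level and vanishes below. -/
def topLift {M : Type*} [Zero M] (τ : α → ℕ) (m : α → M) (p : α × ℕ) : M :=
  if p.2 + 1 = τ p.1 then m p.1 else 0

/-- The lift to the tower of a coboundary `χ` for the induced map. -/
def corrLift (χ : α → E) (W : α × ℕ → E) (p : α × ℕ) : E :=
  χ p.1 + ∑ i ∈ Finset.range p.2, W (p.1, i)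

/-- The induced observable. -/
def towerSum (τ : α → ℕ) (W : α × ℕ → E) (x : α) : E := ∑ l ∈ Finset.range (τ x), W (x, l)

lemma measurable_towerSum (hτ : Measurable τ) (hW : Measurable W) :
    Measurable (towerSum τ W) := by
  have h : Measurable fun p : ℕ × α => ∑ l ∈ Finset.range p.1, W (p.2, l) :=
    measurable_from_prod_countable_right fun n => by
      show Measurable fun y => ∑ l ∈ Finset.range n, W (y, l)
      exact Finset.measurable_fun_sum _ fun l _ =>
        (hW.comp (measurable_id.prodMk measurable_const) : Measurable fun x => W (x, l))
  exact h.comp (hτ.prodMk measurable_id)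

lemma measurable_topLift {M : Type*} [MeasurableSpace M] [Zero M] {m : α → M} (hτ : Measurable τ)
    (hm : Measurable m) : Measurable (topLift τ m) :=
  Measurable.ite (measurableSet_eq_fun (measurable_snd.add_const 1) (hτ.comp measurable_fst))
    (hm.comp measurable_fst) measurable_const

lemma measurable_corrLift (hχ : Measurable χ) (hW : Measurable W) : Measurable (corrLift χ W) := by
  refine (hχ.comp measurable_fst).add ?_
  have h : Measurable fun p : ℕ × α => ∑ l ∈ Finset.range p.1, W (p.2, l) :=
    measurable_from_prod_countable_right fun n => by
      show Measurable fun y => ∑ l ∈ Finset.range n, W (y, l)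
      exact Finset.measurable_fun_sum _ fun l _ =>
        (hW.comp (measurable_id.prodMk measurable_const) : Measurable fun x => W (x, l))
  exact h.comp measurable_swap

lemma sum_topLift {M : Type*} [AddCommMonoid M] (hpos : ∀ x, 0 < τ x) (m : α → M) (x : α) :
    ∑ l ∈ Finset.range (τ x), topLift τ m (x, l) = m x := by
  obtain ⟨k, hk⟩ := Nat.exists_eq_succ_of_ne_zero (hpos x).ne'
  rw [Finset.sum_eq_single_of_mem k (by simp [hk])]
  · simp [topLift, hk]
  · intro l _ hl
    have : ¬ l + 1 = τ x := by omega
    simp [topLift, this]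

/-- Below the top level, `W` is the increment of its own partial sums along the column. At the top,
the orbit returns to the base, where the lifted coboundary is `χ (F x)`; what is left over is the
induced martingale difference. -/
lemma tower_decomposition (hpos : ∀ x, 0 < τ x) (q : Tower τ) :
    W q.1 = topLift τ (fun x => towerSum τ W x + χ x - χ (F x)) q.1 +
      (corrLift χ W (towerMap F τ hpos q).1 - corrLift χ W q.1) := by
  obtain ⟨⟨x, l⟩, hl⟩ := q
  rw [towerMap_val]
  simp only at hl
  by_cases h : l + 1 < τ x
  · have h' : ¬ l + 1 = τ x := h.ne
    simp only [topLift, towerStep, h, h', corrLift, if_true, if_false, Finset.sum_range_succ]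
    abel
  · have h' : l + 1 = τ x := by omega
    have hsum : towerSum τ W x = ∑ i ∈ Finset.range l, W (x, i) + W (x, l) := by
      rw [towerSum, ← h', Finset.sum_range_succ]
    have e1 : towerStep F τ (x, l) = (F x, 0) := by simp [towerStep, h]
    have e2 : ∀ m : α → E, topLift τ m (x, l) = m x := fun m => by simp [topLift, h']
    rw [e1, e2]
    simp only [corrLift, hsum, Finset.range_zero, Finset.sum_empty]
    abel

lemma birkhoffSum_tower (hpos : ∀ x, 0 < τ x) (n : ℕ) (q : Tower τ) :
    birkhoffSum (towerMap F τ hpos) (fun q => W q.1) n q =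
      birkhoffSum (towerMap F τ hpos)
        (fun q => topLift τ (fun x => towerSum τ W x + χ x - χ (F x)) q.1) n q +
      (corrLift χ W ((towerMap F τ hpos)^[n] q).1 - corrLift χ W q.1) := by
  induction n with
  | zero => simp
  | succ n ih =>
    rw [birkhoffSum_succ, birkhoffSum_succ, ih, Function.iterate_succ_apply',
      tower_decomposition (F := F) (χ := χ) (W := W) hpos ((towerMap F τ hpos)^[n] q)]
    abel

variable (hF : MeasurePreserving F μ μ) (hτ : Measurable τ) (hpos : ∀ x, 0 < τ x)
  (hfin : ∫⁻ a, (τ a : ℝ≥0∞) ∂μ ≠ ∞)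

include hτ hpos hfin

lemma integral_topLift {E' : Type*} [NormedAddCommGroup E'] [NormedSpace ℝ E'] [CompleteSpace E']
    {h : α → E'}
    (hi : Integrable (fun q : Tower τ => topLift τ h q.1) (towerMeasure τ μ)) :
    ∫ q : Tower τ, topLift τ h q.1 ∂towerMeasure τ μ =
      (∫⁻ a, (τ a : ℝ≥0∞) ∂μ).toReal⁻¹ • ∫ x, h x ∂μ := by
  rw [integral_tower hτ hfin (zero_lt_one.trans_le (one_le_lintegral_time hpos)).ne' hi]
  simp_rw [sum_topLift hpos]

lemma integrable_topLift {h : α → ℝ} (hm : Measurable h) (hi : Integrable h μ) :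
    Integrable (fun q : Tower τ => topLift τ h q.1) (towerMeasure τ μ) := by
  refine ⟨((measurable_topLift hτ hm).comp measurable_subtype_coe).aestronglyMeasurable, ?_⟩
  have h1 : ∀ p : α × ℕ, ‖topLift τ h p‖ₑ = topLift τ (fun x => ‖h x‖ₑ) p := fun p => by
    unfold topLift
    split_ifs <;> simp
  unfold HasFiniteIntegral
  simp_rw [h1]
  rw [lintegral_tower hτ (measurable_topLift hτ hm.enorm)]
  simp_rw [sum_topLift hpos]
  refine ENNReal.mul_lt_top (ENNReal.inv_lt_top.2 ?_) hi.2
  exact zero_lt_one.trans_le (one_le_lintegral_time hpos)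

include hF

/-- The lift is supported on the top level, and from there the tower map goes to the base over `F
x`; so only the trace of `A` on the base matters. -/
lemma setIntegral_topLift_sq (hm : Measurable m) (hm2 : MemLp m 2 μ) {A : Set (Tower τ)}
    (hA : MeasurableSet A) :
    ∫ q in towerMap F τ hpos ⁻¹' A, ‖topLift τ m q.1‖ ^ 2 ∂towerMeasure τ μ =
      (∫⁻ a, (τ a : ℝ≥0∞) ∂μ).toReal⁻¹ *
        ∫ x in F ⁻¹' (towerBase hpos ⁻¹' A), ‖m x‖ ^ 2 ∂μ := by
  have hb : Measurable (towerBase hpos) :=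
    measurable_comap_iff.2 (measurable_id.prodMk measurable_const)
  have hD : MeasurableSet (F ⁻¹' (towerBase hpos ⁻¹' A)) := hF.measurable (hb hA)
  set h : α → ℝ := (F ⁻¹' (towerBase hpos ⁻¹' A)).indicator fun x => ‖m x‖ ^ 2
  have hh : Measurable h := (hm.norm.pow_const 2).indicator hD
  have hhi : Integrable h μ := (hm2.integrable_norm_pow two_ne_zero).indicator hD
  rw [← integral_indicator (measurable_towerMap hF.measurable hτ hpos hA), ← integral_indicator hD,
    ← smul_eq_mul, ← integral_topLift hτ hpos hfin (integrable_topLift hτ hpos hfin hh hhi)]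
  refine integral_congr_ae (.of_forall fun q => ?_)
  obtain ⟨⟨x, l⟩, hl⟩ := q
  by_cases hlt : l + 1 = τ x
  · have e : towerMap F τ hpos ⟨(x, l), hl⟩ = towerBase hpos (F x) := by
      apply Subtype.ext
      rw [towerMap_val]
      simp [towerStep, hlt, towerBase]
    by_cases hx : towerBase hpos (F x) ∈ A
    · simp [Set.indicator, e, hx, topLift, hlt, h]
    · simp [Set.indicator, e, hx, topLift, hlt, h]
  · simp [topLift, hlt, Set.indicator]

/-- On the support of the lift, a function of the image point is the function `G (F x, 0)` of `F x`,
to which the orthogonality of `m` applies. `map_towerBase_le` ensures that the restriction of `G` to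
the base is in `L²`. -/
lemma IsReverseDiff.topLift (hm : IsReverseDiff F μ m) :
    IsReverseDiff (towerMap F τ hpos) (towerMeasure τ μ) (fun q => topLift τ m q.1) := by
  have hmeas : Measurable fun q : Tower τ => NUH.topLift τ m q.1 :=
    (measurable_topLift hτ hm.measurable).comp measurable_subtype_coe
  have hmem : MemLp (fun q : Tower τ => NUH.topLift τ m q.1) 2 (towerMeasure τ μ) := by
    rw [memLp_two_iff_integrable_sq_norm hmeas.aestronglyMeasurable]
    refine (integrable_topLift hτ hpos hfin (hm.measurable.norm.pow_const 2)
      (hm.memLp.integrable_norm_pow two_ne_zero)).congr (.of_forall fun q => ?_)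
    simp only [NUH.topLift]
    split_ifs <;> simp
  refine ⟨hmeas, hmem, fun G hG => ?_⟩
  have hf := measurePreserving_towerMap hF hτ hpos
  have hi := integrable_inner_of_memLp hmem (hG.comp_measurePreserving hf)
  have hb : Measurable (towerBase hpos) :=
    measurable_comap_iff.2 (measurable_id.prodMk measurable_const)
  have hG0 : MemLp (fun x => G (towerBase hpos x)) 2 μ :=
    (hG.of_measure_le_smul hfin (map_towerBase_le hτ hpos hfin)).comp_of_map hb.aemeasurable
  have e : ∀ q : Tower τ, inner ℝ (NUH.topLift τ m q.1) (G (towerMap F τ hpos q)) =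
      NUH.topLift τ (fun x => inner ℝ (m x) (G (towerBase hpos (F x)))) q.1 := by
    rintro ⟨⟨x, l⟩, hl⟩
    by_cases hlt : l + 1 = τ x
    · have e : towerMap F τ hpos ⟨(x, l), hl⟩ = towerBase hpos (F x) := by
        apply Subtype.ext
        rw [towerMap_val]
        simp [towerStep, hlt, towerBase]
      simp [NUH.topLift, hlt, e]
    · simp [NUH.topLift, hlt]
  simp only [Function.comp_def, e] at hi
  simp_rw [e]
  rw [integral_topLift hτ hpos hfin hi, hm.orthogonal _ hG0, smul_zero]

end TowerMartingale

/-! ### Tail bounds for Birkhoff sums on the tower -/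

/-- An observable on the tower, bounded by `B a`, which is Hölder with respect to the symbolic
metric with a loss that depends on the height of the tower. -/
structure IsTowerObservable {α E : Type*} [MeasurableSpace α] [NormedAddCommGroup E]
    [MeasurableSpace E] (F : α → α) (label τ : α → ℕ) (a : α → ℝ) (B θ : ℝ)
    (W : α × ℕ → E) : Prop where
  measurable : Measurable W
  bound : ∀ x l, l < τ x → ‖W (x, l)‖ ≤ B * a x
  holder : ∀ (n : ℕ) (x x' : α) (l : ℕ), 1 ≤ n →
    (∀ i < n, label (F^[i] x) = label (F^[i] x')) → l < τ x →
    ‖W (x, l) - W (x', l)‖ ≤ B * (a x * θ ^ (n - τ x))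

/-- The inducing time is positive, measurable and constant on partition elements. -/
structure IsInducingTime {α : Type*} [MeasurableSpace α] (label τ : α → ℕ) : Prop where
  measurable : Measurable τ
  pos : ∀ x, 0 < τ x
  const : ∀ x x', label x = label x' → τ x = τ x'

section Tails

variable {α E : Type*} [MeasurableSpace α] {μ : Measure α} [IsProbabilityMeasure μ] {F : α → α}
  {label : α → ℕ} {τ : α → ℕ} {L γ θ B : ℝ} {a : α → ℝ}
  [NormedAddCommGroup E] [InnerProductSpace ℝ E] [CompleteSpace E] [MeasurableSpace E]
  [BorelSpace E] [SecondCountableTopology E] {m χ : α → E} {W : α × ℕ → E}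

/-- Summation over a column turns the weight `a` into `t = a * τ`, so the integral of `t * τ` in the
decomposition is a second moment of `τ` weighted by `a`. -/
lemma IsTowerObservable.isSymbolicHolder (hτ : IsInducingTime label τ)
    (hW : IsTowerObservable F label τ a B θ W) :
    IsSymbolicHolder F label τ (fun x => a x * τ x) B θ (towerSum τ W) := by
  refine ⟨measurable_towerSum hτ.measurable hW.measurable, fun x => ?_, fun n x x' hn h => ?_⟩
  · refine (norm_sum_le _ _).trans ?_
    refine (Finset.sum_le_sum fun l hl => hW.bound x l (Finset.mem_range.1 hl)).trans_eq ?_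
    simp only [Finset.sum_const, Finset.card_range, nsmul_eq_mul]
    ring
  · have hc : τ x' = τ x := (hτ.const x x' (h 0 hn)).symm
    rw [towerSum, towerSum, hc, ← Finset.sum_sub_distrib]
    refine (norm_sum_le _ _).trans ?_
    refine (Finset.sum_le_sum fun l hl =>
      hW.holder n x x' l hn h (Finset.mem_range.1 hl)).trans_eq ?_
    simp only [Finset.sum_const, Finset.card_range, nsmul_eq_mul]
    ring

lemma IsInducingTime.isWeight (hτ : IsInducingTime label τ) (ha : Measurable a)
    (hac : ∀ x x', label x = label x' → a x = a x') (ha0 : ∀ x, 0 ≤ a x) (ha1 : ∀ x, a x ≤ 1) :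
    IsWeight label τ (fun x => a x * τ x) where
  measurable_τ := hτ.measurable
  measurable_t := ha.mul (measurable_from_top.comp hτ.measurable)
  τ_pos := hτ.pos
  τ_const := hτ.const
  t_const x x' h := by rw [hac x x' h, hτ.const x x' h]
  t_nonneg x := mul_nonneg (ha0 x) (Nat.cast_nonneg _)
  t_le x := mul_le_of_le_one_left (Nat.cast_nonneg _) (ha1 x)

lemma IsInducingTime.lintegral_ne_top (_hτ : IsInducingTime label τ)
    (hi : Integrable (fun x => (τ x : ℝ)) μ) : ∫⁻ x, (τ x : ℝ≥0∞) ∂μ ≠ ∞ := by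
  have := hi.2
  unfold HasFiniteIntegral at this
  refine ne_of_lt (lt_of_eq_of_lt (lintegral_congr fun x => ?_) this)
  rw [← Real.enorm_natCast]

lemma IsInducingTime.one_le_toReal (hτ : IsInducingTime label τ)
    (hi : Integrable (fun x => (τ x : ℝ)) μ) : 1 ≤ (∫⁻ x, (τ x : ℝ≥0∞) ∂μ).toReal := by
  rw [← ENNReal.toReal_one]
  exact ENNReal.toReal_mono (hτ.lintegral_ne_top hi) (one_le_lintegral_time hτ.pos)

lemma IsInducingTime.one_le (hτ : IsInducingTime label τ) (x : α) : (1 : ℝ) ≤ τ x := by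
  exact_mod_cast hτ.pos x

lemma integral_towerSum_eq_zero (hτ : IsInducingTime label τ)
    (hi : Integrable (fun x => (τ x : ℝ)) μ)
    (hWi : Integrable (fun q : Tower τ => W q.1) (towerMeasure τ μ))
    (h0 : ∫ q : Tower τ, W q.1 ∂towerMeasure τ μ = 0) : ∫ x, towerSum τ W x ∂μ = 0 := by
  have h1 := hτ.one_le_toReal hi
  rw [integral_tower hτ.measurable (hτ.lintegral_ne_top hi)
    (zero_lt_one.trans_le (one_le_lintegral_time hτ.pos)).ne' hWi, smul_eq_zero] at h0
  exact h0.resolve_left (by positivity)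

lemma IsTowerObservable.integrable (hτ : IsInducingTime label τ)
    (hi : Integrable (fun x => (τ x : ℝ)) μ) (hW : IsTowerObservable F label τ a B θ W)
    (ha1 : ∀ x, a x ≤ 1) (hB : 0 ≤ B) :
    Integrable (fun q : Tower τ => W q.1) (towerMeasure τ μ) := by
  have := isProbabilityMeasure_tower (μ := μ) hτ.measurable hτ.pos (hτ.lintegral_ne_top hi)
  refine Integrable.of_bound (hW.measurable.comp measurable_subtype_coe).aestronglyMeasurable B
    (.of_forall fun q => (hW.bound q.1.1 q.1.2 q.2).trans ?_)
  exact mul_le_of_le_one_right hB (ha1 _)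

lemma norm_corrLift_le {R : ℝ} (hW : IsTowerObservable F label τ a B θ W)
    (hχ : ∀ x, ‖χ x‖ ≤ R) (q : Tower τ) :
    ‖corrLift χ W q.1‖ ≤ R + B * (a q.1.1 * q.1.2) := by
  refine (norm_add_le _ _).trans (add_le_add (hχ _) ((norm_sum_le _ _).trans ?_))
  refine (Finset.sum_le_sum fun l hl => hW.bound q.1.1 l
    ((Finset.mem_range.1 hl).trans q.2)).trans_eq ?_
  simp only [Finset.sum_const, Finset.card_range, nsmul_eq_mul]
  ring

lemma IsInducingTime.measureReal_tower_le (hτ : IsInducingTime label τ)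
    (hi : Integrable (fun x => (τ x : ℝ)) μ) {D : Set α} (hD : MeasurableSet D) :
    (towerMeasure τ μ).real {q : Tower τ | q.1.1 ∈ D} ≤ ∫ x in D, (τ x : ℝ) ∂μ := by
  have hfin := hτ.lintegral_ne_top hi
  have hZ := one_le_lintegral_time (μ := μ) hτ.pos
  rw [integral_eq_lintegral_of_nonneg_ae (.of_forall fun x => Nat.cast_nonneg _)
    (measurable_from_top.comp hτ.measurable).aestronglyMeasurable]
  have hD' : MeasurableSet {q : Tower τ | q.1.1 ∈ D} :=
    (measurable_fst.comp measurable_subtype_coe) hD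
  have h1 : towerMeasure τ μ {q : Tower τ | q.1.1 ∈ D} =
      (∫⁻ a, (τ a : ℝ≥0∞) ∂μ)⁻¹ * ∫⁻ x, τ x * D.indicator 1 x ∂μ := by
    rw [← lintegral_tower_base hτ.measurable (measurable_one.indicator hD),
      ← lintegral_indicator_one hD']
    rfl
  have h2 : ∫⁻ x, τ x * D.indicator 1 x ∂μ = ∫⁻ x in D, ENNReal.ofReal (τ x) ∂μ := by
    rw [← lintegral_indicator hD]
    refine lintegral_congr fun x => ?_
    by_cases hx : x ∈ D <;> simp [hx]
  refine ENNReal.toReal_mono ?_ ?_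
  · simp only [ENNReal.ofReal_natCast]
    exact ne_top_of_le_ne_top hfin (setLIntegral_le_lintegral _ _)
  · rw [h1, h2]
    exact mul_le_of_le_one_left zero_le (ENNReal.inv_le_one.2 hZ)

/-- Tail bound for square integrable inducing times. -/
lemma GibbsMarkov.tail_of_sq_integrable (hG : GibbsMarkov F label μ L γ)
    (hτ : IsInducingTime label τ) (hi : Integrable (fun x => (τ x : ℝ) ^ 2) μ)
    (hθ : 0 < θ) (hθ1 : θ < 1) (hW : IsTowerObservable F label τ (fun _ => 1) 1 θ W)
    (h0 : ∫ q : Tower τ, W q.1 ∂towerMeasure τ μ = 0) {R s : ℝ}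
    (hR : correctorConst L γ θ * ∫ x, (τ x : ℝ) ^ 2 ∂μ ≤ R)
    (hs : 2 * (Real.exp (couplingConst L γ) * ∫ x, (τ x : ℝ) ^ 2 ∂μ) + 8 * R ^ 2 ≤ s)
    {M : ℕ} (hM : 1 ≤ M) (n : ℕ) {lam : ℝ} (hl : 0 < lam) :
    (towerMeasure τ μ).real {q | ∃ j ≤ n, (4 * M + 2) * (1 + R) * lam ≤
        ‖birkhoffSum (towerMap F τ hτ.pos) (fun q => W q.1) j q‖} ≤
      (towerMeasure τ μ).real {q | ∃ j ≤ n, lam < τ ((towerMap F τ hτ.pos)^[j] q).1.1} +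
        (n * s / lam ^ 2) ^ M := by
  have hi1 : Integrable (fun x => (τ x : ℝ)) μ :=
    hi.mono' (measurable_from_top.comp hτ.measurable).aestronglyMeasurable
      (.of_forall fun x => by
        have := hτ.one_le x
        rw [Real.norm_eq_abs, abs_of_nonneg (by positivity)]
        nlinarith)
  have hfin := hτ.lintegral_ne_top hi1
  have hprob := isProbabilityMeasure_tower (μ := μ) hτ.measurable hτ.pos hfin
  have hR0 : 0 ≤ R := (mul_nonneg (hG.correctorConst_nonneg hθ1)
    (integral_nonneg fun x => by positivity)).trans hR
  have hs0 : 0 ≤ s := le_trans (by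
    have : 0 ≤ ∫ x, (τ x : ℝ) ^ 2 ∂μ := integral_nonneg fun x => by positivity
    positivity) hs
  set f := towerMap F τ hτ.pos with hf_def
  set P := towerMeasure τ μ
  have hf : MeasurePreserving f P P := measurePreserving_towerMap hG.preserves hτ.measurable hτ.pos
  -- Column heights are at least one, so for `lam < 1` the first probability on the right is one.
  by_cases hl1 : lam < 1
  · have hu : {q : Tower τ | ∃ j ≤ n, lam < τ (f^[j] q).1.1} = Set.univ :=
      Set.eq_univ_of_forall fun q => ⟨0, Nat.zero_le _, hl1.trans_le (hτ.one_le _)⟩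
    rw [hu, probReal_univ]
    have : 0 ≤ (n * s / lam ^ 2) ^ M := by positivity
    linarith [measureReal_le_one (μ := P)
      (s := {q | ∃ j ≤ n, (4 * M + 2) * (1 + R) * lam ≤ ‖birkhoffSum f (fun q => W q.1) j q‖})]
  push Not at hl1
  have hw := hτ.isWeight (a := fun _ => 1) measurable_const (fun _ _ _ => rfl)
    (fun _ => zero_le_one) (fun _ => le_rfl)
  have hΦ := hW.isSymbolicHolder hτ
  have e1 : (fun x => (1 : ℝ) * (τ x : ℝ) * τ x) = fun x => (τ x : ℝ) ^ 2 := by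
    ext x; ring
  have ht : Integrable (fun x => (1 : ℝ) * (τ x : ℝ) * τ x) μ := by rwa [e1]
  obtain ⟨χ, hχm, hχ, hm⟩ := hG.exists_corrector hw ht hθ hθ1 zero_le_one hΦ
    (integral_towerSum_eq_zero hτ hi1
      (hW.integrable hτ hi1 (fun _ => le_rfl) zero_le_one) h0)
  have hχ' : ∀ x, ‖χ x‖ ≤ R := fun x => (hχ x).trans (by rw [mul_one, e1]; exact hR)
  have hv : ∀ A, MeasurableSet A →
      ∫ x in F ⁻¹' A, ‖towerSum τ W x + χ x - χ (F x)‖ ^ 2 ∂μ ≤ s * μ.real A := fun A hA => by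
    refine (hG.condVariance_le hw ht hΦ hχ' hm hA).trans ?_
    rw [e1]
    exact mul_le_mul_of_nonneg_right (by linarith) measureReal_nonneg
  set m : α → E := fun x => towerSum τ W x + χ x - χ (F x) with hm_def
  have hmt := IsReverseDiff.topLift hG.preserves hτ.measurable hτ.pos hfin hm
  -- The normalising factor of the tower measure cancels against the mass of the base, so the
  -- conditional variance bound passes to the tower with the same `s`.
  have hvt : ∀ A, MeasurableSet A →
      ∫ q in f ⁻¹' A, ‖topLift τ m q.1‖ ^ 2 ∂P ≤ s * P.real A := fun A hA => by
    have hb : Measurable (towerBase hτ.pos) :=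
      measurable_comap_iff.2 (measurable_id.prodMk measurable_const)
    rw [setIntegral_topLift_sq hG.preserves hτ.measurable hτ.pos hfin hm.measurable hm.memLp hA]
    have h1 := hτ.one_le_toReal hi1
    have h2 := map_towerBase_le (μ := μ) hτ.measurable hτ.pos hfin A
    rw [Measure.map_apply hb hA, Measure.smul_apply, smul_eq_mul] at h2
    have h3 : μ.real (towerBase hτ.pos ⁻¹' A) ≤ (∫⁻ a, (τ a : ℝ≥0∞) ∂μ).toReal * P.real A := by
      have := ENNReal.toReal_mono (ENNReal.mul_ne_top hfin (measure_ne_top _ _)) h2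
      rwa [ENNReal.toReal_mul] at this
    rw [inv_mul_le_iff₀ (by positivity)]
    refine (hv _ (hb hA)).trans ?_
    calc s * μ.real (towerBase hτ.pos ⁻¹' A) ≤
        s * ((∫⁻ a, (τ a : ℝ≥0∞) ∂μ).toReal * P.real A) := mul_le_mul_of_nonneg_left h3 hs0
      _ = _ := by ring
  -- On columns of height at most `lam`, where `lam ≥ 1`, jumps are at most `lam + 2 * R ≤ b`. Then
  -- `lam + b = 2 * (1 + R) * lam`; the doubling in `mem_crossing_of_le` gives `4 * M * (1 + R) *
  -- lam`, and the coboundary at the two ends of the orbit another `2 * (1 + R) * lam`.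
  have key := hmt.iterated_kolmogorov hf (b := (1 + 2 * R) * lam) hs0 hl (by positivity) hvt n hM
    n le_rfl Set.univ MeasurableSet.univ
  simp only [Set.preimage_univ, Set.inter_univ, probReal_univ, mul_one] at key
  refine le_trans ?_ (add_le_add_right key _)
  refine le_trans (measureReal_mono ?_ (measure_ne_top _ _)) (measureReal_union_le _ _)
  rintro q ⟨j, hj, hq⟩
  by_contra hcon
  simp only [Set.mem_union, Set.mem_ofPred_eq, Set.mem_inter_iff, not_or, not_exists, not_and,
    not_lt] at hcon
  obtain ⟨hcτ, hc2⟩ := hcon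
  have hcorr : ∀ i ≤ n, ‖corrLift χ W (f^[i] q).1‖ ≤ (R + 1) * lam := fun i hi => by
    refine (norm_corrLift_le hW hχ' _).trans ?_
    have h1 : ((f^[i] q).1.2 : ℝ) ≤ τ (f^[i] q).1.1 := by exact_mod_cast (f^[i] q).2.le
    have h2 := hcτ i hi
    nlinarith
  refine hc2 (mem_crossing_of_le (by positivity) hj ?_) fun k hk => ?_
  · have h1 := birkhoffSum_tower (F := F) (χ := χ) (W := W) hτ.pos j q
    have h2 := hcorr j hj
    have h3 := hcorr 0 (Nat.zero_le _)
    rw [h1] at hq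
    have h4 := norm_add_le (birkhoffSum f (fun q => topLift τ m q.1) j q)
      (corrLift χ W (f^[j] q).1 - corrLift χ W q.1)
    have h5 := norm_sub_le (corrLift χ W (f^[j] q).1) (corrLift χ W q.1)
    simp only [Function.iterate_zero, id] at h3
    have h6 : (4 * M + 2) * (1 + R) * lam ≤
        ‖birkhoffSum f (fun q => topLift τ m q.1) j q‖ + 2 * ((R + 1) * lam) := by
      refine hq.trans (h4.trans ?_)
      linarith
    nlinarith
  · simp only [topLift]
    split_ifs with h
    · have h1 := hΦ.bound (f^[k] q).1.1
      have h2 := hcτ k hk.le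
      have h3 := hχ' (f^[k] q).1.1
      have h4 := hχ' (F (f^[k] q).1.1)
      have h5 := norm_sub_le (towerSum τ W (f^[k] q).1.1 + χ (f^[k] q).1.1) (χ (F (f^[k] q).1.1))
      have h6 := norm_add_le (towerSum τ W (f^[k] q).1.1) (χ (f^[k] q).1.1)
      simp only [hm_def]
      nlinarith
    · simp only [norm_zero]
      positivity

end Tails

/-! ### Truncation of tower observables when `τ` has no second moment. -/

section Truncation

variable {α E : Type*} [MeasurableSpace α] {μ : Measure α} [IsProbabilityMeasure μ] {F : α → α}
  {label : α → ℕ} {τ : α → ℕ} {L γ θ B : ℝ} {a : α → ℝ}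
  [NormedAddCommGroup E] [InnerProductSpace ℝ E] [CompleteSpace E] [MeasurableSpace E]
  [BorelSpace E] [SecondCountableTopology E] {m χ : α → E} {W : α × ℕ → E}

/-- The centred truncation of a tower observable to columns of height at most `lam`. -/
noncomputable def truncation (τ : α → ℕ) (lam : ℝ) (c : E) (W : α × ℕ → E) (p : α × ℕ) : E :=
  if (τ p.1 : ℝ) ≤ lam then W p - c else 0

/-- The indicator function of the columns of height at most `lam`. -/
noncomputable def lowColumn (τ : α → ℕ) (lam : ℝ) (x : α) : ℝ := if (τ x : ℝ) ≤ lam then 1 else 0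

lemma measurableSet_lowColumn (hτ : Measurable τ) (lam : ℝ) :
    MeasurableSet {x | (τ x : ℝ) ≤ lam} :=
  measurableSet_le (measurable_from_top.comp hτ) measurable_const

lemma isTowerObservable_truncation (hτ : IsInducingTime label τ) (hθ : 0 < θ)
    (hW : IsTowerObservable F label τ (fun _ => 1) 1 θ W) {lam : ℝ} {c : E} (hc : ‖c‖ ≤ 1) :
    IsTowerObservable F label τ (lowColumn τ lam) 2 θ (truncation τ lam c W) where
  measurable := Measurable.ite (measurableSet_lowColumn (hτ.measurable.comp measurable_fst) lam)
    (hW.measurable.sub_const c) measurable_const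
  bound x l hl := by
    unfold truncation lowColumn
    split_ifs
    · have h1 := hW.bound x l hl
      have h2 := norm_sub_le (W (x, l)) c
      linarith
    · simp
  holder n x x' l hn h hl := by
    have hτc := hτ.const x x' (h 0 hn)
    unfold truncation lowColumn
    simp only [← hτc]
    split_ifs
    · have h1 := hW.holder n x x' l hn h hl
      rw [sub_sub_sub_cancel_right]
      have : 0 < θ ^ (n - τ x) := by positivity
      linarith
    · simp

/-- Tail bound for integrable inducing times. -/
lemma GibbsMarkov.tail_of_integrable (hG : GibbsMarkov F label μ L γ)
    (hτ : IsInducingTime label τ) (hi : Integrable (fun x => (τ x : ℝ)) μ)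
    (hθ : 0 < θ) (hθ1 : θ < 1) (hW : IsTowerObservable F label τ (fun _ => 1) 1 θ W)
    (h0 : ∫ q : Tower τ, W q.1 ∂towerMeasure τ μ = 0) {R H : ℝ}
    (hR : correctorConst L γ θ ≤ R) (hH : ∫ x, (τ x : ℝ) ∂μ ≤ H) {n : ℕ} (hn : 1 ≤ n)
    {lam : ℝ} (hl : 0 < lam)
    (hA : 1 ≤ lam → ∫ x in {x | (τ x : ℝ) ≤ lam}, (τ x : ℝ) ^ 2 ∂μ ≤ H * lam) :
    (towerMeasure τ μ).real {q | ∃ j ≤ n, (7 + 4 * R * H) * lam ≤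
        ‖birkhoffSum (towerMap F τ hτ.pos) (fun q => W q.1) j q‖} ≤
      n * ((4 + 8 * R * H) * (∫ x in {x | (τ x : ℝ) ≤ lam}, (τ x : ℝ) ^ 2 ∂μ) / lam ^ 2 +
        2 * (∫ x in {x | lam < (τ x : ℝ)}, (τ x : ℝ) ∂μ) / lam) := by
  have hfin := hτ.lintegral_ne_top hi
  have hprob := isProbabilityMeasure_tower (μ := μ) hτ.measurable hτ.pos hfin
  have hR0 : 0 ≤ R := (hG.correctorConst_nonneg hθ1).trans hR
  have hH0 : 0 ≤ H := (integral_nonneg fun x => by positivity).trans hH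
  set f := towerMap F τ hτ.pos with hf_def
  set P := towerMeasure τ μ
  have hn1 : (1 : ℝ) ≤ n := by exact_mod_cast hn
  have hf : MeasurePreserving f P P := measurePreserving_towerMap hG.preserves hτ.measurable hτ.pos
  have hA0 : 0 ≤ ∫ x in {x | (τ x : ℝ) ≤ lam}, (τ x : ℝ) ^ 2 ∂μ :=
    integral_nonneg fun x => by positivity
  set A := ∫ x in {x | (τ x : ℝ) ≤ lam}, (τ x : ℝ) ^ 2 ∂μ with hA_def
  have hhigh : MeasurableSet {x | lam < (τ x : ℝ)} :=
    measurableSet_lt measurable_const (measurable_from_top.comp hτ.measurable)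
  -- All columns are then higher than `lam`, and the last term on the right already exceeds one.
  by_cases hl1 : lam < 1
  · have hu : {x | lam < (τ x : ℝ)} = Set.univ :=
      Set.eq_univ_of_forall fun q => hl1.trans_le (hτ.one_le _)
    have hT : 1 ≤ ∫ x, (τ x : ℝ) ∂μ := by
      calc (1 : ℝ) = ∫ _, 1 ∂μ := by simp
        _ ≤ _ := integral_mono (integrable_const _) hi hτ.one_le
    rw [hu, Measure.restrict_univ]
    have h1 : 1 ≤ 2 * (∫ x, (τ x : ℝ) ∂μ) / lam := by
      rw [le_div_iff₀ hl]; linarith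
    have h2 : 0 ≤ (4 + 8 * R * H) * A / lam ^ 2 := by positivity
    refine measureReal_le_one.trans ?_
    nlinarith
  push Not at hl1
  have hA := hA hl1
  have hlow := measurableSet_lowColumn hτ.measurable lam
  have hWi := hW.integrable hτ hi (fun _ => le_rfl) zero_le_one
  set D : Set (Tower τ) := {q | (τ q.1.1 : ℝ) ≤ lam} with hD_def
  have hD : MeasurableSet D := (measurable_fst.comp measurable_subtype_coe) hlow
  have hPD : P.real Dᶜ ≤ ∫ x in {x | lam < (τ x : ℝ)}, (τ x : ℝ) ∂μ := by
    have := hτ.measureReal_tower_le hi hhigh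
    refine le_of_eq_of_le ?_ this
    congr 1
    ext q
    simp [hD_def]
  -- The mean of `W` over the low columns, so that the truncation has integral zero. Since `W`
  -- itself is centred, `P.real D * ‖c‖` is at most the mass of the high columns.
  set c : E := (P.real D)⁻¹ • ∫ q in D, W q.1 ∂P with hc_def
  have hID : ‖∫ q in D, W q.1 ∂P‖ ≤ P.real D := by
    refine (norm_setIntegral_le_of_norm_le_const (C := 1) (measure_lt_top _ _)
      fun q _ => ?_).trans (by simp)
    simpa using hW.bound q.1.1 q.1.2 q.2
  have hc : ‖c‖ ≤ 1 := by
    rw [hc_def, norm_smul, norm_inv, Real.norm_of_nonneg measureReal_nonneg]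
    rcases (measureReal_nonneg (μ := P) (s := D)).eq_or_lt with h | h
    · rw [← h]; simp
    · rw [inv_mul_le_iff₀ h]; simpa using hID
  have hcD : P.real D • c = ∫ q in D, W q.1 ∂P := by
    rcases (measureReal_nonneg (μ := P) (s := D)).eq_or_lt with h | h
    · rw [← h] at hID ⊢
      rw [zero_smul, norm_le_zero_iff.1 hID]
    · rw [hc_def, smul_smul, mul_inv_cancel₀ h.ne', one_smul]
  set V := truncation τ lam c W with hV_def
  have hV : IsTowerObservable F label τ (lowColumn τ lam) 2 θ V :=
    isTowerObservable_truncation hτ hθ hW hc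
  have ha1 : ∀ x, lowColumn τ lam x ≤ 1 := fun x => by unfold lowColumn; split_ifs <;> norm_num
  have ha0 : ∀ x, 0 ≤ lowColumn τ lam x := fun x => by unfold lowColumn; split_ifs <;> norm_num
  have hVi := hV.integrable hτ hi ha1 zero_le_two
  have hV0 : ∫ q : Tower τ, V q.1 ∂P = 0 := by
    have e : (fun q : Tower τ => V q.1) = D.indicator fun q => W q.1 - c := by
      ext1 q
      by_cases h : (τ q.1.1 : ℝ) ≤ lam <;> simp [hV_def, truncation, Set.indicator, hD_def, h]
    rw [e, integral_indicator hD, integral_sub hWi.integrableOn (integrable_const c),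
      setIntegral_const, hcD, sub_self]
  have ham : Measurable (lowColumn τ lam) := Measurable.ite hlow measurable_const measurable_const
  have hw := hτ.isWeight ham (fun x x' h => by simp only [lowColumn, hτ.const x x' h]) ha0 ha1
  have hΦ := hV.isSymbolicHolder hτ
  have e1 : (fun x => lowColumn τ lam x * (τ x : ℝ) * τ x) =
      {x | (τ x : ℝ) ≤ lam}.indicator fun x => (τ x : ℝ) ^ 2 := by
    ext x
    by_cases h : (τ x : ℝ) ≤ lam
    · simp [lowColumn, Set.indicator, h, sq]
    · simp [lowColumn, Set.indicator, h]
  have e2 : ∫ x, lowColumn τ lam x * (τ x : ℝ) * τ x ∂μ = A := by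
    rw [e1, integral_indicator hlow]
  have ht : Integrable (fun x => lowColumn τ lam x * (τ x : ℝ) * τ x) μ := by
    rw [e1]
    refine Integrable.of_bound (((measurable_from_top (f := fun k : ℕ => (k : ℝ) ^ 2)).comp
      hτ.measurable).indicator hlow).aestronglyMeasurable (lam ^ 2) (.of_forall fun x => ?_)
    by_cases h : (τ x : ℝ) ≤ lam
    · simp only [Set.indicator, Set.mem_ofPred_eq, h, if_true, Real.norm_eq_abs]
      rw [abs_of_nonneg (by positivity)]
      exact pow_le_pow_left₀ (Nat.cast_nonneg _) h 2
    · simp only [Set.indicator, Set.mem_ofPred_eq, h, if_false, norm_zero]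
      positivity
  obtain ⟨χ, hχm, hχ, hm⟩ := hG.exists_corrector hw ht hθ hθ1 zero_le_two hΦ
    (integral_towerSum_eq_zero hτ hi hVi hV0)
  rw [e2] at hχ
  have hχ1 : ∀ x, ‖χ x‖ ≤ 2 * R * A := fun x => (hχ x).trans (by nlinarith)
  have hvar := hG.variance_le hw ht zero_le_two hΦ hχm hχ1 hm
  rw [e2] at hvar
  have ht1 : ∫ x, lowColumn τ lam x * (τ x : ℝ) ∂μ ≤ H :=
    (integral_mono (hw.integrable ht) hi hw.t_le).trans hH
  set m : α → E := fun x => towerSum τ V x + χ x - χ (F x) with hm_def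
  -- The bound of `χ` is proportional to `A`, and `variance_le` is linear in it; so the variance is
  -- proportional to `A` and not to `A ^ 2`.
  have hs : ∫ x, ‖m x‖ ^ 2 ∂μ ≤ (4 + 8 * R * H) * A := by
    refine hvar.trans ?_
    have : 0 ≤ 2 * 2 * (2 * R * A) := by positivity
    nlinarith
  have hmt := IsReverseDiff.topLift hG.preserves hτ.measurable hτ.pos hfin hm
  have hst : ∀ k : ℕ, ∫ q in f^[k + 1] ⁻¹' Set.univ, ‖topLift τ m q.1‖ ^ 2 ∂P ≤
      ((4 + 8 * R * H) * A) * P.real Set.univ := fun k => by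
    have := setIntegral_topLift_sq hG.preserves hτ.measurable hτ.pos hfin hm.measurable hm.memLp
      MeasurableSet.univ
    simp only [Set.preimage_univ, Measure.restrict_univ] at this
    rw [Set.preimage_univ, Measure.restrict_univ, this, probReal_univ, mul_one]
    have h1 := hτ.one_le_toReal hi
    refine le_trans ?_ hs
    exact mul_le_of_le_one_left (integral_nonneg fun x => by positivity) (inv_le_one_of_one_le₀ h1)
  have key := hmt.kolmogorov hf MeasurableSet.univ hl hst n
  simp only [Set.preimage_univ, Set.inter_univ, probReal_univ, mul_one] at key
  -- The discarded part has `L¹` norm at most twice the mass of the high columns. No cancellation is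
  -- used for it: the sum of its norms over the orbit is treated by Markov's inequality.
  set rest : Tower τ → E := fun q => W q.1 - V q.1 with hrest_def
  have hresti : Integrable rest P := hWi.sub hVi
  have hrest : ∫ q, ‖rest q‖ ∂P ≤ 2 * P.real Dᶜ := by
    have h1 : ∀ q, ‖rest q‖ ≤ D.indicator (fun _ => ‖c‖) q + Dᶜ.indicator (fun _ => 1) q := by
      intro q
      by_cases h : (τ q.1.1 : ℝ) ≤ lam
      · simp [hrest_def, hV_def, truncation, Set.indicator, hD_def, h]
      · have := hW.bound q.1.1 q.1.2 q.2
        simpa [hrest_def, hV_def, truncation, Set.indicator, hD_def, h] using this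
    have i1 : Integrable (D.indicator fun _ => ‖c‖) P := (integrable_const _).indicator hD
    have i2 : Integrable (Dᶜ.indicator fun _ => (1 : ℝ)) P :=
      (integrable_const _).indicator hD.compl
    have h2 := integral_mono hresti.norm (i1.add i2) h1
    refine h2.trans ?_
    show ∫ q, (D.indicator (fun _ => ‖c‖) q + Dᶜ.indicator (fun _ => 1) q) ∂P ≤ _
    rw [integral_add i1 i2, integral_indicator_const _ hD, integral_indicator_const _ hD.compl,
      smul_eq_mul, smul_eq_mul, mul_one]
    have h3 : P.real D * ‖c‖ ≤ P.real Dᶜ := by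
      have h4 := integral_add_compl hD hWi
      rw [h0, ← hcD] at h4
      have h5 : ‖P.real D • c‖ = ‖∫ q in Dᶜ, W q.1 ∂P‖ := by
        rw [eq_neg_of_add_eq_zero_left h4, norm_neg]
      rw [norm_smul, Real.norm_of_nonneg measureReal_nonneg] at h5
      rw [h5]
      refine (norm_setIntegral_le_of_norm_le_const (C := 1) (measure_lt_top _ _)
        fun q _ => ?_).trans (by simp)
      simpa using hW.bound q.1.1 q.1.2 q.2
    linarith
  set G : Tower τ → ℝ := birkhoffSum f (fun q => ‖rest q‖) n with hG_def
  have hGi : ∀ i ∈ Finset.range n, Integrable (fun q => ‖rest (f^[i] q)‖) P := fun i _ =>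
    (hf.iterate i).integrable_comp_of_integrable hresti.norm
  have hGI : ∫ q, G q ∂P ≤ n * (2 * P.real Dᶜ) := by
    simp only [hG_def, birkhoffSum]
    rw [integral_finsetSum _ hGi]
    refine (Finset.sum_le_sum fun i _ => ?_).trans_eq
      (by rw [Finset.sum_const, Finset.card_range, nsmul_eq_mul])
    refine le_of_eq_of_le ?_ hrest
    have h1 := integral_map (μ := P) (f := fun q => ‖rest q‖) (hf.iterate i).aemeasurable
      (by rw [(hf.iterate i).map_eq]; exact hresti.norm.aestronglyMeasurable)
    rw [(hf.iterate i).map_eq] at h1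
    exact h1.symm
  have hGint : Integrable G P := by
    simp only [hG_def]
    exact integrable_finsetSum _ hGi
  have hG0 : ∀ q, 0 ≤ G q := fun q => Finset.sum_nonneg fun i _ => norm_nonneg _
  have hmark : P.real {q | lam ≤ G q} ≤ n * (2 * P.real Dᶜ) / lam := by
    rw [le_div_iff₀ hl, mul_comm]
    exact (mul_meas_ge_le_integral_of_nonneg (.of_forall hG0) hGint lam).trans hGI
  have hfinal : P.real (crossing f (fun q => topLift τ m q.1) lam n) + P.real {q | lam ≤ G q} ≤
      n * ((4 + 8 * R * H) * A / lam ^ 2 +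
        2 * (∫ x in {x | lam < (τ x : ℝ)}, (τ x : ℝ) ∂μ) / lam) := by
    calc _ ≤ n * ((4 + 8 * R * H) * A) / lam ^ 2 + n * (2 * P.real Dᶜ) / lam :=
          add_le_add key hmark
      _ ≤ n * ((4 + 8 * R * H) * A) / lam ^ 2 +
          n * (2 * (∫ x in {x | lam < (τ x : ℝ)}, (τ x : ℝ) ∂μ)) / lam := by gcongr
      _ = _ := by ring
  refine le_trans (le_trans (measureReal_mono ?_ (measure_ne_top _ _))
    (measureReal_union_le _ _)) hfinal
  rintro q ⟨j, hj, hq⟩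
  by_contra hcon
  simp only [Set.mem_union, Set.mem_ofPred_eq, not_or, not_le] at hcon
  obtain ⟨hc1, hc2⟩ := hcon
  -- The three contributions add up to the threshold: `2 * lam` from the maximal inequality, `2 * (2
  -- * R * H + 2) * lam` from the coboundary at both ends, and `lam` from the discarded part.
  have hcorr : ∀ i, ‖corrLift χ V (f^[i] q).1‖ ≤ (2 * R * H + 2) * lam := fun i => by
    refine (norm_corrLift_le hV hχ1 _).trans ?_
    have h1 : lowColumn τ lam (f^[i] q).1.1 * (f^[i] q).1.2 ≤ lam := by
      have h1 : ((f^[i] q).1.2 : ℝ) ≤ τ (f^[i] q).1.1 := by exact_mod_cast (f^[i] q).2.le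
      unfold lowColumn
      split_ifs with h
      · linarith
      · linarith
    have h2 : 2 * R * A ≤ 2 * R * (H * lam) := mul_le_mul_of_nonneg_left hA (by positivity)
    nlinarith
  refine hc1 (mem_crossing_of_le hl hj ?_)
  have h1 := birkhoffSum_tower (F := F) (χ := χ) (W := V) hτ.pos j q
  have h2 := hcorr j
  have h3 := hcorr 0
  simp only [Function.iterate_zero, id] at h3
  have h4 := norm_add_le (birkhoffSum f (fun q => topLift τ m q.1) j q)
    (corrLift χ V (f^[j] q).1 - corrLift χ V q.1)
  have h5 := norm_sub_le (corrLift χ V (f^[j] q).1) (corrLift χ V q.1)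
  have h6 : ‖birkhoffSum f rest j q‖ ≤ G q := by
    refine (norm_sum_le _ _).trans ?_
    exact Finset.sum_le_sum_of_subset_of_nonneg (Finset.range_mono hj) fun _ _ _ => norm_nonneg _
  have h7 : birkhoffSum f (fun q => W q.1) j q =
      birkhoffSum f (fun q => V q.1) j q + birkhoffSum f rest j q := by
    simp only [birkhoffSum, hrest_def, Finset.sum_sub_distrib]
    abel
  rw [h7, h1] at hq
  have h8 := norm_add_le (birkhoffSum f (fun q => topLift τ m q.1) j q +
    (corrLift χ V (f^[j] q).1 - corrLift χ V q.1)) (birkhoffSum f rest j q)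
  nlinarith

end Truncation

/-! ### From tail bounds to moment bounds -/

section Moments

lemma lintegral_Ioc_rpow {b r : ℝ} (hb : 0 ≤ b) (hr : -1 < r) :
    ∫⁻ t in Set.Ioc 0 b, ENNReal.ofReal (t ^ r) = ENNReal.ofReal (b ^ (r + 1) / (r + 1)) := by
  have h1 := intervalIntegral.intervalIntegrable_rpow' (a := 0) (b := b) hr
  rw [intervalIntegrable_iff_integrableOn_Ioc_of_le hb] at h1
  rw [← ofReal_integral_eq_lintegral_ofReal h1
    ((ae_restrict_mem measurableSet_Ioc).mono fun t ht => Real.rpow_nonneg ht.1.le _),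
    ← intervalIntegral.integral_of_le hb, integral_rpow (Or.inl hr),
    Real.zero_rpow (by linarith), sub_zero]

lemma lintegral_Ioi_rpow {b r : ℝ} (hb : 0 < b) (hr : r < -1) :
    ∫⁻ t in Set.Ioi b, ENNReal.ofReal (t ^ r) = ENNReal.ofReal (b ^ (r + 1) / (-r - 1)) := by
  rw [← ofReal_integral_eq_lintegral_ofReal (integrableOn_Ioi_rpow_of_lt hr hb)
    ((ae_restrict_mem measurableSet_Ioi).mono fun t ht =>
      Real.rpow_nonneg (hb.trans ht).le _), integral_Ioi_rpow_of_lt hr hb]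
  congr 1
  rw [neg_div, ← div_neg]
  congr 1
  ring

variable {Ω α : Type*} [MeasurableSpace Ω] {P : Measure Ω} [IsProbabilityMeasure P]
  [MeasurableSpace α] {μ : Measure α} [IsProbabilityMeasure μ]

/-- Moments of `Z` from a bound of its tail by the tail of `Y` and a power tail. -/
lemma lintegral_rpow_le_of_power_tail {Z Y : Ω → ℝ} {N b q : ℝ} (hN : 0 ≤ N) (hb : 0 < b)
    (hq : 1 ≤ q) {M : ℕ} (hM : q ≤ M) (hZ : Measurable Z) (hY : Measurable Y)
    (hZ0 : ∀ ω, 0 ≤ Z ω) (hY0 : ∀ ω, 0 ≤ Y ω) (hZN : ∀ ω, Z ω ≤ N)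
    (htail : ∀ t, 0 < t → P.real {ω | t ≤ Z ω} ≤ P.real {ω | t < Y ω} + (b ^ 2 / t ^ 2) ^ M) :
    ∫⁻ ω, ENNReal.ofReal (Z ω ^ q) ∂P ≤
      ∫⁻ ω, ENNReal.ofReal (min (Y ω) N ^ q) ∂P + ENNReal.ofReal (2 * b ^ q) := by
  have hq0 : 0 < q := by linarith
  have hmin : ∀ ω, 0 ≤ min (Y ω) N := fun ω => le_min (hY0 ω) hN
  rw [lintegral_rpow_eq_lintegral_meas_lt_mul P (.of_forall hZ0) hZ.aemeasurable hq0,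
    lintegral_rpow_eq_lintegral_meas_lt_mul P (.of_forall hmin)
      (hY.min measurable_const).aemeasurable hq0]
  set h : ℝ → ℝ≥0∞ := fun t => ENNReal.ofReal (min 1 ((b ^ 2 / t ^ 2) ^ M)) with hh
  have h1 : ∀ t ∈ Set.Ioi (0 : ℝ), P {ω | t < Z ω} * ENNReal.ofReal (t ^ (q - 1)) ≤
      P {ω | t < min (Y ω) N} * ENNReal.ofReal (t ^ (q - 1)) +
        h t * ENNReal.ofReal (t ^ (q - 1)) := by
    intro t ht
    rw [← add_mul]
    refine mul_le_mul_left ?_ _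
    -- As `Z` never exceeds `N`, the tail of `Y` is needed only below `N`, where it coincides with
    -- that of `min Y N`.
    by_cases htN : t < N
    · have e : {ω | t < min (Y ω) N} = {ω | t < Y ω} := by
        ext ω; simp [htN]
      rw [e]
      rcases le_total 1 ((b ^ 2 / t ^ 2) ^ M) with h2 | h2
      · rw [hh]
        simp only [min_eq_left h2, ENNReal.ofReal_one]
        exact prob_le_one.trans le_add_self
      · simp only [hh, min_eq_right h2]
        have hsub : {ω | t < Z ω} ⊆ {ω | t ≤ Z ω} := fun ω (hω : t < Z ω) => hω.le
        have h3 : P.real {ω | t < Z ω} ≤ P.real {ω | t < Y ω} + (b ^ 2 / t ^ 2) ^ M :=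
          (measureReal_mono hsub (measure_ne_top _ _)).trans (htail t ht)
        rw [← ofReal_measureReal (μ := P) (s := {ω | t < Z ω}),
          ← ofReal_measureReal (μ := P) (s := {ω | t < Y ω}),
          ← ENNReal.ofReal_add measureReal_nonneg (by positivity)]
        exact ENNReal.ofReal_le_ofReal h3
    · have e : {ω | t < Z ω} = ∅ := by
        ext ω
        simp only [Set.mem_ofPred_eq, Set.mem_empty_iff_false, iff_false, not_lt]
        exact (hZN ω).trans (not_lt.1 htN)
      rw [e, measure_empty]
      exact zero_le
  have h2 : ∫⁻ t in Set.Ioi (0 : ℝ), h t * ENNReal.ofReal (t ^ (q - 1)) ≤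
      ENNReal.ofReal (b ^ q / q + b ^ q / (2 * M - q)) := by
    rw [← Set.Ioc_union_Ioi_eq_Ioi hb.le]
    refine (lintegral_union_le _ _ _).trans ?_
    have hMq : 0 < 2 * (M : ℝ) - q := by linarith
    rw [ENNReal.ofReal_add (by positivity) (by positivity)]
    refine add_le_add ?_ ?_
    · have e := lintegral_Ioc_rpow hb.le (r := q - 1) (by linarith)
      rw [sub_add_cancel] at e
      rw [← e]
      refine setLIntegral_mono' measurableSet_Ioc fun t _ => ?_
      refine mul_le_of_le_one_left zero_le ?_
      rw [← ENNReal.ofReal_one]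
      exact ENNReal.ofReal_le_ofReal (min_le_left _ _)
    · have e := lintegral_Ioi_rpow hb (r := q - 1 - 2 * M) (by linarith)
      have e2 : b ^ q / (2 * M - q) =
          b ^ (2 * (M : ℝ)) * (b ^ (q - 1 - 2 * M + 1) / (-(q - 1 - 2 * M) - 1)) := by
        rw [← mul_div_assoc, ← Real.rpow_add hb]
        congr 1
        · congr 1; ring
        · ring
      rw [e2, ENNReal.ofReal_mul (by positivity), ← e, ← lintegral_const_mul' _ _ ENNReal.ofReal_ne_top]
      refine setLIntegral_mono' measurableSet_Ioi fun t ht => ?_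
      have ht0 : 0 < t := hb.trans ht
      rw [hh, ← ENNReal.ofReal_mul (by positivity), ← ENNReal.ofReal_mul (by positivity)]
      refine ENNReal.ofReal_le_ofReal ?_
      refine (mul_le_mul_of_nonneg_right (min_le_right _ _) (by positivity)).trans_eq ?_
      rw [div_pow, ← pow_mul, ← pow_mul, ← Real.rpow_natCast b, ← Real.rpow_natCast t,
        Real.rpow_sub ht0 (q - 1)]
      push_cast
      ring
  refine (mul_le_mul_right ((setLIntegral_mono' measurableSet_Ioi h1).trans_eq
    (lintegral_add_right' _ ?_)) _).trans ?_
  · have hm : Measurable fun t : ℝ => min 1 ((b ^ 2 / t ^ 2) ^ M) :=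
      measurable_const.min ((measurable_const.div (measurable_id.pow_const 2)).pow_const M)
    have hm2 : Measurable fun t : ℝ => t ^ (q - 1) := measurable_id.pow_const _
    exact (hm.ennreal_ofReal.mul hm2.ennreal_ofReal).aemeasurable
  rw [mul_add]
  refine add_le_add_right ((mul_le_mul_right h2 _).trans ?_) _
  rw [← ENNReal.ofReal_mul hq0.le]
  refine ENNReal.ofReal_le_ofReal ?_
  -- Because `q ≤ M`, the contribution of `t > b` is no larger than that of `t ≤ b`, where the power
  -- tail was replaced by one.
  have hMq : q ≤ 2 * (M : ℝ) - q := by linarith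
  have h3 : b ^ q / (2 * M - q) ≤ b ^ q / q := by gcongr
  calc q * (b ^ q / q + b ^ q / (2 * M - q)) ≤ q * (b ^ q / q + b ^ q / q) := by gcongr
    _ = 2 * b ^ q := by field_simp; ring

/-- The kernel in the tail bounds for integrable inducing times. -/
noncomputable def tailKernel (c₁ c₂ t y : ℝ) : ℝ := if y ≤ t then c₁ * (y ^ 2 / t ^ 2) else c₂ * (y / t)

lemma tailKernel_nonneg {c₁ c₂ t y : ℝ} (h1 : 0 ≤ c₁) (h2 : 0 ≤ c₂) (ht : 0 ≤ t) (hy : 0 ≤ y) :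
    0 ≤ tailKernel c₁ c₂ t y := by
  unfold tailKernel
  split_ifs <;> positivity

lemma measurable_tailKernel (c₁ c₂ : ℝ) :
    Measurable fun z : ℝ × ℝ => tailKernel c₁ c₂ z.1 z.2 :=
  Measurable.ite (measurableSet_le measurable_snd measurable_fst)
    (((measurable_snd.pow_const 2).div (measurable_fst.pow_const 2)).const_mul _)
    ((measurable_snd.div measurable_fst).const_mul _)

/-- For `t ≥ y` the integrand is `c₁ * y² * t^(p - 3)`, integrable at infinity since `p < 2`; for `t
< y` it is `c₂ * y * t^(p - 2)`, integrable at zero since `p > 1`. Both parts scale like `y^p`. -/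
lemma lintegral_tailKernel_le {c₁ c₂ y p : ℝ} (h1 : 0 ≤ c₁) (h2 : 0 ≤ c₂) (hy : 0 < y)
    (hp1 : 1 < p) (hp2 : p < 2) :
    ∫⁻ t in Set.Ioi 0, ENNReal.ofReal (tailKernel c₁ c₂ t y * t ^ (p - 1)) ≤
      ENNReal.ofReal ((c₁ / (2 - p) + c₂ / (p - 1)) * y ^ p) := by
  have hp1' : 0 < p - 1 := by linarith
  have hp2' : 0 < 2 - p := by linarith
  have hsub : Set.Ioi (0 : ℝ) ⊆ Set.Ici y ∪ Set.Ioo 0 y := fun t ht => by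
    rcases le_or_gt y t with h | h
    · exact Or.inl h
    · exact Or.inr ⟨ht, h⟩
  refine (lintegral_mono_set hsub).trans ((lintegral_union_le _ _ _).trans ?_)
  rw [add_mul, ENNReal.ofReal_add (by positivity) (by positivity)]
  refine add_le_add ?_ ?_
  · have e := lintegral_Ioi_rpow hy (r := p - 3) (by linarith)
    have e2 : c₁ / (2 - p) * y ^ p = (c₁ * y ^ (2 : ℝ)) * (y ^ (p - 3 + 1) / (-(p - 3) - 1)) := by
      have : y ^ p = y ^ (2 : ℝ) * y ^ (p - 3 + 1) := by
        rw [← Real.rpow_add hy]; congr 1; ring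
      rw [this, show -(p - 3) - 1 = 2 - p by ring]
      ring
    rw [e2, ENNReal.ofReal_mul (by positivity), ← e,
      ← lintegral_const_mul' _ _ ENNReal.ofReal_ne_top, setLIntegral_congr Ioi_ae_eq_Ici.symm]
    refine setLIntegral_mono' measurableSet_Ioi fun t ht => ?_
    have ht0 : 0 < t := hy.trans ht
    rw [← ENNReal.ofReal_mul (by positivity)]
    refine ENNReal.ofReal_le_ofReal (le_of_eq ?_)
    rw [tailKernel, if_pos (le_of_lt ht), show p - 3 = p - 1 - (2 : ℕ) by norm_num; ring,
      Real.rpow_sub_natCast ht0.ne']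
    norm_num
    ring
  · have e := lintegral_Ioc_rpow hy.le (r := p - 2) (by linarith)
    have e2 : c₂ / (p - 1) * y ^ p = (c₂ * y) * (y ^ (p - 2 + 1) / (p - 2 + 1)) := by
      have : y ^ p = y * y ^ (p - 2 + 1) := by
        rw [← Real.rpow_one_add' hy.le (by linarith)]; congr 1; ring
      rw [this, show p - 2 + 1 = p - 1 by ring]
      ring
    rw [e2, ENNReal.ofReal_mul (by positivity), ← e,
      ← lintegral_const_mul' _ _ ENNReal.ofReal_ne_top]
    refine (setLIntegral_mono' measurableSet_Ioo fun t ht => ?_).trans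
      (lintegral_mono_set Set.Ioo_subset_Ioc_self)
    have ht0 : 0 < t := ht.1
    rw [← ENNReal.ofReal_mul (by positivity)]
    refine ENNReal.ofReal_le_ofReal (le_of_eq ?_)
    rw [tailKernel, if_neg (not_le.2 ht.2), show p - 2 = p - 1 - (1 : ℕ) by norm_num; ring,
      Real.rpow_sub_natCast ht0.ne']
    ring

/-- Layer cake and Tonelli: integrating over the level `t` before the space variable reduces the
moment to the scalar integral of the kernel. -/
lemma lintegral_rpow_le_of_tailKernel {Z : Ω → ℝ} {T : α → ℝ} {c₁ c₂ p : ℝ} (h1 : 0 ≤ c₁)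
    (h2 : 0 ≤ c₂) (hp1 : 1 < p) (hp2 : p < 2) (hZ : Measurable Z) (hT : Measurable T)
    (hZ0 : ∀ ω, 0 ≤ Z ω) (hT0 : ∀ x, 0 < T x)
    (htail : ∀ t, 0 < t → P {ω | t ≤ Z ω} ≤ ∫⁻ x, ENNReal.ofReal (tailKernel c₁ c₂ t (T x)) ∂μ) :
    ∫⁻ ω, ENNReal.ofReal (Z ω ^ p) ∂P ≤
      ENNReal.ofReal (p * (c₁ / (2 - p) + c₂ / (p - 1))) * ∫⁻ x, ENNReal.ofReal (T x ^ p) ∂μ := by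
  have hp0 : 0 < p := by linarith
  have hp1' : 0 < p - 1 := by linarith
  have hp2' : 0 < 2 - p := by linarith
  rw [lintegral_rpow_eq_lintegral_meas_le_mul P (.of_forall hZ0) hZ.aemeasurable hp0,
    ENNReal.ofReal_mul hp0.le, mul_assoc]
  refine mul_le_mul_right ?_ _
  rw [← lintegral_const_mul' _ _ ENNReal.ofReal_ne_top]
  have hm : Measurable fun z : ℝ × α =>
      ENNReal.ofReal (tailKernel c₁ c₂ z.1 (T z.2) * z.1 ^ (p - 1)) :=
    (((measurable_tailKernel c₁ c₂).comp (measurable_fst.prodMk (hT.comp measurable_snd))).mul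
      (measurable_fst.pow_const _)).ennreal_ofReal
  calc ∫⁻ t in Set.Ioi 0, P {ω | t ≤ Z ω} * ENNReal.ofReal (t ^ (p - 1))
      ≤ ∫⁻ t in Set.Ioi 0, ∫⁻ x, ENNReal.ofReal (tailKernel c₁ c₂ t (T x) * t ^ (p - 1)) ∂μ := by
        refine setLIntegral_mono' measurableSet_Ioi fun t ht => ?_
        refine (mul_le_mul_left (htail t ht) _).trans_eq ?_
        rw [← lintegral_mul_const' _ _ ENNReal.ofReal_ne_top]
        refine lintegral_congr fun x => ?_
        rw [ENNReal.ofReal_mul (tailKernel_nonneg h1 h2 (le_of_lt ht) (hT0 x).le)]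
    _ = ∫⁻ x, (∫⁻ t in Set.Ioi 0,
          ENNReal.ofReal (tailKernel c₁ c₂ t (T x) * t ^ (p - 1))) ∂μ :=
        lintegral_lintegral_swap hm.aemeasurable
    _ ≤ _ := lintegral_mono fun x => by
        refine (lintegral_tailKernel_le h1 h2 (hT0 x) hp1 hp2).trans_eq ?_
        rw [ENNReal.ofReal_mul (by positivity)]

lemma lintegral_tailKernel {T : α → ℝ} (hT : Measurable T) (hT0 : ∀ x, 0 ≤ T x)
    (hi : Integrable T μ) {c₁ c₂ t : ℝ} (h1 : 0 ≤ c₁) (h2 : 0 ≤ c₂) (ht : 0 < t) :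
    ∫⁻ x, ENNReal.ofReal (tailKernel c₁ c₂ t (T x)) ∂μ =
      ENNReal.ofReal (c₁ * (∫ x in {x | T x ≤ t}, T x ^ 2 ∂μ) / t ^ 2 +
        c₂ * (∫ x in {x | t < T x}, T x ∂μ) / t) := by
  have m1 : MeasurableSet {x | T x ≤ t} := measurableSet_le hT measurable_const
  have m2 : MeasurableSet {x | t < T x} := measurableSet_lt measurable_const hT
  have e : (fun x => tailKernel c₁ c₂ t (T x)) = fun x =>
      c₁ / t ^ 2 * {x | T x ≤ t}.indicator (fun x => T x ^ 2) x +
        c₂ / t * {x | t < T x}.indicator T x := by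
    ext x
    by_cases h : T x ≤ t
    · simp [tailKernel, h, Set.indicator, not_lt.2 h]; ring
    · simp [tailKernel, h, Set.indicator, not_le.1 h]; ring
  have i1 : Integrable ({x | T x ≤ t}.indicator fun x => T x ^ 2) μ := by
    refine Integrable.of_bound ((hT.pow_const 2).indicator m1).aestronglyMeasurable (t ^ 2)
      (.of_forall fun x => ?_)
    by_cases h : T x ≤ t
    · simp only [Set.indicator, Set.mem_ofPred_eq, h, if_true, Real.norm_eq_abs]
      rw [abs_of_nonneg (by positivity)]
      exact pow_le_pow_left₀ (hT0 x) h 2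
    · simp only [Set.indicator, Set.mem_ofPred_eq, h, if_false, norm_zero]
      positivity
  have i2 := hi.indicator m2
  have i3 : Integrable (fun x => tailKernel c₁ c₂ t (T x)) μ := by
    rw [e]
    exact (i1.const_mul _).add (i2.const_mul _)
  rw [← ofReal_integral_eq_lintegral_ofReal i3
    (.of_forall fun x => tailKernel_nonneg h1 h2 ht.le (hT0 x)), e,
    integral_add (i1.const_mul _) (i2.const_mul _), integral_const_mul, integral_const_mul,
    integral_indicator m1, integral_indicator m2]
  congr 1
  ring

lemma eLpNorm_le_of_lintegral_rpow_le {X : Ω → ℝ} {c q D : ℝ} (hX : ∀ ω, 0 ≤ X ω) (hc : 0 < c)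
    (hq : 0 < q) (h : ∫⁻ ω, ENNReal.ofReal ((X ω / c) ^ q) ∂P ≤ ENNReal.ofReal D) :
    eLpNorm X (ENNReal.ofReal q) P ≤ ENNReal.ofReal (c * D ^ (1 / q)) := by
  rcases le_or_gt D 0 with hD | hD
  · rw [ENNReal.ofReal_of_nonpos hD] at h
    have e := eLpNorm_eq_lintegral_rpow_enorm_toReal (μ := P) (f := fun ω => X ω / c)
      (p := ENNReal.ofReal q) (by simpa using hq) ENNReal.ofReal_ne_top
    have e1 : ∀ ω, ‖X ω / c‖ₑ ^ q = ENNReal.ofReal ((X ω / c) ^ q) := fun ω => by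
      have : 0 ≤ X ω / c := div_nonneg (hX ω) hc.le
      rw [Real.enorm_of_nonneg this, ENNReal.ofReal_rpow_of_nonneg this hq.le]
    simp only [ENNReal.toReal_ofReal hq.le, e1, nonpos_iff_eq_zero.1 h] at e
    rw [ENNReal.zero_rpow_of_pos (by positivity)] at e
    have e2 : X = c • fun ω => X ω / c := by
      ext ω
      simp only [Pi.smul_apply, smul_eq_mul]
      field_simp
    rw [e2, eLpNorm_const_smul, e, mul_zero]
    exact zero_le
  have e := eLpNorm_eq_lintegral_rpow_enorm_toReal (μ := P) (f := fun ω => X ω / c)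
    (p := ENNReal.ofReal q) (by simpa using hq) ENNReal.ofReal_ne_top
  have e1 : ∀ ω, ‖X ω / c‖ₑ ^ q = ENNReal.ofReal ((X ω / c) ^ q) := fun ω => by
    have : 0 ≤ X ω / c := div_nonneg (hX ω) hc.le
    rw [Real.enorm_of_nonneg this, ENNReal.ofReal_rpow_of_nonneg this hq.le]
  simp only [ENNReal.toReal_ofReal hq.le, e1] at e
  have e2 : X = c • fun ω => X ω / c := by
    ext ω
    simp only [Pi.smul_apply, smul_eq_mul]
    field_simp
  rw [e2, eLpNorm_const_smul, e, ENNReal.ofReal_mul hc.le, ← ENNReal.ofReal_rpow_of_pos hD,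
    Real.enorm_of_nonneg hc.le]
  gcongr

end Moments

/-! ### Elementary properties of maximal Birkhoff sums. -/

section MaxBirkhoff

variable {Λ E : Type*} [NormedAddCommGroup E] {f : Λ → Λ} {g : Λ → E} {n : ℕ} {x : Λ}

lemma le_maxBirkhoff_iff {t : ℝ} :
    t ≤ maxBirkhoff f g n x ↔ ∃ j ≤ n, t ≤ ‖birkhoffSum f g j x‖ := by
  simp [maxBirkhoff, Finset.le_sup'_iff]

lemma maxBirkhoff_le_iff {t : ℝ} :
    maxBirkhoff f g n x ≤ t ↔ ∀ j ≤ n, ‖birkhoffSum f g j x‖ ≤ t := by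
  simp [maxBirkhoff, Finset.sup'_le_iff]

lemma maxBirkhoff_nonneg : 0 ≤ maxBirkhoff f g n x :=
  le_maxBirkhoff_iff.2 ⟨0, Nat.zero_le _, norm_nonneg _⟩

lemma norm_birkhoffSum_le {B : ℝ} (hg : ∀ x, ‖g x‖ ≤ B) (j : ℕ) (x : Λ) :
    ‖birkhoffSum f g j x‖ ≤ j * B := by
  refine (norm_sum_le _ _).trans ((Finset.sum_le_sum fun i _ => hg _).trans_eq ?_)
  rw [Finset.sum_const, Finset.card_range, nsmul_eq_mul]

lemma maxBirkhoff_le {B : ℝ} (hB : 0 ≤ B) (hg : ∀ x, ‖g x‖ ≤ B) :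
    maxBirkhoff f g n x ≤ n * B := by
  refine maxBirkhoff_le_iff.2 fun j hj => (norm_birkhoffSum_le hg j x).trans ?_
  have : (j : ℝ) ≤ n := by exact_mod_cast hj
  gcongr

lemma measurable_maxBirkhoff [MeasurableSpace Λ] [MeasurableSpace E] [BorelSpace E]
    [SecondCountableTopology E] (hf : Measurable f) (hg : Measurable g) (n : ℕ) :
    Measurable (maxBirkhoff f g n) := by
  have : maxBirkhoff f g n = (Finset.range (n + 1)).sup' Finset.nonempty_range_add_one
      fun j x => ‖birkhoffSum f g j x‖ := by
    ext x
    rw [Finset.sup'_apply]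
    rfl
  rw [this]
  exact Finset.measurable_sup' _ fun j _ => (measurable_birkhoffSum hf hg j).norm

end MaxBirkhoff

/-! ### Moments of the column heights met along an orbit. -/

section TowerMoments

variable {α : Type*} [MeasurableSpace α] {μ : Measure α} [IsProbabilityMeasure μ] {F : α → α}
  {label : α → ℕ} {τ : α → ℕ}

/-- The maximal height of the columns visited up to time `n`. -/
noncomputable def maxHeight (f : Tower τ → Tower τ) (n : ℕ) (q : Tower τ) : ℝ :=
  (Finset.range (n + 1)).sup' Finset.nonempty_range_add_one fun j => (τ (f^[j] q).1.1 : ℝ)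

/-- The column changes only at visits to the base, so the maximum is dominated by the initial value,
which carries a weight `τ`, plus at most `n` base terms of weight one. The cut at `n` trades the
surplus power: both `τ` and `n` times `min τ n ^ (2 * (p - 1))` are at most `n ^ (p - 1) * τ ^ p`,
the latter because `p ≥ 2`. -/
lemma lintegral_min_maxHeight_le (hF : MeasurePreserving F μ μ) (hτ : IsInducingTime label τ)
    {p : ℝ} (hp : 2 ≤ p) (n : ℕ) :
    ∫⁻ q, ENNReal.ofReal (min (maxHeight (towerMap F τ hτ.pos) n q) n ^ (2 * (p - 1)))
        ∂towerMeasure τ μ ≤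
      ENNReal.ofReal (2 * (n : ℝ) ^ (p - 1)) * ∫⁻ x, ENNReal.ofReal ((τ x : ℝ) ^ p) ∂μ := by
  set f := towerMap F τ hτ.pos
  set P := towerMeasure τ μ
  have hf : MeasurePreserving f P P := measurePreserving_towerMap hF hτ.measurable hτ.pos
  have hZ : (∫⁻ a, (τ a : ℝ≥0∞) ∂μ)⁻¹ ≤ 1 :=
    ENNReal.inv_le_one.2 (one_le_lintegral_time hτ.pos)
  have hp1 : 0 ≤ p - 1 := by linarith
  have hp2 : 0 ≤ p - 2 := by linarith
  set g : α → ℝ≥0∞ := fun x => ENNReal.ofReal (min (τ x : ℝ) n ^ (2 * (p - 1))) with hg_def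
  have hg : Measurable g :=
    (((measurable_from_top (f := fun k : ℕ => (k : ℝ))).comp hτ.measurable).min
      measurable_const |>.pow_const _).ennreal_ofReal
  have h1 : ∀ q, ENNReal.ofReal (min (maxHeight f n q) n ^ (2 * (p - 1))) ≤
      g q.1.1 + ∑ i ∈ Finset.range n,
        (if (f^[i + 1] q).1.2 = 0 then g (f^[i + 1] q).1.1 else 0) := by
    intro q
    obtain ⟨j, hj, he⟩ := Finset.exists_mem_eq_sup' (s := Finset.range (n + 1))
      Finset.nonempty_range_add_one fun j => (τ (f^[j] q).1.1 : ℝ)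
    rw [maxHeight, he]
    refine (apply_iterate_towerMap_le hτ.pos g j q).trans ?_
    have hjn : j ≤ n := Nat.lt_succ_iff.1 (Finset.mem_range.1 hj)
    exact add_le_add_right (Finset.sum_le_sum_of_subset (Finset.range_mono hjn)) _
  set g0 : α × ℕ → ℝ≥0∞ := fun p => if p.2 = 0 then g p.1 else 0 with hg0_def
  have hg0 : Measurable g0 :=
    Measurable.ite (measurable_snd (measurableSet_singleton 0)) (hg.comp measurable_fst)
      measurable_const
  have hg0' : Measurable fun q : Tower τ => g0 q.1 := hg0.comp measurable_subtype_coe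
  have h2 : ∀ i, ∫⁻ q, g0 (f^[i + 1] q).1 ∂P ≤ ∫⁻ x, g x ∂μ := fun i => by
    rw [(hf.iterate (i + 1)).lintegral_comp hg0', lintegral_tower hτ.measurable hg0]
    refine mul_le_of_le_one_of_le hZ (lintegral_mono fun x => ?_)
    rw [Finset.sum_eq_single_of_mem 0 (Finset.mem_range.2 (hτ.pos x))]
    · simp [hg0_def]
    · intro l _ hl
      simp [hg0_def, hl]
  have h3 : ∫⁻ q : Tower τ, g q.1.1 ∂P ≤ ∫⁻ x, τ x * g x ∂μ := by
    rw [lintegral_tower_base hτ.measurable hg]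
    exact mul_le_of_le_one_left zero_le hZ
  have hn0 : (0 : ℝ) ≤ n := Nat.cast_nonneg n
  have hsq : ∀ y : ℝ, 1 ≤ y → min y n ^ (2 * (p - 1)) = min y n ^ (p - 1) * min y n ^ (p - 1) :=
    fun y hy => by
      rw [two_mul, Real.rpow_add_of_nonneg (le_min (by linarith) hn0) hp1 hp1]
  have h4 : ∀ x, τ x * g x ≤ ENNReal.ofReal ((n : ℝ) ^ (p - 1)) * ENNReal.ofReal ((τ x : ℝ) ^ p) :=
    fun x => by
      have hy := hτ.one_le x
      have h0 : 0 ≤ min (τ x : ℝ) n := le_min (by linarith) hn0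
      rw [← ENNReal.ofReal_natCast, hg_def, ← ENNReal.ofReal_mul (by linarith),
        ← ENNReal.ofReal_mul (by positivity)]
      refine ENNReal.ofReal_le_ofReal ?_
      rw [hsq _ hy]
      have e : (τ x : ℝ) ^ p = τ x * (τ x : ℝ) ^ (p - 1) := by
        rw [← Real.rpow_one_add' (by linarith) (by linarith)]
        congr 1
        ring
      rw [e]
      calc (τ x : ℝ) * (min (τ x : ℝ) n ^ (p - 1) * min (τ x : ℝ) n ^ (p - 1)) ≤
          (τ x : ℝ) * ((τ x : ℝ) ^ (p - 1) * (n : ℝ) ^ (p - 1)) := by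
            gcongr
            · exact min_le_left _ _
            · exact min_le_right _ _
        _ = _ := by ring
  have h5 : ∀ x, n * g x ≤ ENNReal.ofReal ((n : ℝ) ^ (p - 1)) * ENNReal.ofReal ((τ x : ℝ) ^ p) :=
    fun x => by
      have hy := hτ.one_le x
      have h0 : 0 ≤ min (τ x : ℝ) n := le_min (by linarith) hn0
      rw [← ENNReal.ofReal_natCast, hg_def, ← ENNReal.ofReal_mul (by linarith),
        ← ENNReal.ofReal_mul (by positivity)]
      refine ENNReal.ofReal_le_ofReal ?_
      have e1 : min (τ x : ℝ) n ^ (2 * (p - 1)) = min (τ x : ℝ) n ^ p * min (τ x : ℝ) n ^ (p - 2) := by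
        rw [← Real.rpow_add_of_nonneg h0 (by linarith) hp2]
        congr 1
        ring
      have e2 : (n : ℝ) ^ (p - 1) = n * (n : ℝ) ^ (p - 2) := by
        rw [← Real.rpow_one_add' hn0 (by linarith)]
        congr 1
        ring
      rw [e1, e2]
      calc (n : ℝ) * (min (τ x : ℝ) n ^ p * min (τ x : ℝ) n ^ (p - 2)) ≤
          n * ((τ x : ℝ) ^ p * (n : ℝ) ^ (p - 2)) := by
            gcongr
            · exact min_le_left _ _
            · exact min_le_right _ _
        _ = _ := by ring
  calc ∫⁻ q, ENNReal.ofReal (min (maxHeight f n q) n ^ (2 * (p - 1))) ∂P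
      ≤ ∫⁻ q, (g q.1.1 + ∑ i ∈ Finset.range n, g0 (f^[i + 1] q).1) ∂P := lintegral_mono h1
    _ = ∫⁻ q : Tower τ, g q.1.1 ∂P + ∑ i ∈ Finset.range n, ∫⁻ q, g0 (f^[i + 1] q).1 ∂P := by
        have hm : Measurable fun q : Tower τ => g q.1.1 :=
          hg.comp (measurable_fst.comp measurable_subtype_coe)
        have hm' : ∀ i ∈ Finset.range n, Measurable fun q => g0 (f^[i + 1] q).1 := fun i _ =>
          hg0'.comp (hf.iterate (i + 1)).measurable
        rw [lintegral_add_left hm, lintegral_finsetSum _ hm']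
    _ ≤ ∫⁻ x, τ x * g x ∂μ + ∑ i ∈ Finset.range n, ∫⁻ x, g x ∂μ :=
        add_le_add h3 (Finset.sum_le_sum fun i _ => h2 i)
    _ = ∫⁻ x, τ x * g x ∂μ + ∫⁻ x, n * g x ∂μ := by
        rw [Finset.sum_const, Finset.card_range, nsmul_eq_mul,
          lintegral_const_mul' _ _ (ENNReal.natCast_ne_top n)]
    _ ≤ ENNReal.ofReal ((n : ℝ) ^ (p - 1)) * ∫⁻ x, ENNReal.ofReal ((τ x : ℝ) ^ p) ∂μ +
        ENNReal.ofReal ((n : ℝ) ^ (p - 1)) * ∫⁻ x, ENNReal.ofReal ((τ x : ℝ) ^ p) ∂μ := by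
        rw [← lintegral_const_mul' _ _ ENNReal.ofReal_ne_top]
        exact add_le_add (lintegral_mono h4) (lintegral_mono h5)
    _ = _ := by
        rw [← two_mul, ENNReal.ofReal_mul zero_le_two, ENNReal.ofReal_ofNat]
        ring

lemma IsInducingTime.integrable_rpow (hτ : IsInducingTime label τ) {p r : ℝ} (hr : r ≤ p)
    (hi : Integrable (fun x => (τ x : ℝ) ^ p) μ) : Integrable (fun x => (τ x : ℝ) ^ r) μ := by
  refine hi.mono' ((measurable_from_top (f := fun k : ℕ => (k : ℝ) ^ r)).comp
    hτ.measurable).aestronglyMeasurable (.of_forall fun x => ?_)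
  rw [Real.norm_eq_abs, abs_of_nonneg (by positivity)]
  exact Real.rpow_le_rpow_of_exponent_le (hτ.one_le x) hr

lemma IsInducingTime.integral_rpow_le (hτ : IsInducingTime label τ) {p r : ℝ} (hr : r ≤ p)
    (hi : Integrable (fun x => (τ x : ℝ) ^ p) μ) :
    ∫ x, (τ x : ℝ) ^ r ∂μ ≤ ∫ x, (τ x : ℝ) ^ p ∂μ :=
  integral_mono (hτ.integrable_rpow hr hi) hi fun x =>
    Real.rpow_le_rpow_of_exponent_le (hτ.one_le x) hr

end TowerMoments

/-- Moment bound for the maximal Birkhoff sums, for `1 < p < 2`. -/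
theorem exists_maxBirkhoff_const_of_lt_two {p : ℝ} (hp1 : 1 < p) (hp2 : p < 2) (L γ θ H : ℝ) :
    ∃ C : ℝ, ∀ {α E : Type*} [MeasurableSpace α] {μ : Measure α} [IsProbabilityMeasure μ]
      {F : α → α} {label τ : α → ℕ} [NormedAddCommGroup E] [InnerProductSpace ℝ E]
      [CompleteSpace E] [MeasurableSpace E] [BorelSpace E] [SecondCountableTopology E]
      {W : α × ℕ → E}, GibbsMarkov F label μ L γ → ∀ hτ : IsInducingTime label τ,
      Integrable (fun x => (τ x : ℝ) ^ p) μ → ∫ x, (τ x : ℝ) ^ p ∂μ ≤ H → 0 < θ → θ < 1 →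
      IsTowerObservable F label τ (fun _ => 1) 1 θ W →
      ∫ q : Tower τ, W q.1 ∂towerMeasure τ μ = 0 → ∀ n : ℕ, 1 ≤ n →
      eLpNorm (maxBirkhoff (towerMap F τ hτ.pos) (fun q => W q.1) n) (ENNReal.ofReal p)
        (towerMeasure τ μ) ≤ ENNReal.ofReal (C * (n : ℝ) ^ (1 / p)) := by
  set R := correctorConst L γ θ
  set D := p * ((4 + 8 * R * H) / (2 - p) + 2 / (p - 1)) * H with hD
  refine ⟨(7 + 4 * R * H) * D ^ (1 / p), ?_⟩
  intro α E _ μ _ F label τ _ _ _ _ _ _ W hG hτ hi hH hθ hθ1 hW h0 n hn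
  have hR0 : 0 ≤ R := hG.correctorConst_nonneg hθ1
  have hH0 : 0 ≤ H := (integral_nonneg fun x => by positivity).trans hH
  have hp1' : 0 < p - 1 := by linarith
  have hp2' : 0 < 2 - p := by linarith
  have hD0 : 0 ≤ D := by positivity
  have hn0 : (0 : ℝ) ≤ n := Nat.cast_nonneg n
  have hi1 : Integrable (fun x => (τ x : ℝ)) μ := by
    simpa using hτ.integrable_rpow hp1.le hi
  have hH1 : ∫ x, (τ x : ℝ) ∂μ ≤ H := by
    simpa using (hτ.integral_rpow_le hp1.le hi).trans hH
  have hprob := isProbabilityMeasure_tower (μ := μ) hτ.measurable hτ.pos (hτ.lintegral_ne_top hi1)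
  have hc : 0 < 7 + 4 * R * H := by positivity
  have hTm : Measurable fun x => (τ x : ℝ) := measurable_from_top.comp hτ.measurable
  -- Divided by `7 + 4 * R * H`, the maximum has the tail of `tail_of_integrable`, which is the
  -- integrated kernel with both constants proportional to `n`. The moment of order `p` is then
  -- linear in `n`.
  have key := lintegral_rpow_le_of_tailKernel (P := towerMeasure τ μ) (μ := μ)
    (Z := fun q => maxBirkhoff (towerMap F τ hτ.pos) (fun q => W q.1) n q / (7 + 4 * R * H))
    (T := fun x => (τ x : ℝ)) (c₁ := n * (4 + 8 * R * H)) (c₂ := n * 2) (by positivity)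
    (by positivity) hp1 hp2
    ((measurable_maxBirkhoff (measurable_towerMap hG.preserves.measurable hτ.measurable hτ.pos)
      (hW.measurable.comp measurable_subtype_coe) n).div_const _) hTm
    (fun q => div_nonneg maxBirkhoff_nonneg hc.le) (fun x => by linarith [hτ.one_le x]) ?_
  · have h1 := eLpNorm_le_of_lintegral_rpow_le (P := towerMeasure τ μ) (D := n * D) (c := 7 + 4 * R * H)
      (q := p) (fun q => maxBirkhoff_nonneg) hc (by linarith) (key.trans ?_)
    · refine h1.trans (ENNReal.ofReal_le_ofReal (le_of_eq ?_))
      rw [Real.mul_rpow hn0 hD0]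
      ring
    · rw [← ofReal_integral_eq_lintegral_ofReal hi (.of_forall fun x => by positivity),
        ← ENNReal.ofReal_mul (by positivity)]
      refine ENNReal.ofReal_le_ofReal ?_
      calc _ ≤ p * (n * (4 + 8 * R * H) / (2 - p) + n * 2 / (p - 1)) * H := by gcongr
        _ = _ := by rw [hD]; ring
  · intro t ht
    rw [lintegral_tailKernel hTm (fun x => by positivity) hi1 (by positivity) (by positivity) ht]
    have e : {q : Tower τ | t ≤ maxBirkhoff (towerMap F τ hτ.pos) (fun q => W q.1) n q /
        (7 + 4 * R * H)} = {q | ∃ j ≤ n, (7 + 4 * R * H) * t ≤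
        ‖birkhoffSum (towerMap F τ hτ.pos) (fun q => W q.1) j q‖} := by
      ext q
      rw [Set.mem_ofPred_eq, Set.mem_ofPred_eq, le_div_iff₀ hc, mul_comm t, le_maxBirkhoff_iff]
    rw [e, ← ofReal_measureReal]
    refine ENNReal.ofReal_le_ofReal ?_
    refine (hG.tail_of_integrable hτ hi1 hθ hθ1 hW h0 (R := R) le_rfl hH1 hn ht fun _ => ?_).trans_eq
      (by ring)
    have m1 : MeasurableSet {x | (τ x : ℝ) ≤ t} := measurableSet_lowColumn hτ.measurable t
    calc ∫ x in {x | (τ x : ℝ) ≤ t}, (τ x : ℝ) ^ 2 ∂μ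
        ≤ ∫ x in {x | (τ x : ℝ) ≤ t}, t * (τ x : ℝ) ∂μ := by
          refine integral_mono_of_nonneg (.of_forall fun x => by positivity)
            (hi1.const_mul t).integrableOn ?_
          filter_upwards [ae_restrict_mem m1] with x hx
          rw [sq]
          exact mul_le_mul_of_nonneg_right hx (by positivity)
      _ ≤ ∫ x, t * (τ x : ℝ) ∂μ :=
          setIntegral_le_integral (hi1.const_mul t) (.of_forall fun x => by positivity)
      _ ≤ H * t := by
          rw [integral_const_mul, mul_comm]
          gcongr

/-- Moment bound for the maximal Birkhoff sums, for `p ≥ 2`. -/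
theorem exists_maxBirkhoff_const_of_two_le {p : ℝ} (hp : 2 ≤ p) (L γ θ H : ℝ) :
    ∃ C : ℝ, ∀ {α E : Type*} [MeasurableSpace α] {μ : Measure α} [IsProbabilityMeasure μ]
      {F : α → α} {label τ : α → ℕ} [NormedAddCommGroup E] [InnerProductSpace ℝ E]
      [CompleteSpace E] [MeasurableSpace E] [BorelSpace E] [SecondCountableTopology E]
      {W : α × ℕ → E}, GibbsMarkov F label μ L γ → ∀ hτ : IsInducingTime label τ,
      Integrable (fun x => (τ x : ℝ) ^ p) μ → ∫ x, (τ x : ℝ) ^ p ∂μ ≤ H → 0 < θ → θ < 1 →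
      IsTowerObservable F label τ (fun _ => 1) 1 θ W →
      ∫ q : Tower τ, W q.1 ∂towerMeasure τ μ = 0 → ∀ n : ℕ, 1 ≤ n →
      eLpNorm (maxBirkhoff (towerMap F τ hτ.pos) (fun q => W q.1) n)
        (ENNReal.ofReal (2 * (p - 1))) (towerMeasure τ μ) ≤
        ENNReal.ofReal (C * (n : ℝ) ^ (1 / 2 : ℝ)) := by
  set R := correctorConst L γ θ * H
  -- The added 1 keeps `s` positive, and with it the scale `√(n * s)` of the power tail.
  set s := 2 * (Real.exp (couplingConst L γ) * H) + 8 * R ^ 2 + 1 with hs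
  -- With this many iterations the power tail of exponent `2 * M` controls moments of order `2 * (p
  -- - 1)`.
  set M := ⌈2 * (p - 1)⌉₊ with hM
  set c := (4 * M + 2) * (1 + R) with hc_def
  set D := 2 * H + 2 * s ^ (p - 1) with hD
  refine ⟨c * D ^ (1 / (2 * (p - 1))), ?_⟩
  intro α E _ μ _ F label τ _ _ _ _ _ _ W hG hτ hi hH hθ hθ1 hW h0 n hn
  have hH0 : 0 ≤ H := (integral_nonneg fun x => by positivity).trans hH
  have hR0 : 0 ≤ R := mul_nonneg (hG.correctorConst_nonneg hθ1) hH0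
  have hs0 : 0 < s := by positivity
  have hn1 : (1 : ℝ) ≤ n := by exact_mod_cast hn
  have hn0 : (0 : ℝ) < n := by linarith
  have hD0 : 0 ≤ D := by positivity
  have hq0 : 0 < 2 * (p - 1) := by linarith
  have hMq : 2 * (p - 1) ≤ M := Nat.le_ceil _
  have hM1 : 1 ≤ M := by
    have : (0 : ℝ) < M := by linarith
    exact_mod_cast this
  have hc1 : 1 ≤ c := by
    have : (0 : ℝ) ≤ M := Nat.cast_nonneg M
    rw [hc_def]
    nlinarith
  have hc : 0 < c := by linarith
  have hi2 : Integrable (fun x => (τ x : ℝ) ^ 2) μ := by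
    simpa using hτ.integrable_rpow (r := 2) hp hi
  have hi1 : Integrable (fun x => (τ x : ℝ)) μ := by
    simpa using hτ.integrable_rpow (r := 1) (by linarith) hi
  have hH2 : ∫ x, (τ x : ℝ) ^ 2 ∂μ ≤ H := by
    simpa using (hτ.integral_rpow_le (r := 2) hp hi).trans hH
  have hprob := isProbabilityMeasure_tower (μ := μ) hτ.measurable hτ.pos (hτ.lintegral_ne_top hi1)
  have hf := measurable_towerMap hG.preserves.measurable hτ.measurable hτ.pos
  have hY : Measurable (maxHeight (towerMap F τ hτ.pos) n) := by
    have : maxHeight (towerMap F τ hτ.pos) n = (Finset.range (n + 1)).sup'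
        Finset.nonempty_range_add_one
        fun j q => (τ ((towerMap F τ hτ.pos)^[j] q).1.1 : ℝ) := by
      ext x
      rw [Finset.sup'_apply]
      rfl
    rw [this]
    exact Finset.measurable_sup' _ fun j _ => measurable_from_top.comp
      (hτ.measurable.comp (measurable_fst.comp (measurable_subtype_coe.comp (hf.iterate j))))
  have hb : 0 < Real.sqrt (n * s) := Real.sqrt_pos.2 (by positivity)
  have key := lintegral_rpow_le_of_power_tail (P := towerMeasure τ μ)
    (Z := fun q => maxBirkhoff (towerMap F τ hτ.pos) (fun q => W q.1) n q / c)
    (Y := maxHeight (towerMap F τ hτ.pos) n) (N := n) (q := 2 * (p - 1)) hn0.le hb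
    (by linarith) hMq
    ((measurable_maxBirkhoff hf (hW.measurable.comp measurable_subtype_coe) n).div_const _) hY
    (fun q => div_nonneg maxBirkhoff_nonneg hc.le)
    (fun q => (Finset.le_sup'_iff _).2 ⟨0, by simp, Nat.cast_nonneg _⟩) (fun q => ?_) ?_
  · have h1 := eLpNorm_le_of_lintegral_rpow_le (P := towerMeasure τ μ) (D := (n : ℝ) ^ (p - 1) * D)
      (c := c) (fun q => maxBirkhoff_nonneg) hc hq0 (key.trans ?_)
    · refine h1.trans (ENNReal.ofReal_le_ofReal (le_of_eq ?_))
      rw [Real.mul_rpow (by positivity) hD0, ← Real.rpow_mul hn0.le,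
        show (p - 1) * (1 / (2 * (p - 1))) = 1 / 2 by
          have : p - 1 ≠ 0 := by linarith
          field_simp]
      ring
    · refine (add_le_add_left (lintegral_min_maxHeight_le hG.preserves hτ hp n) _).trans ?_
      rw [← ofReal_integral_eq_lintegral_ofReal hi (.of_forall fun x => by positivity),
        ← ENNReal.ofReal_mul (by positivity), ← ENNReal.ofReal_add
          (mul_nonneg (by positivity) (integral_nonneg fun x => by positivity)) (by positivity)]
      refine ENNReal.ofReal_le_ofReal ?_
      rw [Real.sqrt_eq_rpow, ← Real.rpow_mul (by positivity),
        show 1 / 2 * (2 * (p - 1)) = p - 1 by ring, Real.mul_rpow hn0.le hs0.le, hD]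
      calc _ ≤ 2 * (n : ℝ) ^ (p - 1) * H + 2 * ((n : ℝ) ^ (p - 1) * s ^ (p - 1)) := by gcongr
        _ = _ := by ring
  · refine (div_le_self maxBirkhoff_nonneg hc1).trans ?_
    refine (maxBirkhoff_le zero_le_one fun q => ?_).trans_eq (mul_one _)
    simpa using hW.bound q.1.1 q.1.2 q.2
  · intro t ht
    have e : {q : Tower τ | t ≤ maxBirkhoff (towerMap F τ hτ.pos) (fun q => W q.1) n q / c} =
        {q | ∃ j ≤ n, c * t ≤ ‖birkhoffSum (towerMap F τ hτ.pos) (fun q => W q.1) j q‖} := by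
      ext q
      rw [Set.mem_ofPred_eq, Set.mem_ofPred_eq, le_div_iff₀ hc, mul_comm t, le_maxBirkhoff_iff]
    have e2 : {q : Tower τ | t < maxHeight (towerMap F τ hτ.pos) n q} =
        {q | ∃ j ≤ n, t < τ ((towerMap F τ hτ.pos)^[j] q).1.1} := by
      ext q
      simp [maxHeight, Finset.lt_sup'_iff]
    rw [e, e2, Real.sq_sqrt (by positivity)]
    refine hG.tail_of_sq_integrable hτ hi2 hθ hθ1 hW h0 (R := R) ?_ ?_ hM1 n ht
    · exact mul_le_mul_of_nonneg_left hH2 (hG.correctorConst_nonneg hθ1)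
    · rw [hs]
      have := mul_le_mul_of_nonneg_left hH2 (Real.exp_nonneg (couplingConst L γ))
      linarith

/-! ### Asymptotic covariance -/

section Covariance

variable {X E : Type*} [MeasurableSpace X] {P : Measure X} [IsProbabilityMeasure P]
  [NormedAddCommGroup E] [InnerProductSpace ℝ E] [CompleteSpace E] [MeasurableSpace E]
  [BorelSpace E] [SecondCountableTopology E] {f : X → X} {m : X → E}

lemma memLp_inner_const {A : X → E} (hA : MemLp A 2 P) (u : E) :
    MemLp (fun x => inner ℝ (A x) u) 2 P := by
  refine MemLp.of_le_mul (c := ‖u‖) hA ?_ (.of_forall fun x => ?_)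
  · exact (continuous_id.inner continuous_const).comp_aestronglyMeasurable hA.aestronglyMeasurable
  · rw [mul_comm]
    exact norm_inner_le_norm _ _

lemma IsReverseDiff.integral_inner_mul (hm : IsReverseDiff f P m) {g : X → ℝ} (hg : MemLp g 2 P)
    (u : E) : ∫ x, inner ℝ (m x) u * g (f x) ∂P = 0 := by
  have hG : MemLp (fun x => g x • u) 2 P := by
    refine MemLp.of_le_mul (c := ‖u‖) hg ?_ (.of_forall fun x => ?_)
    · exact (continuous_id.smul continuous_const).comp_aestronglyMeasurable hg.aestronglyMeasurable
    · rw [norm_smul, mul_comm]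
  rw [← hm.orthogonal _ hG]
  refine integral_congr_ae (.of_forall fun x => ?_)
  simp only [real_inner_smul_right]
  ring

lemma integrable_mul_of_memLp {a b : X → ℝ} (ha : MemLp a 2 P) (hb : MemLp b 2 P) :
    Integrable (fun x => a x * b x) P := ha.integrable_mul hb

lemma integral_add_four {a b c d : X → ℝ} (ha : Integrable a P) (hb : Integrable b P)
    (hc : Integrable c P) (hd : Integrable d P) :
    ∫ x, (a x + b x + (c x + d x)) ∂P =
      ∫ x, a x ∂P + ∫ x, b x ∂P + (∫ x, c x ∂P + ∫ x, d x ∂P) := by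
  rw [← integral_add ha hb, ← integral_add hc hd]
  exact integral_add (ha.add hb) (hc.add hd)

/-- Each new term is orthogonal to everything that comes later on the orbit, so both mixed terms
vanish and the covariance is exactly additive. -/
lemma IsReverseDiff.integral_birkhoffSum_mul (hf : MeasurePreserving f P P)
    (hm : IsReverseDiff f P m) (u w : E) (n : ℕ) :
    ∫ x, inner ℝ (birkhoffSum f m n x) u * inner ℝ (birkhoffSum f m n x) w ∂P =
      n * ∫ x, inner ℝ (m x) u * inner ℝ (m x) w ∂P := by
  induction n with
  | zero => simp
  | succ n ih =>
    have hS := memLp_birkhoffSum hf hm.memLp n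
    have hSf := hS.comp_measurePreserving hf
    have mu := memLp_inner_const hm.memLp u
    have mw := memLp_inner_const hm.memLp w
    have su := memLp_inner_const hSf u
    have sw := memLp_inner_const hSf w
    have i1 := integrable_mul_of_memLp mu mw
    have i2 := integrable_mul_of_memLp mu sw
    have i3 := integrable_mul_of_memLp mw su
    have i4 := integrable_mul_of_memLp su sw
    have z2 := hm.integral_inner_mul (memLp_inner_const hS w) u
    have z3 := hm.integral_inner_mul (memLp_inner_const hS u) w
    have e : ∀ x, inner ℝ (birkhoffSum f m (n + 1) x) u * inner ℝ (birkhoffSum f m (n + 1) x) w =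
        (inner ℝ (m x) u * inner ℝ (m x) w +
          inner ℝ (m x) u * inner ℝ ((birkhoffSum f m n ∘ f) x) w) +
        (inner ℝ (m x) w * inner ℝ ((birkhoffSum f m n ∘ f) x) u +
          inner ℝ ((birkhoffSum f m n ∘ f) x) u * inner ℝ ((birkhoffSum f m n ∘ f) x) w) := by
      intro x
      rw [birkhoffSum_succ', inner_add_left, inner_add_left, Function.comp_apply]
      ring
    simp_rw [e]
    have z4 : ∫ x, inner ℝ ((birkhoffSum f m n ∘ f) x) u * inner ℝ ((birkhoffSum f m n ∘ f) x) w ∂P =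
        ∫ x, inner ℝ (birkhoffSum f m n x) u * inner ℝ (birkhoffSum f m n x) w ∂P := by
      have hi := integrable_mul_of_memLp (memLp_inner_const hS u) (memLp_inner_const hS w)
      have h := integral_map (μ := P)
        (f := fun x => inner ℝ (birkhoffSum f m n x) u * inner ℝ (birkhoffSum f m n x) w)
        hf.aemeasurable (by rw [hf.map_eq]; exact hi.aestronglyMeasurable)
      rw [hf.map_eq] at h
      exact h.symm
    rw [integral_add_four i1 i2 i3 i4, z4, ih]
    simp only [Function.comp_apply]
    rw [z2, z3]
    push_cast
    ring

lemma abs_integral_mul_le {a b : X → ℝ} (ha : MemLp a 2 P) (hb : MemLp b 2 P) :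
    |∫ x, a x * b x ∂P| ≤ √(∫ x, a x ^ 2 ∂P) * √(∫ x, b x ^ 2 ∂P) := by
  have h := integral_mul_norm_le_Lp_mul_Lq (μ := P) (f := a) (g := b) (p := 2) (q := 2)
    Real.HolderConjugate.two_two (by simpa using ha) (by simpa using hb)
  simp only [Real.norm_eq_abs, Real.rpow_two, sq_abs, ← Real.sqrt_eq_rpow] at h
  refine (abs_integral_le_integral_abs).trans (le_trans (le_of_eq ?_) h)
  simp_rw [abs_mul]

/-- Cauchy-Schwarz, with the factor `1 / n` shared equally between the two norms. -/
lemma tendsto_average_mul_of_tendsto_zero {a d : ℕ → X → ℝ} (ha : ∀ n, MemLp (a n) 2 P)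
    (hd : ∀ n, MemLp (d n) 2 P) {s : ℝ}
    (h1 : Tendsto (fun n : ℕ => (n : ℝ)⁻¹ * ∫ x, a n x ^ 2 ∂P) atTop (𝓝 s))
    (h2 : Tendsto (fun n : ℕ => (n : ℝ)⁻¹ * ∫ x, d n x ^ 2 ∂P) atTop (𝓝 0)) :
    Tendsto (fun n : ℕ => (n : ℝ)⁻¹ * ∫ x, a n x * d n x ∂P) atTop (𝓝 0) := by
  have h3 := (h1.sqrt).mul (h2.sqrt)
  rw [Real.sqrt_zero, mul_zero] at h3
  refine squeeze_zero_norm (fun n => ?_) h3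
  have hn : (0 : ℝ) ≤ (n : ℝ)⁻¹ := by positivity
  rw [Real.norm_eq_abs, abs_mul, abs_of_nonneg hn, Real.sqrt_mul hn, Real.sqrt_mul hn]
  calc (n : ℝ)⁻¹ * |∫ x, a n x * d n x ∂P|
      ≤ (n : ℝ)⁻¹ * (√(∫ x, a n x ^ 2 ∂P) * √(∫ x, d n x ^ 2 ∂P)) :=
        mul_le_mul_of_nonneg_left (abs_integral_mul_le (ha n) (hd n)) hn
    _ = (√((n : ℝ)⁻¹) * √((n : ℝ)⁻¹)) * (√(∫ x, a n x ^ 2 ∂P) * √(∫ x, d n x ^ 2 ∂P)) := by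
        rw [Real.mul_self_sqrt hn]
    _ = _ := by ring

/-- Asymptotic covariances do not change under perturbations of size `o(√n)` in `L²`. -/
lemma tendsto_covariance_of_sub {A B : ℕ → X → E} (hA : ∀ n, MemLp (A n) 2 P)
    (hB : ∀ n, MemLp (B n) 2 P) {σ : E → E → ℝ}
    (h : ∀ u w, Tendsto (fun n : ℕ => (n : ℝ)⁻¹ * ∫ x, inner ℝ (A n x) u * inner ℝ (A n x) w ∂P)
      atTop (𝓝 (σ u w)))
    (h0 : Tendsto (fun n : ℕ => (n : ℝ)⁻¹ * ∫ x, ‖B n x - A n x‖ ^ 2 ∂P) atTop (𝓝 0)) (u w : E) :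
    Tendsto (fun n : ℕ => (n : ℝ)⁻¹ * ∫ x, inner ℝ (B n x) u * inner ℝ (B n x) w ∂P)
      atTop (𝓝 (σ u w)) := by
  have hD : ∀ n, MemLp (fun x => B n x - A n x) 2 P := fun n => (hB n).sub (hA n)
  have hd : ∀ u : E, Tendsto (fun n : ℕ => (n : ℝ)⁻¹ * ∫ x, inner ℝ (B n x - A n x) u ^ 2 ∂P)
      atTop (𝓝 0) := fun u => by
    have h1 := h0.mul_const (‖u‖ ^ 2)
    rw [zero_mul] at h1
    refine squeeze_zero (fun n => mul_nonneg (by positivity)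
      (integral_nonneg fun x => sq_nonneg _)) (fun n => ?_) h1
    rw [mul_assoc, ← integral_mul_const]
    refine mul_le_mul_of_nonneg_left ?_ (by positivity)
    refine integral_mono (memLp_inner_const (hD n) u).integrable_sq
      (((hD n).integrable_norm_pow two_ne_zero).mul_const _) fun x => ?_
    show inner ℝ (B n x - A n x) u ^ 2 ≤ ‖B n x - A n x‖ ^ 2 * ‖u‖ ^ 2
    rw [← mul_pow, ← sq_abs]
    exact pow_le_pow_left₀ (abs_nonneg _) (abs_real_inner_le_norm _ _) 2
  have ha : ∀ u : E, Tendsto (fun n : ℕ => (n : ℝ)⁻¹ * ∫ x, inner ℝ (A n x) u ^ 2 ∂P)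
      atTop (𝓝 (σ u u)) := fun u => by simpa only [sq] using h u u
  have t1 := tendsto_average_mul_of_tendsto_zero (fun n => memLp_inner_const (hA n) u)
    (fun n => memLp_inner_const (hD n) w) (ha u) (hd w)
  have t2 := tendsto_average_mul_of_tendsto_zero (fun n => memLp_inner_const (hA n) w)
    (fun n => memLp_inner_const (hD n) u) (ha w) (hd u)
  have t3 := tendsto_average_mul_of_tendsto_zero (fun n => memLp_inner_const (hD n) u)
    (fun n => memLp_inner_const (hD n) w) (hd u) (hd w)
  have t := ((h u w).add t1).add (t2.add t3)
  simp only [add_zero] at t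
  refine t.congr fun n => ?_
  have i1 := integrable_mul_of_memLp (memLp_inner_const (hA n) u) (memLp_inner_const (hA n) w)
  have i2 := integrable_mul_of_memLp (memLp_inner_const (hA n) u) (memLp_inner_const (hD n) w)
  have i3 := integrable_mul_of_memLp (memLp_inner_const (hA n) w) (memLp_inner_const (hD n) u)
  have i4 := integrable_mul_of_memLp (memLp_inner_const (hD n) u) (memLp_inner_const (hD n) w)
  rw [← mul_add, ← mul_add, ← mul_add, ← integral_add_four i1 i2 i3 i4]
  congr 1
  refine integral_congr_ae (.of_forall fun x => ?_)
  simp only [inner_sub_left]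
  ring

end Covariance

/-! ### The coboundary on the tower is negligible in `L²` after division by `√n`. -/

section TowerCovariance

variable {α E : Type*} [MeasurableSpace α] {μ : Measure α} [IsProbabilityMeasure μ] {F : α → α}
  {label : α → ℕ} {τ : α → ℕ} {L γ θ B : ℝ} {a : α → ℝ}
  [NormedAddCommGroup E] [InnerProductSpace ℝ E] [CompleteSpace E] [MeasurableSpace E]
  [BorelSpace E] [SecondCountableTopology E] {m χ : α → E} {W : α × ℕ → E}

/-- Bound for the square of the increment of the coboundary from below the top level. -/
def climbWeight (τ : α → ℕ) (n : ℕ) (p : α × ℕ) : ℕ :=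
  if p.2 + n < τ p.1 then n ^ 2 else p.2 ^ 2

/-- Bound for the square of the coboundary on the first `n` levels. -/
def baseWeight (n : ℕ) (p : α × ℕ) : ℕ := if p.2 < n then p.2 ^ 2 else 0

/-- Split the column at level `τ x - n`. The lower part is nonempty only when `n < τ x`, and
contributes at most `τ x * n ^ 2 ≤ τ x ^ 2 * n`; the upper part has at most `min (τ x) n` levels,
each of weight at most `τ x ^ 2`. -/
lemma sum_climbWeight_le (τ : α → ℕ) (n : ℕ) (x : α) :
    ∑ l ∈ Finset.range (τ x), climbWeight τ n (x, l) ≤ 2 * (τ x ^ 2 * min (τ x) n) := by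
  have h1 : τ x - n ≤ τ x := Nat.sub_le _ _
  rw [Finset.range_eq_Ico, ← Finset.sum_Ico_consecutive _ (Nat.zero_le _) h1, two_mul]
  refine add_le_add ?_ ?_
  · have : ∀ l ∈ Finset.Ico 0 (τ x - n), climbWeight τ n (x, l) ≤ n ^ 2 := fun l hl => by
      have := (Finset.mem_Ico.1 hl).2
      have : l + n < τ x := by omega
      simp [climbWeight, this]
    refine (Finset.sum_le_card_nsmul _ _ _ this).trans ?_
    rw [Nat.card_Ico, smul_eq_mul, Nat.sub_zero]
    rcases le_total (τ x) n with h | h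
    · simp [Nat.sub_eq_zero_of_le h]
    · rw [min_eq_right h]
      calc (τ x - n) * n ^ 2 = (τ x - n) * n * n := by ring
        _ ≤ τ x * τ x * n := by gcongr
        _ = _ := by ring
  · have : ∀ l ∈ Finset.Ico (τ x - n) (τ x), climbWeight τ n (x, l) ≤ τ x ^ 2 := fun l hl => by
      have h2 := Finset.mem_Ico.1 hl
      have h3 : ¬ l + n < τ x := by omega
      simp only [climbWeight, h3, if_false]
      exact Nat.pow_le_pow_left h2.2.le 2
    refine (Finset.sum_le_card_nsmul _ _ _ this).trans ?_
    rw [Nat.card_Ico, smul_eq_mul, mul_comm]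
    refine Nat.mul_le_mul_left _ ?_
    omega

lemma sum_baseWeight_le (n : ℕ) (x : α) :
    ∑ l ∈ Finset.range (τ x), baseWeight n (x, l) ≤ τ x ^ 2 * min (τ x) n := by
  have h1 : min (τ x) n ≤ τ x := min_le_left _ _
  rw [Finset.range_eq_Ico, ← Finset.sum_Ico_consecutive _ (Nat.zero_le _) h1]
  have h2 : ∑ l ∈ Finset.Ico (min (τ x) n) (τ x), baseWeight n (x, l) = 0 :=
    Finset.sum_eq_zero fun l hl => by
      have := Finset.mem_Ico.1 hl
      have : ¬ l < n := by omega
      simp [baseWeight, this]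
  rw [h2, add_zero]
  have : ∀ l ∈ Finset.Ico 0 (min (τ x) n), baseWeight n (x, l) ≤ τ x ^ 2 := fun l hl => by
    have h3 := Finset.mem_Ico.1 hl
    have h4 : l ≤ τ x := by omega
    simp only [baseWeight]
    split_ifs
    · exact Nat.pow_le_pow_left h4 2
    · exact Nat.zero_le _
  refine (Finset.sum_le_card_nsmul _ _ _ this).trans ?_
  rw [Nat.card_Ico, smul_eq_mul, mul_comm, Nat.sub_zero]

/-- Either the orbit climbs for `n` steps, or it ends on one of the first `n` levels. -/
lemma iterate_towerMap_cases (hpos : ∀ x, 0 < τ x) (n : ℕ) (q : Tower τ) :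
    (q.1.2 + n < τ q.1.1 ∧ ((towerMap F τ hpos)^[n] q).1 = (q.1.1, q.1.2 + n)) ∨
      (¬ q.1.2 + n < τ q.1.1 ∧ ((towerMap F τ hpos)^[n] q).1.2 < n) := by
  induction n with
  | zero => exact Or.inl ⟨by simpa using q.2, rfl⟩
  | succ n ih =>
    rw [Function.iterate_succ_apply', towerMap_val]
    rcases ih with ⟨h1, h2⟩ | ⟨h1, h2⟩
    · rw [h2]
      by_cases h : q.1.2 + n + 1 < τ q.1.1
      · exact Or.inl ⟨h, by simp [towerStep, h, ← add_assoc]⟩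
      · exact Or.inr ⟨h, by simp [towerStep, h]⟩
    · refine Or.inr ⟨by omega, ?_⟩
      unfold towerStep
      split_ifs <;> simp [h2]

/-- If the orbit only climbs, the increment consists of `n` values of `W`, however high the column;
otherwise the two values are bounded separately, and the final level is below `n`. Bounding both
ends separately in all cases would require a third moment of `τ`. -/
lemma norm_sq_corrLift_sub_le (hpos : ∀ x, 0 < τ x) {R : ℝ}
    (hW : IsTowerObservable F label τ (fun _ => 1) B θ W) (hχ : ∀ x, ‖χ x‖ ≤ R) (n : ℕ)
    (q : Tower τ) :
    ‖corrLift χ W ((towerMap F τ hpos)^[n] q).1 - corrLift χ W q.1‖ ^ 2 ≤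
      8 * R ^ 2 + 4 * B ^ 2 * (climbWeight τ n q.1 +
        baseWeight n ((towerMap F τ hpos)^[n] q).1) := by
  rcases iterate_towerMap_cases (F := F) hpos n q with ⟨h1, h2⟩ | ⟨h1, h2⟩
  · have e : corrLift χ W ((towerMap F τ hpos)^[n] q).1 - corrLift χ W q.1 =
        ∑ i ∈ Finset.range n, W (q.1.1, q.1.2 + i) := by
      rw [h2, corrLift, corrLift, Finset.sum_range_add]
      abel
    have h3 : ‖∑ i ∈ Finset.range n, W (q.1.1, q.1.2 + i)‖ ≤ B * n := by
      refine (norm_sum_le _ _).trans ((Finset.sum_le_sum fun i hi => hW.bound _ _ ?_).trans_eq ?_)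
      · have := Finset.mem_range.1 hi
        omega
      · simp [mul_comm]
    rw [e, climbWeight, if_pos h1]
    have h4 := pow_le_pow_left₀ (norm_nonneg _) h3 2
    have h5 : (0 : ℝ) ≤ baseWeight n ((towerMap F τ hpos)^[n] q).1 := Nat.cast_nonneg _
    have h6 : 0 ≤ 4 * B ^ 2 * baseWeight n ((towerMap F τ hpos)^[n] q).1 := by positivity
    push_cast
    nlinarith [sq_nonneg (B * n), sq_nonneg R]
  · have h3 := norm_corrLift_le hW hχ q
    have h4 := norm_corrLift_le hW hχ ((towerMap F τ hpos)^[n] q)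
    simp only [one_mul] at h3 h4
    rw [climbWeight, if_neg h1, baseWeight, if_pos h2]
    push_cast
    set l : ℝ := (q.1.2 : ℝ)
    set l' : ℝ := (((towerMap F τ hpos)^[n] q).1.2 : ℝ)
    have h5 := (norm_sub_le (corrLift χ W ((towerMap F τ hpos)^[n] q).1) (corrLift χ W q.1)).trans
      (add_le_add h4 h3)
    have h6 := pow_le_pow_left₀ (norm_nonneg _) h5 2
    refine h6.trans ?_
    nlinarith [sq_nonneg (B * l - B * l'), sq_nonneg (R - B * l), sq_nonneg (R - B * l')]

lemma lintegral_increment_le (hF : MeasurePreserving F μ μ) (hτ : IsInducingTime label τ)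
    (n : ℕ) :
    ∫⁻ q, ((climbWeight τ n q.1 : ℝ≥0∞) +
        (baseWeight n ((towerMap F τ hτ.pos)^[n] q).1 : ℝ≥0∞)) ∂towerMeasure τ μ ≤
      3 * ∫⁻ x, (τ x : ℝ≥0∞) ^ 2 * (min (τ x) n : ℕ) ∂μ := by
  have hf := measurePreserving_towerMap hF hτ.measurable hτ.pos
  have hZ : (∫⁻ a, (τ a : ℝ≥0∞) ∂μ)⁻¹ ≤ 1 :=
    ENNReal.inv_le_one.2 (one_le_lintegral_time hτ.pos)
  have hcast : Measurable fun k : ℕ => (k : ℝ≥0∞) := measurable_from_top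
  have m1 : Measurable fun p : α × ℕ => (climbWeight τ n p : ℝ≥0∞) :=
    hcast.comp (Measurable.ite (measurableSet_lt (measurable_snd.add_const n)
      (hτ.measurable.comp measurable_fst)) measurable_const (measurable_snd.pow_const 2))
  have m2 : Measurable fun p : α × ℕ => (baseWeight n p : ℝ≥0∞) :=
    hcast.comp (Measurable.ite (measurableSet_lt measurable_snd measurable_const)
      (measurable_snd.pow_const 2) measurable_const)
  have m2' : Measurable fun q : Tower τ => (baseWeight n q.1 : ℝ≥0∞) :=
    m2.comp measurable_subtype_coe
  have m1' : Measurable fun q : Tower τ => (climbWeight τ n q.1 : ℝ≥0∞) :=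
    m1.comp measurable_subtype_coe
  rw [lintegral_add_left m1', (hf.iterate n).lintegral_comp m2', lintegral_tower hτ.measurable m1,
    lintegral_tower hτ.measurable m2, show (3 : ℝ≥0∞) = 2 + 1 by norm_num, add_mul, one_mul]
  refine add_le_add ?_ ?_
  · refine (mul_le_of_le_one_left zero_le hZ).trans ?_
    rw [← lintegral_const_mul' _ _ (by norm_num)]
    refine lintegral_mono fun x => ?_
    have h := (Nat.cast_le (α := ℝ≥0∞)).2 (sum_climbWeight_le τ n x)
    push_cast at h ⊢
    exact h
  · refine (mul_le_of_le_one_left zero_le hZ).trans (lintegral_mono fun x => ?_)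
    have h := (Nat.cast_le (α := ℝ≥0∞)).2 (sum_baseWeight_le (τ := τ) n x)
    push_cast at h ⊢
    exact h

/-- Dominated convergence: after division by `n` the integrand is at most `τ ^ 2`, and pointwise it
is at most `τ ^ 3 / n`. So a finite second moment is enough. -/
lemma tendsto_average_lintegral_min (hτ : IsInducingTime label τ)
    (hi : Integrable (fun x => (τ x : ℝ) ^ 2) μ) :
    Tendsto (fun n : ℕ => (n : ℝ≥0∞)⁻¹ * ∫⁻ x, (τ x : ℝ≥0∞) ^ 2 * (min (τ x) n : ℕ) ∂μ)
      atTop (𝓝 0) := by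
  have hcast : Measurable fun k : ℕ => (k : ℝ≥0∞) := measurable_from_top
  have hfin : ∫⁻ x, (τ x : ℝ≥0∞) ^ 2 ∂μ ≠ ∞ := by
    have := hi.2
    unfold HasFiniteIntegral at this
    refine ne_of_lt (lt_of_eq_of_lt (lintegral_congr fun x => ?_) this)
    rw [enorm_pow, Real.enorm_natCast]
  have h := tendsto_lintegral_of_dominated_convergence (μ := μ)
    (F := fun n x => (n : ℝ≥0∞)⁻¹ * ((τ x : ℝ≥0∞) ^ 2 * (min (τ x) n : ℕ))) (f := fun _ => 0)
    (fun x => (τ x : ℝ≥0∞) ^ 2) (fun n => ?_) (fun n => .of_forall fun x => ?_) hfin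
    (.of_forall fun x => ?_)
  · rw [lintegral_zero] at h
    refine h.congr' ((eventually_ge_atTop 1).mono fun n hn => ?_)
    rw [lintegral_const_mul']
    simp; omega
  · exact (((hcast.comp hτ.measurable).pow_const 2).mul
      (hcast.comp (hτ.measurable.min measurable_const))).const_mul _
  · rcases Nat.eq_zero_or_pos n with rfl | hn
    · simp
    · have hn0 : (n : ℝ≥0∞) ≠ 0 := by exact_mod_cast hn.ne'
      calc (n : ℝ≥0∞)⁻¹ * ((τ x : ℝ≥0∞) ^ 2 * (min (τ x) n : ℕ))
          ≤ (n : ℝ≥0∞)⁻¹ * ((τ x : ℝ≥0∞) ^ 2 * n) := by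
            gcongr
            exact min_le_right _ _
        _ = (τ x : ℝ≥0∞) ^ 2 * ((n : ℝ≥0∞)⁻¹ * n) := by ring
        _ ≤ _ := by rw [ENNReal.inv_mul_cancel hn0 (ENNReal.natCast_ne_top n), mul_one]
  · have h1 : Tendsto (fun n : ℕ => (n : ℝ≥0∞)⁻¹ * ((τ x : ℝ≥0∞) ^ 2 * τ x)) atTop (𝓝 (0 * _)) :=
      ENNReal.Tendsto.mul_const ENNReal.tendsto_inv_nat_nhds_zero
        (Or.inr (ENNReal.mul_ne_top (ENNReal.pow_ne_top (ENNReal.natCast_ne_top _))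
          (ENNReal.natCast_ne_top _)))
    rw [zero_mul] at h1
    refine tendsto_of_tendsto_of_tendsto_of_le_of_le tendsto_const_nhds h1 (fun n => zero_le)
      fun n => ?_
    show (n : ℝ≥0∞)⁻¹ * ((τ x : ℝ≥0∞) ^ 2 * (min (τ x) n : ℕ)) ≤ _
    gcongr
    exact min_le_left _ _

/-- The asymptotic covariance of a square integrable observable on the tower. -/
theorem GibbsMarkov.exists_covariance (hG : GibbsMarkov F label μ L γ)
    (hτ : IsInducingTime label τ) (hi : Integrable (fun x => (τ x : ℝ) ^ 2) μ)
    (hθ : 0 < θ) (hθ1 : θ < 1) (hB : 0 ≤ B)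
    (hW : IsTowerObservable F label τ (fun _ => 1) B θ W)
    (h0 : ∫ q : Tower τ, W q.1 ∂towerMeasure τ μ = 0) :
    ∃ σ : E → E → ℝ, ∀ u w, Tendsto (fun n : ℕ => (n : ℝ)⁻¹ *
      ∫ q, inner ℝ (birkhoffSum (towerMap F τ hτ.pos) (fun q => W q.1) n q) u *
        inner ℝ (birkhoffSum (towerMap F τ hτ.pos) (fun q => W q.1) n q) w ∂towerMeasure τ μ)
      atTop (𝓝 (σ u w)) := by
  have hi1 : Integrable (fun x => (τ x : ℝ)) μ := by
    have := hτ.integrable_rpow (p := 2) (r := 1) (by norm_num) (by simpa using hi)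
    simpa using this
  have hfin := hτ.lintegral_ne_top hi1
  have hprob := isProbabilityMeasure_tower (μ := μ) hτ.measurable hτ.pos hfin
  have hw := hτ.isWeight (a := fun _ => 1) measurable_const (fun _ _ _ => rfl)
    (fun _ => zero_le_one) (fun _ => le_rfl)
  have hΦ := hW.isSymbolicHolder hτ
  have e1 : (fun x => (1 : ℝ) * (τ x : ℝ) * τ x) = fun x => (τ x : ℝ) ^ 2 := by
    ext x; ring
  have ht : Integrable (fun x => (1 : ℝ) * (τ x : ℝ) * τ x) μ := by rwa [e1]
  have hWi := hW.integrable hτ hi1 (fun _ => le_rfl) hB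
  obtain ⟨χ, hχm, hχ, hm⟩ := hG.exists_corrector hw ht hθ hθ1 hB hΦ
    (integral_towerSum_eq_zero hτ hi1 hWi h0)
  set R := correctorConst L γ θ * B * ∫ x, 1 * (τ x : ℝ) * τ x ∂μ
  set m : α → E := fun x => towerSum τ W x + χ x - χ (F x) with hm_def
  have hmt := IsReverseDiff.topLift hG.preserves hτ.measurable hτ.pos hfin hm
  set f := towerMap F τ hτ.pos with hf_def
  set P := towerMeasure τ μ
  have hf : MeasurePreserving f P P := measurePreserving_towerMap hG.preserves hτ.measurable hτ.pos
  have hW2 : MemLp (fun q : Tower τ => W q.1) 2 P :=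
    MemLp.of_bound (hW.measurable.comp measurable_subtype_coe).aestronglyMeasurable B
      (.of_forall fun q => by simpa using hW.bound q.1.1 q.1.2 q.2)
  -- The limit is the covariance of one martingale difference on the tower. For the martingale sums
  -- the normalised covariance equals it for every `n ≥ 1`, and it remains to show that the
  -- coboundary is negligible.
  refine ⟨fun u w => ∫ q : Tower τ, inner ℝ (topLift τ m q.1) u * inner ℝ (topLift τ m q.1) w ∂P,
    fun u w => tendsto_covariance_of_sub (P := P)
      (A := fun n => birkhoffSum f (fun q => topLift τ m q.1) n)
      (σ := fun u w => ∫ q : Tower τ, inner ℝ (topLift τ m q.1) u * inner ℝ (topLift τ m q.1) w ∂P)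
      (fun n => memLp_birkhoffSum hf hmt.memLp n)
      (fun n => memLp_birkhoffSum hf hW2 n) (fun u w => ?_) ?_ u w⟩
  · refine tendsto_const_nhds.congr' ((eventually_ge_atTop 1).mono fun n hn => ?_)
    have hn0 : (n : ℝ) ≠ 0 := by positivity
    simp only
    rw [hmt.integral_birkhoffSum_mul hf, inv_mul_cancel_left₀ hn0]
  · have hD : ∀ n q, birkhoffSum f (fun q => W q.1) n q -
        birkhoffSum f (fun q => topLift τ m q.1) n q =
        corrLift χ W (f^[n] q).1 - corrLift χ W q.1 := fun n q => by
      rw [birkhoffSum_tower (F := F) (χ := χ) (W := W) hτ.pos n q]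
      abel
    simp_rw [hD]
    have hcm : Measurable fun q : Tower τ => corrLift χ W q.1 :=
      (measurable_corrLift hχm hW.measurable).comp measurable_subtype_coe
    have hDm : ∀ n, Measurable fun q => ‖corrLift χ W (f^[n] q).1 - corrLift χ W q.1‖ ^ 2 :=
      fun n => (((hcm.comp (hf.iterate n).measurable).sub hcm).norm).pow_const 2
    set κ : ℕ → ℝ≥0∞ := fun n => (n : ℝ≥0∞)⁻¹ *
      ∫⁻ q, ENNReal.ofReal (‖corrLift χ W (f^[n] q).1 - corrLift χ W q.1‖ ^ 2) ∂P with hκ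
    have hκ0 : Tendsto κ atTop (𝓝 0) := by
      have t1 : Tendsto (fun n : ℕ => (n : ℝ≥0∞)⁻¹ * ENNReal.ofReal (8 * R ^ 2)) atTop
          (𝓝 (0 * _)) :=
        ENNReal.Tendsto.mul_const ENNReal.tendsto_inv_nat_nhds_zero (Or.inr ENNReal.ofReal_ne_top)
      have t2 := ENNReal.Tendsto.const_mul (a := ENNReal.ofReal (4 * B ^ 2) * 3)
        (tendsto_average_lintegral_min hτ hi) (Or.inr (by finiteness))
      have t3 := t1.add t2
      rw [zero_mul, mul_zero, add_zero] at t3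
      refine tendsto_of_tendsto_of_tendsto_of_le_of_le tendsto_const_nhds t3 (fun n => zero_le)
        fun n => ?_
      simp only [hκ]
      rw [show ENNReal.ofReal (4 * B ^ 2) * 3 * ((n : ℝ≥0∞)⁻¹ *
        ∫⁻ x, (τ x : ℝ≥0∞) ^ 2 * (min (τ x) n : ℕ) ∂μ) = (n : ℝ≥0∞)⁻¹ *
          (ENNReal.ofReal (4 * B ^ 2) * (3 * ∫⁻ x, (τ x : ℝ≥0∞) ^ 2 * (min (τ x) n : ℕ) ∂μ)) by ring,
        ← mul_add]
      refine mul_le_mul_right ?_ _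
      have hb : ∀ q, ENNReal.ofReal (‖corrLift χ W (f^[n] q).1 - corrLift χ W q.1‖ ^ 2) ≤
          ENNReal.ofReal (8 * R ^ 2) + ENNReal.ofReal (4 * B ^ 2) *
            ((climbWeight τ n q.1 : ℝ≥0∞) + (baseWeight n (f^[n] q).1 : ℝ≥0∞)) := fun q => by
        refine (ENNReal.ofReal_le_ofReal (norm_sq_corrLift_sub_le hτ.pos hW hχ n q)).trans ?_
        rw [ENNReal.ofReal_add (by positivity) (by positivity),
          ENNReal.ofReal_mul (p := 4 * B ^ 2) (by positivity),
          ENNReal.ofReal_add (by positivity) (by positivity), ENNReal.ofReal_natCast,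
          ENNReal.ofReal_natCast]
      refine (lintegral_mono hb).trans ?_
      rw [lintegral_add_left measurable_const, lintegral_const, measure_univ, mul_one,
        lintegral_const_mul' _ _ ENNReal.ofReal_ne_top]
      exact add_le_add_right (mul_le_mul_right (lintegral_increment_le hG.preserves hτ n) _) _
    have hκ1 := (ENNReal.tendsto_toReal ENNReal.zero_ne_top).comp hκ0
    rw [ENNReal.toReal_zero] at hκ1
    refine hκ1.congr fun n => ?_
    rw [Function.comp_apply, hκ, ENNReal.toReal_mul, ENNReal.toReal_inv, ENNReal.toReal_natCast,
      integral_eq_lintegral_of_nonneg_ae (.of_forall fun q => by positivity)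
        (hDm n).aestronglyMeasurable]

end TowerCovariance

/-! ### The quotient map is Gibbs-Markov -/

lemma le_sepTime {α : Type*} {F : α → α} {label : α → ℕ} {x y : α} {n : ℕ}
    (h : ∀ i < n, label (F^[i] x) = label (F^[i] y)) : (n : ℕ∞) ≤ sepTime F label x y := by
  refine le_iInf₂ fun m hm => ?_
  by_contra hlt
  exact hm (h m (by exact_mod_cast not_le.1 hlt))

lemma powENat_le {θ : ℝ} (hθ : 0 ≤ θ) (hθ1 : θ ≤ 1) {n : ℕ} {s : ℕ∞} (h : (n : ℕ∞) ≤ s) :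
    powENat θ s ≤ θ ^ n := by
  unfold powENat
  split_ifs with hs
  · positivity
  · lift s to ℕ using hs
    exact pow_le_pow_of_le_one hθ hθ1 (by exact_mod_cast h)

namespace InducingScheme

variable {Λ : Type u} [MetricSpace Λ] [MeasurableSpace Λ] {T : Λ → Λ} (S : InducingScheme T)

lemma measurable_τ : Measurable S.τ := by
  have hf : Function.FactorsThrough S.τ S.piece := fun y y' h => S.τ_const y y' h
  have : S.τ = Function.extend S.piece S.τ (fun _ => 0) ∘ S.piece := by
    ext y
    exact (hf.extend_apply _ y).symm
  rw [this]
  exact measurable_from_top.comp S.measurable_piece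

lemma measurable_F (hT : Measurable T) : Measurable S.F := by
  refine measurable_comap_iff.2 ?_
  have h : Measurable fun p : ℕ × S.Y => T^[p.1] (p.2 : Λ) :=
    measurable_from_prod_countable_right fun n => (hT.iterate n).comp measurable_subtype_coe
  exact h.comp (S.measurable_τ.prodMk measurable_id)

lemma measurable_proj : Measurable S.proj := measurable_quotient_mk''

lemma proj_F (y : S.Y) : S.proj (S.F y) = S.Fbar (S.proj y) := rfl

lemma proj_iterate_F (n : ℕ) (y : S.Y) : S.proj (S.F^[n] y) = S.Fbar^[n] (S.proj y) :=
  Function.Semiconj.iterate_right (f := S.proj) (fun y => S.proj_F y) n y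

lemma pieceBar_proj (y : S.Y) : S.pieceBar (S.proj y) = S.piece y := rfl

lemma measurable_Fbar (hT : Measurable T) : Measurable S.Fbar :=
  measurable_from_quotient.2 (S.measurable_proj.comp (S.measurable_F hT))

lemma measurable_pieceBar : Measurable S.pieceBar := measurable_from_quotient.2 S.measurable_piece

lemma measurable_τbar : Measurable S.τbar := measurable_from_quotient.2 S.measurable_τ

lemma isInducingTime : IsInducingTime S.pieceBar S.τbar where
  measurable := S.measurable_τbar
  pos := S.τbar_pos
  const x x' := by
    induction x using Quotient.inductionOn
    induction x' using Quotient.inductionOn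
    exact S.τ_const _ _

lemma piece_iterate_leafPoint (n : ℕ) (x : S.Ybar) :
    S.piece (S.F^[n] (S.leafPoint x)) = S.pieceBar (S.Fbar^[n] x) := by
  rw [← pieceBar_proj, proj_iterate_F, proj_leafPoint]

variable {S} {D₀ D₁ γ p : ℝ}

lemma visits_zero (x : Λ) : S.visits 0 x = 0 := by simp [visits]

lemma IsHyperbolic.dist_leafPoint_le (h : S.IsHyperbolic D₀ D₁ γ p) (hD : 0 ≤ D₀) (hγ : 0 < γ)
    (hγ1 : γ < 1) {n : ℕ} {x x' : S.Ybar}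
    (hx : ∀ i < n, S.pieceBar (S.Fbar^[i] x) = S.pieceBar (S.Fbar^[i] x')) (j : ℕ) :
    dist (T^[j] (S.leafPoint x : Λ)) (T^[j] (S.leafPoint x' : Λ)) ≤
      D₀ * (γ ^ n / γ ^ S.visits j (S.leafPoint x : Λ)) := by
  refine (h.expand _ (S.leafPoint_mem x) _ (S.leafPoint_mem x') j).trans ?_
  have : powENat γ (sepTime S.F S.piece (S.leafPoint x) (S.leafPoint x')) ≤ γ ^ n :=
    powENat_le hγ.le hγ1.le (le_sepTime fun i hi => by
      rw [piece_iterate_leafPoint, piece_iterate_leafPoint, hx i hi])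
  gcongr

/-- The `σ`-algebra generated by the itineraries. -/
abbrev wordSpace (S : InducingScheme T) : MeasurableSpace S.Ybar :=
  ⨆ n, MeasurableSpace.comap (word S.Fbar S.pieceBar n) inferInstance

/-- Two leaves with the same first `n` labels have leaf points at distance at most `D₀ * γ ^ n`. So
the preimage of an open set is a union of cylinders, and there are countably many of them. -/
lemma IsHyperbolic.measurable_leafPoint_word [BorelSpace Λ] (h : S.IsHyperbolic D₀ D₁ γ p)
    (hD : 0 ≤ D₀) (hγ : 0 < γ) (hγ1 : γ < 1) :
    Measurable[S.wordSpace] fun x => (S.leafPoint x : Λ) := by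
  borelize Λ
  refine @measurable_of_isOpen _ _ _ _ _ S.wordSpace _ fun U hU => ?_
  set G : S.Ybar → Λ := fun x => (S.leafPoint x : Λ)
  have e : G ⁻¹' U = ⋃ n, word S.Fbar S.pieceBar n ⁻¹'
      {w | word S.Fbar S.pieceBar n ⁻¹' {w} ⊆ G ⁻¹' U} := by
    ext x
    simp only [Set.mem_iUnion, Set.mem_preimage]
    constructor
    · intro hx
      obtain ⟨ε, hε, hball⟩ := Metric.isOpen_iff.1 hU _ hx
      have h1 : Tendsto (fun n : ℕ => D₀ * γ ^ n) atTop (𝓝 (D₀ * 0)) :=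
        (tendsto_pow_atTop_nhds_zero_of_lt_one hγ.le hγ1).const_mul _
      rw [mul_zero] at h1
      obtain ⟨n, hn⟩ := (h1.eventually_lt_const hε).exists
      refine ⟨n, fun x' hx' => hball ?_⟩
      have hx'' : ∀ i < n, S.pieceBar (S.Fbar^[i] x') = S.pieceBar (S.Fbar^[i] x) :=
        fun i hi => congrFun hx' ⟨i, hi⟩
      have h2 := h.dist_leafPoint_le hD hγ hγ1 hx'' 0
      simp only [Function.iterate_zero, id, visits_zero, pow_zero, div_one] at h2
      exact Metric.mem_ball.2 (h2.trans_lt hn)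
    · rintro ⟨n, hn⟩
      exact hn rfl
  rw [e]
  refine @MeasurableSet.iUnion _ _ S.wordSpace _ _ fun n => ?_
  have hle : MeasurableSpace.comap (word S.Fbar S.pieceBar n) inferInstance ≤ S.wordSpace :=
    le_iSup (fun n => MeasurableSpace.comap (word S.Fbar S.pieceBar n) inferInstance) n
  exact hle _ ⟨_, MeasurableSet.of_discrete, rfl⟩

/-- A measurable set in the quotient is the preimage under `leafPoint` of a Borel set, so
itineraries generate the quotient `σ`-algebra. This is what martingale convergence of the invariant
density requires. -/
lemma IsHyperbolic.measurableSpace_le (h : S.IsHyperbolic D₀ D₁ γ p) [BorelSpace Λ]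
    (hD : 0 ≤ D₀) (hγ : 0 < γ) (hγ1 : γ < 1) :
    (inferInstance : MeasurableSpace S.Ybar) ≤ S.wordSpace := by
  intro A hA
  obtain ⟨B, hB, hBA⟩ := S.measurable_proj hA
  have e : A = (fun x => (S.leafPoint x : Λ)) ⁻¹' B := by
    ext x
    have : S.leafPoint x ∈ Subtype.val ⁻¹' B ↔ S.leafPoint x ∈ S.proj ⁻¹' A := by rw [hBA]
    simp only [Set.mem_preimage, proj_leafPoint] at this
    exact this.symm
  rw [e]
  exact h.measurable_leafPoint_word hD hγ hγ1 hB

lemma wordSpace_le (hT : Measurable T) : S.wordSpace ≤ (inferInstance : MeasurableSpace S.Ybar) :=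
  iSup_le fun n => (measurable_word (S.measurable_Fbar hT) S.measurable_pieceBar n).comap_le

lemma IsHyperbolic.measurable_leafPoint [BorelSpace Λ] (h : S.IsHyperbolic D₀ D₁ γ p)
    (hT : Measurable T) (hD : 0 ≤ D₀) (hγ : 0 < γ) (hγ1 : γ < 1) : Measurable S.leafPoint :=
  measurable_comap_iff.2 fun _ hB =>
    wordSpace_le hT _ (h.measurable_leafPoint_word hD hγ hγ1 hB)

lemma measurable_proj_Wu : Measurable fun w : S.Wu => S.proj w.1 :=
  S.measurable_proj.comp measurable_subtype_coe

lemma IsHyperbolic.lintegral_ρbar_lt_top (h : S.IsHyperbolic D₀ D₁ γ p) :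
    ∫⁻ x, ENNReal.ofReal ((S.τbar x : ℝ) ^ p) ∂S.ρbar < ∞ := by
  have hm : Measurable fun x : S.Ybar => ENNReal.ofReal ((S.τbar x : ℝ) ^ p) :=
    (measurable_from_top (f := fun k : ℕ => ENNReal.ofReal ((k : ℝ) ^ p))).comp S.measurable_τbar
  rw [ρbar, lintegral_map hm measurable_proj_Wu]
  exact h.integrable

/-- As `τ ≥ 1`, the finite moment of `τ` bounds the total mass. -/
lemma IsHyperbolic.isFiniteMeasure_ρbar (h : S.IsHyperbolic D₀ D₁ γ p) (hp : 0 ≤ p) :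
    IsFiniteMeasure S.ρbar := by
  refine ⟨lt_of_le_of_lt ?_ h.lintegral_ρbar_lt_top⟩
  rw [← lintegral_one]
  refine lintegral_mono fun x => ?_
  rw [← ENNReal.ofReal_one]
  exact ENNReal.ofReal_le_ofReal
    (Real.one_le_rpow (by exact_mod_cast S.τbar_pos x) hp)

/-- On a branch, `1 / ζ` is the Jacobian of the quotient map, and its values at points of the two
pullbacks differ by a factor at most `exp (D₁ * γ ^ n)`. Integrating this comparison over the
product of the pullbacks gives the statement for measures. -/
lemma IsHyperbolic.hasDistortion_ρbar (h : S.IsHyperbolic D₀ D₁ γ p) (hT : Measurable T)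
    (hp : 0 ≤ p) (hD₁ : 0 ≤ D₁) (hγ : 0 < γ) (hγ1 : γ < 1) :
    HasDistortion S.Fbar S.pieceBar S.ρbar D₁ γ := by
  have := h.isFiniteMeasure_ρbar hp
  intro j n B B' hB hB' hBB'
  by_cases hj : j ∈ Set.range S.pieceBar
  swap
  · have : pre S.Fbar S.pieceBar j B = ∅ := by
      ext x
      simp only [pre, Set.mem_inter_iff, Set.mem_preimage, Set.mem_singleton_iff,
        Set.mem_empty_iff_false, iff_false, not_and]
      exact fun hx => absurd ⟨x, hx⟩ hj
    rw [this, measureReal_empty, zero_mul]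
    positivity
  obtain ⟨ζ, hζm, hζ0, hζ, hdist⟩ := h.distortion
  have hmeas : ∀ B, MeasurableSet B → MeasurableSet (pre S.Fbar S.pieceBar j B) := fun B hB =>
    measurableSet_pre (S.measurable_Fbar hT) S.measurable_pieceBar j hB
  have himage : ∀ B, MeasurableSet B → S.ρbar B =
      ∫⁻ x in pre S.Fbar S.pieceBar j B, ENNReal.ofReal (ζ x)⁻¹ ∂S.ρbar := fun B hB => by
    rw [← hζ j _ (fun x hx => hx.1) (hmeas B hB)]
    congr 1
    ext y
    constructor
    · intro hy
      obtain ⟨x, hx, rfl⟩ := (h.full_branch j hj).surjOn (Set.mem_univ y)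
      exact ⟨x, ⟨hx, hy⟩, rfl⟩
    · rintro ⟨x, hx, rfl⟩
      exact hx.2
  set A := pre S.Fbar S.pieceBar j B with hA
  set A' := pre S.Fbar S.pieceBar j B' with hA'
  have hζle : ∀ x ∈ A, ∀ x' ∈ A', (ζ x')⁻¹ ≤ Real.exp (D₁ * γ ^ n) * (ζ x)⁻¹ := by
    intro x hx x' hx'
    have h1 := hdist x x' (hx.1.trans hx'.1.symm)
    have h2 : powENat γ (sepTime S.Fbar S.pieceBar x x') ≤ γ ^ n :=
      (powENat_le hγ.le hγ1.le (le_sepTime fun i hi => hBB'.pre j x hx x' hx' i hi)).trans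
        (pow_le_pow_of_le_one hγ.le hγ1.le n.le_succ)
    have h3 : Real.log (ζ x) ≤ D₁ * γ ^ n + Real.log (ζ x') := by
      have := (abs_le.1 h1).2
      have := mul_le_mul_of_nonneg_left h2 hD₁
      linarith
    have h4 : ζ x ≤ Real.exp (D₁ * γ ^ n) * ζ x' := by
      rw [← Real.exp_log (hζ0 x), ← Real.exp_log (hζ0 x'), ← Real.exp_add]
      simpa using h3
    have := hζ0 x
    have := hζ0 x'
    rw [← div_eq_mul_inv, le_div_iff₀ (hζ0 x), inv_mul_le_iff₀ (hζ0 x')]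
    linarith
  have key : S.ρbar A * S.ρbar B' ≤
      ENNReal.ofReal (Real.exp (D₁ * γ ^ n)) * (S.ρbar A' * S.ρbar B) := by
    rw [himage B hB, himage B' hB', ← hA, ← hA']
    have m1 : Measurable fun x => ENNReal.ofReal (ζ x)⁻¹ := hζm.inv.ennreal_ofReal
    calc S.ρbar A * ∫⁻ x' in A', ENNReal.ofReal (ζ x')⁻¹ ∂S.ρbar
        = ∫⁻ _ in A, ∫⁻ x' in A', ENNReal.ofReal (ζ x')⁻¹ ∂S.ρbar ∂S.ρbar := by
          rw [setLIntegral_const, mul_comm]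
      _ ≤ ∫⁻ x in A, ∫⁻ _ in A',
            ENNReal.ofReal (Real.exp (D₁ * γ ^ n)) * ENNReal.ofReal (ζ x)⁻¹ ∂S.ρbar ∂S.ρbar := by
          refine setLIntegral_mono' (hmeas B hB) fun x hx =>
            setLIntegral_mono' (hmeas B' hB') fun x' hx' => ?_
          rw [← ENNReal.ofReal_mul (Real.exp_nonneg _)]
          exact ENNReal.ofReal_le_ofReal (hζle x hx x' hx')
      _ = _ := by
          simp_rw [setLIntegral_const]
          rw [lintegral_mul_const _ (m1.const_mul _), lintegral_const_mul _ m1]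
          ring
  have := ENNReal.toReal_mono (by finiteness) key
  rwa [ENNReal.toReal_mul, ENNReal.toReal_mul, ENNReal.toReal_mul,
    ENNReal.toReal_ofReal (Real.exp_nonneg _)] at this

variable {μY : Measure S.Y}

lemma IsInducedMeasure.isProbabilityMeasure_map (hμ : S.IsInducedMeasure μY) :
    IsProbabilityMeasure (μY.map S.proj) :=
  have := hμ.prob
  Measure.isProbabilityMeasure_map S.measurable_proj.aemeasurable

lemma IsInducedMeasure.measurePreserving_Fbar (hμ : S.IsInducedMeasure μY) (hT : Measurable T) :
    MeasurePreserving S.Fbar (μY.map S.proj) (μY.map S.proj) := by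
  refine ⟨S.measurable_Fbar hT, ?_⟩
  rw [Measure.map_map (S.measurable_Fbar hT) S.measurable_proj]
  have : S.Fbar ∘ S.proj = S.proj ∘ S.F := rfl
  rw [this, ← Measure.map_map S.measurable_proj (S.measurable_F hT), hμ.invariant.map_eq]

lemma IsHyperbolic.gibbsMarkov [BorelSpace Λ] (h : S.IsHyperbolic D₀ D₁ γ p)
    (hμ : S.IsInducedMeasure μY) (hT : Measurable T) (hp : 0 ≤ p) (hD₀ : 0 ≤ D₀) (hD₁ : 0 ≤ D₁)
    (hγ : 0 < γ) (hγ1 : γ < 1) :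
    GibbsMarkov S.Fbar S.pieceBar (μY.map S.proj) (3 * (D₁ / (1 - γ))) γ := by
  have := h.isFiniteMeasure_ρbar hp
  have := hμ.isProbabilityMeasure_map
  exact
  { preserves := hμ.measurePreserving_Fbar hT
    measurable_label := S.measurable_pieceBar
    L_nonneg := by
      have : 0 < 1 - γ := by linarith
      positivity
    γ_pos := hγ
    γ_lt_one := hγ1
    distortion := (h.hasDistortion_ρbar hT hp hD₁ hγ hγ1).of_invariant
      (hμ.measurePreserving_Fbar hT) S.measurable_pieceBar hD₁ hγ hγ1 hμ.absCont
      (h.measurableSpace_le hD₀ hγ hγ1) }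

/-- Regularity of the invariant density, compared with the whole space at `n = 0`, says that the
density is bounded; so the moment passes from `ρbar` to the invariant measure. -/
lemma IsHyperbolic.lintegral_τbar_lt_top [BorelSpace Λ] (h : S.IsHyperbolic D₀ D₁ γ p)
    (hμ : S.IsInducedMeasure μY) (hT : Measurable T) (hp : 0 ≤ p) (hD₀ : 0 ≤ D₀) (hD₁ : 0 ≤ D₁)
    (hγ : 0 < γ) (hγ1 : γ < 1) :
    ∫⁻ x, ENNReal.ofReal ((S.τbar x : ℝ) ^ p) ∂(μY.map S.proj) < ∞ := by
  have := h.isFiniteMeasure_ρbar hp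
  have := hμ.isProbabilityMeasure_map
  have hreg := (h.hasDistortion_ρbar hT hp hD₁ hγ hγ1).regular_of_invariant
    (hμ.measurePreserving_Fbar hT) S.measurable_pieceBar hD₁ hγ hγ1 hμ.absCont
    (h.measurableSpace_le hD₀ hγ hγ1) 0
  have hρ : S.ρbar Set.univ ≠ 0 := fun h0 => by
    have := hμ.absCont h0
    rw [measure_univ] at this
    exact one_ne_zero this
  have hρ' : 0 < S.ρbar.real Set.univ := ENNReal.toReal_pos hρ (measure_ne_top _ _)
  set c := Real.exp (D₁ / (1 - γ) * γ ^ 0) / S.ρbar.real Set.univ with hc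
  have hle : μY.map S.proj ≤ ENNReal.ofReal c • S.ρbar := by
    refine Measure.le_iff.2 fun B hB => ?_
    have h1 := hreg B Set.univ hB .univ (agree_zero _ _)
    rw [probReal_univ (μ := μY.map S.proj), one_mul] at h1
    rw [Measure.smul_apply, smul_eq_mul, ← ofReal_measureReal, ← ofReal_measureReal (μ := S.ρbar),
      ← ENNReal.ofReal_mul (by positivity)]
    refine ENNReal.ofReal_le_ofReal ?_
    rw [hc, div_mul_eq_mul_div, le_div_iff₀ hρ']
    exact h1
  refine (lintegral_mono' hle le_rfl).trans_lt ?_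
  rw [lintegral_smul_measure, smul_eq_mul]
  exact ENNReal.mul_lt_top ENNReal.ofReal_lt_top h.lintegral_ρbar_lt_top

end InducingScheme

/-! ### The quotient observable -/

section Holder

variable {Λ E : Type*} [MetricSpace Λ] [NormedAddCommGroup E] {η : ℝ≥0} {v : Λ → E}

lemma IsHolder.norm_le (h : IsHolder η v) (x : Λ) : ‖v x‖ ≤ holderNorm η v :=
  (le_ciSup h.1 x).trans (le_add_of_nonneg_right (NNReal.coe_nonneg _))

lemma IsHolder.norm_sub_le (h : IsHolder η v) (x y : Λ) :
    ‖v x - v y‖ ≤ holderNorm η v * dist x y ^ (η : ℝ) := by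
  rw [← dist_eq_norm]
  refine (h.2.holderWith.dist_le x y).trans ?_
  have : 0 ≤ ⨆ x, ‖v x‖ := Real.iSup_nonneg fun _ => norm_nonneg _
  refine mul_le_mul_of_nonneg_right ?_ (by positivity)
  exact le_add_of_nonneg_left this

lemma holderNorm_nonneg : 0 ≤ holderNorm η v :=
  add_nonneg (Real.iSup_nonneg fun _ => norm_nonneg _) (NNReal.coe_nonneg _)

lemma IsHolder.continuous (h : IsHolder η v) (hη : 0 < η) : Continuous v :=
  h.2.holderWith.continuous hη

end Holder

/-- The first bound is used for `k ≤ 2 * j`, the second for `k ≥ 2 * j`. The exponent 3 leaves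
enough room for decay in `j` and in `k` simultaneously, which is why `θ ^ 3 = γ ^ η`. -/
lemma min_pow_le {θ : ℝ} (hθ : 0 < θ) (hθ1 : θ ≤ 1) (j k : ℕ) :
    min (θ ^ (3 * j)) (θ ^ (3 * k) / θ ^ (3 * j)) ≤ θ ^ (j + k) := by
  rcases le_total k (2 * j) with h | h
  · exact (min_le_left _ _).trans (pow_le_pow_of_le_one hθ.le hθ1 (by omega))
  · refine (min_le_right _ _).trans ?_
    rw [div_le_iff₀ (by positivity), ← pow_add]
    exact pow_le_pow_of_le_one hθ.le hθ1 (by omega)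

namespace InducingScheme

variable {Λ : Type u} [MetricSpace Λ] [MeasurableSpace Λ] {T : Λ → Λ} {S : InducingScheme T}
  {E : Type*} [NormedAddCommGroup E] {v : Λ → E} {D₀ D₁ γ p η N θ : ℝ}

lemma measurable_iterate_uncurry (hT : Measurable T) : Measurable fun p : Λ × ℕ => T^[p.2] p.1 :=
  measurable_from_prod_countable_left fun _ => hT.iterate _

lemma visits_le (j : ℕ) (x : Λ) : S.visits j x ≤ j := by
  have h : {k : ℕ | k < j ∧ T^[k] x ∈ S.Y} ⊆ (Finset.range j : Set ℕ) := fun k hk => by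
    simpa using hk.1
  have := Set.ncard_le_ncard h (Finset.finite_toSet _)
  rwa [Set.ncard_coe_finset, Finset.card_range] at this

lemma πΔ_f (q : S.Δ) : S.πΔ (S.f q) = T (S.πΔ q) := by
  obtain ⟨⟨y, l⟩, hl⟩ := q
  have hl' : l < S.τ y := hl
  rw [πΔ, f, towerMap_val]
  by_cases h : l + 1 < S.τ y
  · simp only [towerStep, h, if_true, πΔ]
    rw [Function.iterate_succ_apply']
  · have h' : S.τ y = l + 1 := by omega
    simp only [towerStep, h, if_false, πΔ, Function.iterate_zero, id, F]
    rw [h', Function.iterate_succ_apply']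

lemma πΔ_iterate_f (j : ℕ) (q : S.Δ) : S.πΔ (S.f^[j] q) = T^[j] (S.πΔ q) :=
  Function.Semiconj.iterate_right (f := S.πΔ) πΔ_f j q

lemma hat_leafSection (q : S.Δbar) : S.hat (S.leafSection q) = S.leafSection q := by
  rw [hat, towerProj_leafSection]

lemma hat_f_leafSection (q : S.Δbar) : S.hat (S.f (S.leafSection q)) = S.leafSection (S.fbar q) := by
  rw [hat, towerProj_f, towerProj_leafSection]

lemma stable_F_leafPoint (x : S.Ybar) : S.stable (S.F (S.leafPoint x)) (S.leafPoint (S.Fbar x)) := by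
  have h : S.proj (S.F (S.leafPoint x)) = S.proj (S.leafPoint (S.Fbar x)) := by
    rw [proj_F, proj_leafPoint, proj_leafPoint]
  exact Quotient.exact h

lemma stable_leafPoint (y : S.Y) : S.stable y (S.leafPoint (S.proj y)) := by
  have h : S.proj y = S.proj (S.leafPoint (S.proj y)) := by rw [proj_leafPoint]
  exact Quotient.exact h

lemma F_leafPoint (x : S.Ybar) :
    (S.F (S.leafPoint x) : Λ) = T^[S.τbar x] (S.leafPoint x : Λ) := by
  rw [← τ_leafPoint]
  rfl

/-- The difference along the orbits of the image of a point of `W^u` and of the point of `W^u` on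
the same stable leaf. -/
noncomputable def leafDefect (S : InducingScheme T) (v : Λ → E) (x : S.Ybar) (j : ℕ) : E :=
  v (T^[j] (S.F (S.leafPoint x) : Λ)) - v (T^[j] (S.leafPoint (S.Fbar x) : Λ))

/-- The formula for the quotient observable, without the restriction to the tower. -/
noncomputable def quotientObs (S : InducingScheme T) (v : Λ → E) (q : S.Ybar × ℕ) : E :=
  v (T^[q.2] (S.leafPoint q.1 : Λ)) +
    if q.2 + 1 = S.τbar q.1 then ∑' j, S.leafDefect v q.1 j else 0

/-- Below the top level the tower map preserves the leaf point, so the terms of the series vanish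
one by one. At the top, what remains is the mismatch between the image of the leaf point and the
leaf point of the image. -/
lemma vbar_eq (v : Λ → E) (q : S.Δbar) : S.vbar v q = S.quotientObs v q.1 := by
  obtain ⟨⟨x, l⟩, hl⟩ := q
  have hl' : l < S.τbar x := hl
  rw [vbar, vhat, hat_leafSection, hat_f_leafSection]
  have e1 : S.πΔ (S.leafSection ⟨(x, l), hl⟩) = T^[l] (S.leafPoint x : Λ) := rfl
  have e2 : S.πΔ (S.leafSection (S.fbar ⟨(x, l), hl⟩)) =
      T^[(towerStep S.Fbar S.τbar (x, l)).2]
        (S.leafPoint (towerStep S.Fbar S.τbar (x, l)).1 : Λ) := by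
    rw [πΔ, leafSection]
    simp only [fbar, towerMap_val]
  simp only [πΔ_iterate_f, e1, e2, quotientObs]
  congr 1
  by_cases h : l + 1 < S.τbar x
  · have h' : ¬ l + 1 = S.τbar x := h.ne
    simp only [towerStep, h, h', if_true, if_false]
    rw [← tsum_zero (β := ℕ)]
    congr 1
    ext j
    rw [← Function.iterate_add_apply, ← Function.iterate_add_apply,
      show j + 1 + l = j + (l + 1) by ring, sub_self]
  · have h' : l + 1 = S.τbar x := by omega
    rw [if_pos h']
    have e3 : towerStep S.Fbar S.τbar (x, l) = (S.Fbar x, 0) := by simp [towerStep, h]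
    simp only [e3, leafDefect, Function.iterate_zero, id, F_leafPoint, ← h']
    congr 1
    ext j
    rw [← Function.iterate_add_apply, ← Function.iterate_add_apply,
      show j + 1 + l = j + (l + 1) by ring]

/-- The data of a bounded Hölder observable of a nonuniformly hyperbolic transformation. -/
structure IsHolderData (S : InducingScheme T) (v : Λ → E) (D₀ D₁ γ p η N θ : ℝ) : Prop where
  hyp : S.IsHyperbolic D₀ D₁ γ p
  one_le_D₀ : 1 ≤ D₀
  γ_pos : 0 < γ
  γ_lt_one : γ < 1
  η_pos : 0 < η
  η_le_one : η ≤ 1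
  θ_pos : 0 < θ
  θ_lt_one : θ < 1
  θ_pow : θ ^ 3 = γ ^ η
  norm_le : ∀ x, ‖v x‖ ≤ N
  norm_sub_le : ∀ x y, ‖v x - v y‖ ≤ N * dist x y ^ η
  N_nonneg : 0 ≤ N

lemma IsHolderData.norm_sub_le_of_dist (h : IsHolderData S v D₀ D₁ γ p η N θ) {x y : Λ} {c : ℝ}
    (hc : 0 ≤ c) (hd : dist x y ≤ D₀ * c) : ‖v x - v y‖ ≤ N * D₀ * c ^ η := by
  have hD := h.one_le_D₀
  refine (h.norm_sub_le x y).trans ?_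
  rw [mul_assoc]
  refine mul_le_mul_of_nonneg_left ?_ h.N_nonneg
  refine (Real.rpow_le_rpow dist_nonneg hd h.η_pos.le).trans ?_
  rw [Real.mul_rpow (by linarith) hc]
  refine mul_le_mul_of_nonneg_right ?_ (by positivity)
  calc D₀ ^ η ≤ D₀ ^ (1 : ℝ) := Real.rpow_le_rpow_of_exponent_le hD h.η_le_one
    _ = D₀ := Real.rpow_one _

lemma IsHolderData.pow_rpow (h : IsHolderData S v D₀ D₁ γ p η N θ) (j : ℕ) :
    (γ ^ j) ^ η = θ ^ (3 * j) := by
  rw [pow_mul, h.θ_pow, Real.rpow_pow_comm h.γ_pos.le]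

lemma IsHolderData.stable_le (h : IsHolderData S v D₀ D₁ γ p η N θ) {y y' : S.Y}
    (hy : S.stable y y') (j : ℕ) :
    ‖v (T^[j] (y : Λ)) - v (T^[j] (y' : Λ))‖ ≤ N * D₀ * θ ^ (3 * j) := by
  have hγ := h.γ_pos
  rw [← h.pow_rpow]
  exact h.norm_sub_le_of_dist (by positivity) (h.hyp.contract y y' hy j)

/-- Up to time `j` there are at most `j ≤ i + r` visits. They use up `r` of the `k + r` common
labels and cost at most another factor `γ ^ (-i)`. -/
lemma IsHolderData.unstable_le (h : IsHolderData S v D₀ D₁ γ p η N θ) {x x' : S.Ybar} {k r i j : ℕ}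
    (hx : ∀ i < k + r, S.pieceBar (S.Fbar^[i] x) = S.pieceBar (S.Fbar^[i] x')) (hj : j ≤ i + r) :
    ‖v (T^[j] (S.leafPoint x : Λ)) - v (T^[j] (S.leafPoint x' : Λ))‖ ≤
      N * D₀ * (θ ^ (3 * k) / θ ^ (3 * i)) := by
  have hγ := h.γ_pos
  have hD := h.one_le_D₀
  rw [← h.pow_rpow, ← h.pow_rpow, ← Real.div_rpow (by positivity) (by positivity)]
  refine h.norm_sub_le_of_dist (by positivity)
    ((h.hyp.dist_leafPoint_le (by linarith) hγ h.γ_lt_one hx j).trans ?_)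
  refine mul_le_mul_of_nonneg_left ?_ (by linarith)
  rw [div_le_div_iff₀ (by positivity) (by positivity)]
  rw [pow_add, mul_assoc, ← pow_add]
  refine mul_le_mul_of_nonneg_left ?_ (by positivity)
  refine pow_le_pow_of_le_one hγ.le h.γ_lt_one.le ?_
  have := S.visits_le j (S.leafPoint x : Λ)
  omega

lemma IsHolderData.pow_three_mul_le (h : IsHolderData S v D₀ D₁ γ p η N θ) (j : ℕ) :
    θ ^ (3 * j) ≤ θ ^ j :=
  pow_le_pow_of_le_one h.θ_pos.le h.θ_lt_one.le (by omega)

lemma IsHolderData.nonneg (h : IsHolderData S v D₀ D₁ γ p η N θ) : 0 ≤ N * D₀ :=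
  mul_nonneg h.N_nonneg (by linarith [h.one_le_D₀])

lemma IsHolderData.norm_leafDefect_le (h : IsHolderData S v D₀ D₁ γ p η N θ) (x : S.Ybar) (j : ℕ) :
    ‖S.leafDefect v x j‖ ≤ N * D₀ * θ ^ (3 * j) :=
  h.stable_le (S.stable_F_leafPoint x) j

lemma IsHolderData.summable_bound (h : IsHolderData S v D₀ D₁ γ p η N θ) (c : ℝ) :
    Summable fun j => c * θ ^ j :=
  (summable_geometric_of_lt_one h.θ_pos.le h.θ_lt_one).mul_left c

lemma IsHolderData.tsum_bound (h : IsHolderData S v D₀ D₁ γ p η N θ) (c : ℝ) :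
    ∑' j, c * θ ^ j = c / (1 - θ) := by
  rw [tsum_mul_left, tsum_geometric_of_lt_one h.θ_pos.le h.θ_lt_one, div_eq_mul_inv]

variable [CompleteSpace E]

lemma IsHolderData.summable_leafDefect (h : IsHolderData S v D₀ D₁ γ p η N θ) (x : S.Ybar) :
    Summable (S.leafDefect v x) :=
  (h.summable_bound (N * D₀)).of_norm_bounded fun j => (h.norm_leafDefect_le x j).trans
    (mul_le_mul_of_nonneg_left (h.pow_three_mul_le j) h.nonneg)

lemma IsHolderData.norm_tsum_leafDefect_le (h : IsHolderData S v D₀ D₁ γ p η N θ) (x : S.Ybar) :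
    ‖∑' j, S.leafDefect v x j‖ ≤ N * D₀ / (1 - θ) := by
  rw [← h.tsum_bound]
  exact tsum_of_norm_bounded (h.summable_bound _).hasSum fun j => (h.norm_leafDefect_le x j).trans
    (mul_le_mul_of_nonneg_left (h.pow_three_mul_le j) h.nonneg)

/-- Two estimates compete. Stable contraction bounds each defect by a multiple of `θ ^ (3 * j)`;
comparing `x` with `x'` along the unstable leaf gives `θ ^ (3 * k) / θ ^ (3 * j)` with `k = n - τ`.
Their minimum decays in both `j` and `k`. If `τ > n`, the truncated exponent is zero and the first
estimate suffices. -/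
lemma IsHolderData.norm_leafDefect_sub_le (h : IsHolderData S v D₀ D₁ γ p η N θ) {n : ℕ}
    {x x' : S.Ybar} (hn : 1 ≤ n)
    (hx : ∀ i < n, S.pieceBar (S.Fbar^[i] x) = S.pieceBar (S.Fbar^[i] x')) (j : ℕ) :
    ‖S.leafDefect v x j - S.leafDefect v x' j‖ ≤
      2 * N * D₀ * θ ^ (n - S.τbar x) * θ ^ j := by
  have hN := h.nonneg
  have h1 : ‖S.leafDefect v x j - S.leafDefect v x' j‖ ≤ 2 * (N * D₀) * θ ^ (3 * j) := by
    refine (_root_.norm_sub_le _ _).trans ?_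
    have := h.norm_leafDefect_le x j
    have := h.norm_leafDefect_le x' j
    linarith
  have hτ : S.τbar x' = S.τbar x := (S.isInducingTime.const x x' (hx 0 hn)).symm
  have hτpos := S.τbar_pos x
  rcases le_or_gt (S.τbar x) n with hle | hlt
  · obtain ⟨k, rfl⟩ := Nat.exists_eq_add_of_le' hle
    rw [Nat.add_sub_cancel]
    have e : ∀ x : S.Ybar, T^[j] (S.F (S.leafPoint x) : Λ) =
        T^[j + S.τbar x] (S.leafPoint x : Λ) := fun x => by
      rw [Function.iterate_add_apply, F_leafPoint]
    have h2 := h.unstable_le (j := j + S.τbar x) (i := j) hx le_rfl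
    -- Passing to the image loses one label. Since `τ ≥ 1`, it is taken from the surplus and not
    -- from `k`.
    have hx' : ∀ i < k + (S.τbar x - 1),
        S.pieceBar (S.Fbar^[i] (S.Fbar x)) = S.pieceBar (S.Fbar^[i] (S.Fbar x')) := fun i hi => by
      have := hx (i + 1) (by omega)
      rwa [Function.iterate_succ_apply, Function.iterate_succ_apply] at this
    have h3 := h.unstable_le (j := j) (i := j) hx' (by omega)
    have h4 : ‖S.leafDefect v x j - S.leafDefect v x' j‖ ≤
        2 * (N * D₀) * (θ ^ (3 * k) / θ ^ (3 * j)) := by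
      rw [leafDefect, leafDefect, e, e, hτ, sub_sub_sub_comm]
      refine (_root_.norm_sub_le _ _).trans ?_
      linarith
    have h5 := min_pow_le h.θ_pos h.θ_lt_one.le j k
    calc ‖S.leafDefect v x j - S.leafDefect v x' j‖
        ≤ 2 * (N * D₀) * min (θ ^ (3 * j)) (θ ^ (3 * k) / θ ^ (3 * j)) := by
          rcases min_choice (θ ^ (3 * j)) (θ ^ (3 * k) / θ ^ (3 * j)) with h6 | h6 <;> rw [h6] <;>
            assumption
      _ ≤ 2 * (N * D₀) * θ ^ (j + k) := mul_le_mul_of_nonneg_left h5 (by linarith)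
      _ = _ := by rw [pow_add]; ring
  · rw [Nat.sub_eq_zero_of_le hlt.le, pow_zero, mul_one]
    refine h1.trans ?_
    have := h.pow_three_mul_le j
    nlinarith

variable [MeasurableSpace E] [BorelSpace E] [SecondCountableTopology E] [BorelSpace Λ]

lemma IsHolderData.measurable_leafPoint (h : IsHolderData S v D₀ D₁ γ p η N θ) (hT : Measurable T) :
    Measurable S.leafPoint :=
  h.hyp.measurable_leafPoint hT (by linarith [h.one_le_D₀]) h.γ_pos h.γ_lt_one

lemma measurable_tsum_of_summable {X : Type*} [MeasurableSpace X] {g : X → ℕ → E}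
    (hg : ∀ j, Measurable fun x => g x j) (hs : ∀ x, Summable (g x)) :
    Measurable fun x => ∑' j, g x j :=
  measurable_of_tendsto_metrizable (f := fun n x => ∑ j ∈ Finset.range n, g x j)
    (fun _ => Finset.measurable_fun_sum _ fun j _ => hg j)
    (tendsto_pi_nhds.2 fun x => (hs x).hasSum.tendsto_sum_nat)

lemma IsHolderData.measurable_quotientObs (h : IsHolderData S v D₀ D₁ γ p η N θ)
    (hT : Measurable T) (hv : Measurable v) : Measurable (S.quotientObs v) := by
  have hlp : Measurable fun x : S.Ybar => (S.leafPoint x : Λ) :=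
    measurable_subtype_coe.comp (h.measurable_leafPoint hT)
  have hF : Measurable fun x : S.Ybar => (S.F (S.leafPoint x) : Λ) :=
    measurable_subtype_coe.comp ((S.measurable_F hT).comp (h.measurable_leafPoint hT))
  refine (hv.comp ((measurable_iterate_uncurry hT).comp
    ((hlp.comp measurable_fst).prodMk measurable_snd))).add ?_
  refine Measurable.ite (measurableSet_eq_fun (measurable_snd.add_const 1)
    (S.measurable_τbar.comp measurable_fst)) ?_ measurable_const
  have hm : Measurable fun x : S.Ybar => ∑' j, S.leafDefect v x j :=
    measurable_tsum_of_summable (fun j => (hv.comp ((hT.iterate j).comp hF)).sub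
      (hv.comp ((hT.iterate j).comp (hlp.comp (S.measurable_Fbar hT))))) h.summable_leafDefect
  exact hm.comp measurable_fst

lemma IsHolderData.isTowerObservable (h : IsHolderData S v D₀ D₁ γ p η N θ) (hT : Measurable T)
    (hv : Measurable v) :
    IsTowerObservable S.Fbar S.pieceBar S.τbar (fun _ => 1) (4 * D₀ / (1 - θ) * N) θ
      (S.quotientObs v) := by
  have hθ := h.θ_pos
  have hθ1 : 0 < 1 - θ := by linarith [h.θ_lt_one]
  have hD := h.one_le_D₀
  have hN := h.N_nonneg
  have hND := h.nonneg
  have hdiv : 1 ≤ 1 / (1 - θ) := by rw [le_div_iff₀ hθ1]; linarith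
  have eB : 4 * D₀ / (1 - θ) * N = 4 * (N * D₀ * (1 / (1 - θ))) := by ring
  have h1 : N * D₀ ≤ N * D₀ * (1 / (1 - θ)) := le_mul_of_one_le_right hND hdiv
  have h2 : N ≤ N * D₀ := le_mul_of_one_le_right hN hD
  refine ⟨h.measurable_quotientObs hT hv, fun x l _ => ?_, fun n x x' l hn hx hl => ?_⟩
  · have h3 := h.norm_le (T^[l] (S.leafPoint x : Λ))
    have h4 := h.norm_tsum_leafDefect_le x
    rw [div_eq_mul_one_div] at h4
    rw [eB, mul_one, quotientObs]
    refine (norm_add_le _ _).trans ?_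
    split_ifs
    · linarith
    · rw [norm_zero]; linarith
  · have hτ : S.τbar x' = S.τbar x := (S.isInducingTime.const x x' (hx 0 hn)).symm
    have hpow : 0 < θ ^ (n - S.τbar x) := by positivity
    have h3 : ‖v (T^[l] (S.leafPoint x : Λ)) - v (T^[l] (S.leafPoint x' : Λ))‖ ≤
        2 * (N * D₀) * θ ^ (n - S.τbar x) := by
      rcases le_or_gt (S.τbar x) n with hle | hlt
      · obtain ⟨k, rfl⟩ := Nat.exists_eq_add_of_le' hle
        have h4 := h.unstable_le (j := l) (i := 0) hx (by omega)
        rw [Nat.add_sub_cancel] at hpow ⊢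
        simp only [mul_zero, pow_zero, div_one] at h4
        have h5 := mul_le_mul_of_nonneg_left (h.pow_three_mul_le k) hND
        nlinarith
      · rw [Nat.sub_eq_zero_of_le hlt.le, pow_zero, mul_one]
        refine (_root_.norm_sub_le _ _).trans ?_
        have := h.norm_le (T^[l] (S.leafPoint x : Λ))
        have := h.norm_le (T^[l] (S.leafPoint x' : Λ))
        linarith
    have h4 : ‖∑' j, S.leafDefect v x j - ∑' j, S.leafDefect v x' j‖ ≤
        2 * (N * D₀) * θ ^ (n - S.τbar x) * (1 / (1 - θ)) := by
      rw [← (h.summable_leafDefect x).tsum_sub (h.summable_leafDefect x'), ← div_eq_mul_one_div,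
        ← h.tsum_bound]
      exact tsum_of_norm_bounded (h.summable_bound _).hasSum fun j =>
        (h.norm_leafDefect_sub_le hn hx j).trans_eq (by ring)
    have h5 : 2 * (N * D₀) * θ ^ (n - S.τbar x) ≤
        2 * (N * D₀) * θ ^ (n - S.τbar x) * (1 / (1 - θ)) :=
      le_mul_of_one_le_right (by positivity) hdiv
    rw [eB, one_mul, quotientObs, quotientObs, add_sub_add_comm]
    simp only [hτ]
    refine (norm_add_le _ _).trans ?_
    split_ifs
    · linarith
    · rw [sub_zero, norm_zero]
      nlinarith

end InducingScheme

/-! ### From the quotient tower to the original system -/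

lemma towerMeasure_preimage_val {α : Type*} [MeasurableSpace α] {μ : Measure α} [SFinite μ]
    {τ : α → ℕ} (hτ : Measurable τ) {A : Set (α × ℕ)} (hA : MeasurableSet A) :
    towerMeasure τ μ (Subtype.val ⁻¹' A) = (∫⁻ a, (τ a : ℝ≥0∞) ∂μ)⁻¹ *
      ∫⁻ x, ∑ l ∈ Finset.range (τ x), A.indicator (1 : α × ℕ → ℝ≥0∞) (x, l) ∂μ := by
  rw [← lintegral_tower hτ (measurable_one.indicator hA),
    ← lintegral_indicator_one (measurable_subtype_coe hA)]
  rfl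

namespace InducingScheme

variable {Λ : Type u} [MetricSpace Λ] [MeasurableSpace Λ] {T : Λ → Λ} {S : InducingScheme T}
  {μY : Measure S.Y}

lemma measurable_towerProj : Measurable S.towerProj :=
  measurable_comap_iff.2 (((S.measurable_proj.comp measurable_fst).prodMk measurable_snd).comp
    measurable_subtype_coe)

lemma lintegral_map_proj {g : ℕ → ℝ≥0∞} :
    ∫⁻ x, g (S.τbar x) ∂(μY.map S.proj) = ∫⁻ y, g (S.τ y) ∂μY :=
  lintegral_map ((measurable_from_top (f := g)).comp S.measurable_τbar) S.measurable_proj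

lemma measurePreserving_towerProj [IsProbabilityMeasure μY] :
    MeasurePreserving S.towerProj (towerMeasure S.τ μY) (S.μΔbar μY) := by
  have : IsProbabilityMeasure (μY.map S.proj) :=
    Measure.isProbabilityMeasure_map S.measurable_proj.aemeasurable
  refine ⟨measurable_towerProj, Measure.ext fun A hA => ?_⟩
  rw [Measure.map_apply measurable_towerProj hA]
  obtain ⟨A, hA, rfl⟩ := hA
  have hm : Measurable fun p : S.Y × ℕ => (S.proj p.1, p.2) :=
    (S.measurable_proj.comp measurable_fst).prodMk measurable_snd
  have e : S.towerProj ⁻¹' (Subtype.val ⁻¹' A) =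
      Subtype.val ⁻¹' ((fun p : S.Y × ℕ => (S.proj p.1, p.2)) ⁻¹' A) := rfl
  rw [e, towerMeasure_preimage_val S.measurable_τ (hm hA), μΔbar,
    towerMeasure_preimage_val S.measurable_τbar hA,
    lintegral_map_proj (g := fun k => (k : ℝ≥0∞))]
  congr 1
  have hg : Measurable fun x : S.Ybar =>
      ∑ l ∈ Finset.range (S.τbar x), A.indicator (1 : S.Ybar × ℕ → ℝ≥0∞) (x, l) := by
    have h : Measurable fun p : ℕ × S.Ybar =>
        ∑ l ∈ Finset.range p.1, A.indicator (1 : S.Ybar × ℕ → ℝ≥0∞) (p.2, l) :=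
      measurable_from_prod_countable_right fun n => by
        show Measurable fun y => ∑ l ∈ Finset.range n, A.indicator (1 : S.Ybar × ℕ → ℝ≥0∞) (y, l)
        exact Finset.measurable_fun_sum _ fun l _ =>
          (measurable_one.indicator hA).comp (measurable_id.prodMk measurable_const)
    exact h.comp (S.measurable_τbar.prodMk measurable_id)
  rw [lintegral_map hg S.measurable_proj]
  rfl

lemma measurable_πΔ (hT : Measurable T) : Measurable S.πΔ :=
  (measurable_iterate_uncurry hT).comp
    (((measurable_subtype_coe.comp measurable_fst).prodMk measurable_snd).comp
      measurable_subtype_coe)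

lemma iterate_towerProj (n : ℕ) (q : S.Δ) : S.towerProj (S.f^[n] q) = S.fbar^[n] (S.towerProj q) :=
  Function.Semiconj.iterate_right (f := S.towerProj) S.towerProj_f n q

variable {E : Type*} [NormedAddCommGroup E] {v : Λ → E} {D₀ D₁ γ p η N θ : ℝ}

/-- The coboundary relating an observable to its projection along stable leaves. -/
noncomputable def leafCorr (S : InducingScheme T) (v : Λ → E) (q : S.Δ) : E :=
  ∑' j, (v (T^[j] (S.πΔ q)) - v (T^[j] (S.πΔ (S.hat q))))

lemma IsHolderData.norm_leafCorr_term_le (h : IsHolderData S v D₀ D₁ γ p η N θ) (q : S.Δ) (j : ℕ) :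
    ‖v (T^[j] (S.πΔ q)) - v (T^[j] (S.πΔ (S.hat q)))‖ ≤ N * D₀ * θ ^ j := by
  obtain ⟨⟨y, l⟩, hl⟩ := q
  have e1 : T^[j] (S.πΔ ⟨(y, l), hl⟩) = T^[j + l] (y : Λ) := by
    rw [Function.iterate_add_apply]; rfl
  have e2 : T^[j] (S.πΔ (S.hat ⟨(y, l), hl⟩)) = T^[j + l] (S.leafPoint (S.proj y) : Λ) := by
    rw [Function.iterate_add_apply]; rfl
  rw [e1, e2]
  refine (h.stable_le (S.stable_leafPoint y) _).trans (mul_le_mul_of_nonneg_left ?_ h.nonneg)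
  exact pow_le_pow_of_le_one h.θ_pos.le h.θ_lt_one.le (by omega)

variable [CompleteSpace E]

lemma IsHolderData.summable_leafCorr (h : IsHolderData S v D₀ D₁ γ p η N θ) (q : S.Δ) :
    Summable fun j => v (T^[j] (S.πΔ q)) - v (T^[j] (S.πΔ (S.hat q))) :=
  (h.summable_bound (N * D₀)).of_norm_bounded (h.norm_leafCorr_term_le q)

lemma IsHolderData.norm_leafCorr_le (h : IsHolderData S v D₀ D₁ γ p η N θ) (q : S.Δ) :
    ‖S.leafCorr v q‖ ≤ N * D₀ / (1 - θ) := by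
  rw [← h.tsum_bound]
  exact tsum_of_norm_bounded (h.summable_bound _).hasSum (h.norm_leafCorr_term_le q)

/-- In the difference of the two series, shifted by one, the terms along the orbit of `q` cancel,
and the series defining `vhat` is left. -/
lemma IsHolderData.vhat_eq (h : IsHolderData S v D₀ D₁ γ p η N θ) (q : S.Δ) :
    S.vhat v q = v (S.πΔ q) + (S.leafCorr v (S.f q) - S.leafCorr v q) := by
  have h1 := h.summable_leafCorr q
  have h2 := h.summable_leafCorr (S.f q)
  have h3 := (summable_nat_add_iff 1).2 h1
  have e : S.leafCorr v q = (v (S.πΔ q) - v (S.πΔ (S.hat q))) +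
      ∑' j, (v (T^[j + 1] (S.πΔ q)) - v (T^[j + 1] (S.πΔ (S.hat q)))) := h1.tsum_eq_zero_add
  rw [e, leafCorr, sub_add_eq_sub_sub, sub_right_comm, ← h2.tsum_sub h3, vhat]
  simp only [πΔ_iterate_f, πΔ_f]
  have e2 : ∀ j, v (T^[j] (T (S.πΔ q))) - v (T^[j] (S.πΔ (S.hat (S.f q)))) -
      (v (T^[j + 1] (S.πΔ q)) - v (T^[j + 1] (S.πΔ (S.hat q)))) =
      v (T^[j + 1] (S.πΔ (S.hat q))) - v (T^[j] (S.πΔ (S.hat (S.f q)))) := fun j => by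
    rw [Function.iterate_succ_apply T j (S.πΔ q)]
    abel
  simp only [e2]
  abel

lemma IsHolderData.birkhoffSum_eq (h : IsHolderData S v D₀ D₁ γ p η N θ) (n : ℕ) (q : S.Δ) :
    birkhoffSum S.fbar (S.vbar v) n (S.towerProj q) =
      birkhoffSum T v n (S.πΔ q) + (S.leafCorr v (S.f^[n] q) - S.leafCorr v q) := by
  induction n with
  | zero => simp
  | succ n ih =>
    rw [birkhoffSum_succ, birkhoffSum_succ, ih, ← iterate_towerProj, vbar_towerProj, h.vhat_eq,
      πΔ_iterate_f, Function.iterate_succ_apply']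
    abel

lemma IsHolderData.norm_birkhoffSum_sub_le (h : IsHolderData S v D₀ D₁ γ p η N θ) (n : ℕ)
    (q : S.Δ) :
    ‖birkhoffSum T v n (S.πΔ q) - birkhoffSum S.fbar (S.vbar v) n (S.towerProj q)‖ ≤
      2 * (N * D₀ / (1 - θ)) := by
  rw [h.birkhoffSum_eq, sub_add_cancel_left, norm_neg]
  refine (_root_.norm_sub_le _ _).trans ?_
  linarith [h.norm_leafCorr_le (S.f^[n] q), h.norm_leafCorr_le q]

lemma IsHolderData.maxBirkhoff_le (h : IsHolderData S v D₀ D₁ γ p η N θ) (n : ℕ) (q : S.Δ) :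
    maxBirkhoff T v n (S.πΔ q) ≤ maxBirkhoff S.fbar (S.vbar v) n (S.towerProj q) +
      2 * (N * D₀ / (1 - θ)) := by
  refine maxBirkhoff_le_iff.2 fun j hj => ?_
  have h1 := h.norm_birkhoffSum_sub_le j q
  have h2 : ‖birkhoffSum S.fbar (S.vbar v) j (S.towerProj q)‖ ≤
      maxBirkhoff S.fbar (S.vbar v) n (S.towerProj q) := le_maxBirkhoff_iff.2 ⟨j, hj, le_rfl⟩
  have h3 := norm_le_insert' (birkhoffSum T v j (S.πΔ q))
    (birkhoffSum S.fbar (S.vbar v) j (S.towerProj q))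
  linarith

variable [MeasurableSpace E] [BorelSpace E] [SecondCountableTopology E] [BorelSpace Λ]

lemma IsHolderData.measurable_vbar (h : IsHolderData S v D₀ D₁ γ p η N θ) (hT : Measurable T)
    (hv : Measurable v) : Measurable (S.vbar v) := by
  rw [show S.vbar v = fun q => S.quotientObs v q.1 from funext (vbar_eq v)]
  exact (h.measurable_quotientObs hT hv).comp measurable_subtype_coe

lemma IsHolderData.measurable_leafCorr (h : IsHolderData S v D₀ D₁ γ p η N θ) (hT : Measurable T)
    (hv : Measurable v) : Measurable (S.leafCorr v) := by
  have hs : Measurable S.leafSection :=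
    measurable_comap_iff.2 ((((h.measurable_leafPoint hT).comp measurable_fst).prodMk
      measurable_snd).comp measurable_subtype_coe)
  have hh : Measurable S.hat := hs.comp measurable_towerProj
  exact measurable_tsum_of_summable (fun j =>
    (hv.comp ((hT.iterate j).comp (measurable_πΔ hT))).sub
      (hv.comp ((hT.iterate j).comp ((measurable_πΔ hT).comp hh)))) h.summable_leafCorr

lemma measurePreserving_f (hμ : S.IsInducedMeasure μY) :
    MeasurePreserving S.f (towerMeasure S.τ μY) (towerMeasure S.τ μY) :=
  have := hμ.prob
  measurePreserving_towerMap hμ.invariant S.measurable_τ S.τ_pos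

variable [NormedSpace ℝ E]

/-- The coboundary of the bounded function `leafCorr` integrates to zero, so centring is preserved
by the passage to the quotient. -/
lemma IsHolderData.integral_vbar (h : IsHolderData S v D₀ D₁ γ p η N θ) (hT : Measurable T)
    (hv : Measurable v) (hμ : S.IsInducedMeasure μY) (hfin : ∫⁻ y, (S.τ y : ℝ≥0∞) ∂μY ≠ ∞) :
    ∫ q, S.vbar v q ∂S.μΔbar μY = ∫ x, v x ∂S.μΛ μY := by
  have := hμ.prob
  have hprob := isProbabilityMeasure_tower (μ := μY) S.measurable_τ S.τ_pos hfin
  have hf := measurePreserving_f hμ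
  have hc := h.measurable_leafCorr hT hv
  have i1 : Integrable (fun q => v (S.πΔ q)) (towerMeasure S.τ μY) :=
    Integrable.of_bound (hv.comp (measurable_πΔ hT)).aestronglyMeasurable N
      (.of_forall fun q => h.norm_le _)
  have i2 : Integrable (S.leafCorr v) (towerMeasure S.τ μY) :=
    Integrable.of_bound hc.aestronglyMeasurable _ (.of_forall h.norm_leafCorr_le)
  have i3 : Integrable (fun q => S.leafCorr v (S.f q)) (towerMeasure S.τ μY) :=
    hf.integrable_comp_of_integrable i2
  have e1 : ∫ q, S.leafCorr v (S.f q) ∂towerMeasure S.τ μY =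
      ∫ q, S.leafCorr v q ∂towerMeasure S.τ μY := by
    have h1 := integral_map (μ := towerMeasure S.τ μY) (f := S.leafCorr v) hf.aemeasurable
      (by rw [hf.map_eq]; exact hc.aestronglyMeasurable)
    rw [hf.map_eq] at h1
    exact h1.symm
  have hp := measurePreserving_towerProj (S := S) (μY := μY)
  rw [← hp.map_eq, integral_map hp.aemeasurable (h.measurable_vbar hT hv).aestronglyMeasurable,
    μΛ, integral_map (measurable_πΔ hT).aemeasurable hv.aestronglyMeasurable]
  simp only [vbar_towerProj, h.vhat_eq]
  have i4 : Integrable (fun q => S.leafCorr v (S.f q) - S.leafCorr v q) (towerMeasure S.τ μY) :=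
    i3.sub i2
  rw [integral_add i1 i4, integral_sub i3 i2, e1, sub_self, add_zero]

/-- The moments of the maximal sums are bounded by those on the quotient tower. -/
lemma IsHolderData.eLpNorm_maxBirkhoff_le (h : IsHolderData S v D₀ D₁ γ p η N θ)
    (hT : Measurable T) (hv : Measurable v) (hμ : S.IsInducedMeasure μY)
    (hfin : ∫⁻ y, (S.τ y : ℝ≥0∞) ∂μY ≠ ∞) (n : ℕ) {r : ℝ≥0∞} (hr : 1 ≤ r) :
    eLpNorm (maxBirkhoff T v n) r (S.μΛ μY) ≤
      eLpNorm (maxBirkhoff S.fbar (S.vbar v) n) r (S.μΔbar μY) +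
        ENNReal.ofReal (2 * (N * D₀ / (1 - θ))) := by
  have := hμ.prob
  have hprob := isProbabilityMeasure_tower (μ := μY) S.measurable_τ S.τ_pos hfin
  have hp := measurePreserving_towerProj (S := S) (μY := μY)
  have hm := measurable_maxBirkhoff hT hv n
  have hfb : Measurable S.fbar :=
    measurable_towerMap (S.measurable_Fbar hT) S.measurable_τbar S.τbar_pos
  have hm' := measurable_maxBirkhoff hfb (h.measurable_vbar hT hv) n
  have hθ1 : 0 < 1 - θ := by linarith [h.θ_lt_one]
  have hc : 0 ≤ 2 * (N * D₀ / (1 - θ)) := by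
    have := h.nonneg
    positivity
  rw [μΛ, eLpNorm_map_measure hm.aestronglyMeasurable (measurable_πΔ hT).aemeasurable,
    ← hp.map_eq, eLpNorm_map_measure hm'.aestronglyMeasurable hp.aemeasurable]
  refine (eLpNorm_mono_real (g := fun q => maxBirkhoff S.fbar (S.vbar v) n (S.towerProj q) +
    2 * (N * D₀ / (1 - θ))) fun q => ?_).trans ?_
  · rw [Function.comp_apply, Real.norm_of_nonneg maxBirkhoff_nonneg]
    exact h.maxBirkhoff_le n q
  · refine (eLpNorm_add_le (hm'.comp hp.measurable).aestronglyMeasurable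
      aestronglyMeasurable_const hr).trans (add_le_add le_rfl ?_)
    refine (eLpNorm_le_of_ae_bound (C := 2 * (N * D₀ / (1 - θ)))
      (.of_forall fun _ => (Real.norm_of_nonneg hc).le)).trans_eq ?_
    rw [measure_univ, ENNReal.one_rpow, one_mul]

end InducingScheme

/-! ### Uniform constants -/

section Mono

variable {α E : Type*} [MeasurableSpace α] {μ : Measure α} {F : α → α}
  {label τ : α → ℕ} {L γ θ B L' γ' θ' B' : ℝ} {a : α → ℝ}
  [NormedAddCommGroup E] [MeasurableSpace E] {W : α × ℕ → E}

lemma GibbsMarkov.mono (hG : GibbsMarkov F label μ L γ) (hL : L ≤ L') (hγ : γ ≤ γ')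
    (hγ' : γ' < 1) : GibbsMarkov F label μ L' γ' where
  preserves := hG.preserves
  measurable_label := hG.measurable_label
  L_nonneg := hG.L_nonneg.trans hL
  γ_pos := hG.γ_pos.trans_le hγ
  γ_lt_one := hγ'
  distortion j n A A' hA hA' h := by
    have h0 := hG.γ_pos
    have h1 := hG.L_nonneg
    have h2 : 0 ≤ L' := h1.trans hL
    refine (hG.distortion j n A A' hA hA' h).trans ?_
    gcongr

lemma IsTowerObservable.mono (hW : IsTowerObservable F label τ (fun _ => 1) B θ W) (hB : B ≤ B')
    (hB' : 0 ≤ B') (hθ0 : 0 ≤ θ) (hθ : θ ≤ θ') :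
    IsTowerObservable F label τ (fun _ => 1) B' θ' W where
  measurable := hW.measurable
  bound x l hl := (hW.bound x l hl).trans (by gcongr)
  holder n x x' l hn hx hl := by
    refine (hW.holder n x x' l hn hx hl).trans ?_
    gcongr

lemma IsTowerObservable.smul [NormedSpace ℝ E] [BorelSpace E]
    (hW : IsTowerObservable F label τ a B θ W) {c : ℝ} (hc : 0 ≤ c) :
    IsTowerObservable F label τ a (c * B) θ (fun p => c • W p) where
  measurable := hW.measurable.const_smul c
  bound x l hl := by
    rw [norm_smul, Real.norm_of_nonneg hc, mul_assoc]
    exact mul_le_mul_of_nonneg_left (hW.bound x l hl) hc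
  holder n x x' l hn hx hl := by
    rw [← smul_sub, norm_smul, Real.norm_of_nonneg hc, mul_assoc]
    exact mul_le_mul_of_nonneg_left (hW.holder n x x' l hn hx hl) hc

lemma maxBirkhoff_le_mul {Λ : Type*} [NormedSpace ℝ E] {f : Λ → Λ} {g : Λ → E} (hB : 0 < B)
    (n : ℕ) (x : Λ) : maxBirkhoff f g n x ≤ B * maxBirkhoff f (fun x => B⁻¹ • g x) n x := by
  refine maxBirkhoff_le_iff.2 fun j hj => ?_
  have h1 : ‖birkhoffSum f (fun x => B⁻¹ • g x) j x‖ ≤ maxBirkhoff f (fun x => B⁻¹ • g x) n x :=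
    le_maxBirkhoff_iff.2 ⟨j, hj, le_rfl⟩
  have h2 : birkhoffSum f (fun x => B⁻¹ • g x) j x = B⁻¹ • birkhoffSum f g j x := by
    simp only [birkhoffSum, Finset.smul_sum]
  rw [h2, norm_smul, norm_inv, Real.norm_of_nonneg hB.le, inv_mul_le_iff₀ hB] at h1
  exact h1

end Mono

/-- Moment bound for the maximal Birkhoff sums on the tower, for `p > 1`. -/
theorem exists_maxBirkhoff_const.{v, w} {p : ℝ} (hp : 1 < p) (L γ θ H : ℝ) :
    ∃ C : ℝ, ∀ {α : Type v} {E : Type w} [MeasurableSpace α] {μ : Measure α}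
      [IsProbabilityMeasure μ]
      {F : α → α} {label τ : α → ℕ} [NormedAddCommGroup E] [InnerProductSpace ℝ E]
      [CompleteSpace E] [MeasurableSpace E] [BorelSpace E] [SecondCountableTopology E]
      {W : α × ℕ → E} {B : ℝ}, GibbsMarkov F label μ L γ → ∀ hτ : IsInducingTime label τ,
      Integrable (fun x => (τ x : ℝ) ^ p) μ → ∫ x, (τ x : ℝ) ^ p ∂μ ≤ H → 0 < θ → θ < 1 →
      0 ≤ B → IsTowerObservable F label τ (fun _ => 1) B θ W →
      ∫ q : Tower τ, W q.1 ∂towerMeasure τ μ = 0 → ∀ n : ℕ, 1 ≤ n →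
      eLpNorm (maxBirkhoff (towerMap F τ hτ.pos) (fun q => W q.1) n)
        (ENNReal.ofReal (max p (2 * (p - 1)))) (towerMeasure τ μ) ≤
        ENNReal.ofReal (B * (C * (n : ℝ) ^ max (1 / 2) (1 / p))) := by
  obtain ⟨C, hC⟩ : ∃ C : ℝ, ∀ {α : Type v} {E : Type w} [MeasurableSpace α] {μ : Measure α}
      [IsProbabilityMeasure μ]
      {F : α → α} {label τ : α → ℕ} [NormedAddCommGroup E] [InnerProductSpace ℝ E]
      [CompleteSpace E] [MeasurableSpace E] [BorelSpace E] [SecondCountableTopology E]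
      {W : α × ℕ → E}, GibbsMarkov F label μ L γ → ∀ hτ : IsInducingTime label τ,
      Integrable (fun x => (τ x : ℝ) ^ p) μ → ∫ x, (τ x : ℝ) ^ p ∂μ ≤ H → 0 < θ → θ < 1 →
      IsTowerObservable F label τ (fun _ => 1) 1 θ W →
      ∫ q : Tower τ, W q.1 ∂towerMeasure τ μ = 0 → ∀ n : ℕ, 1 ≤ n →
      eLpNorm (maxBirkhoff (towerMap F τ hτ.pos) (fun q => W q.1) n)
        (ENNReal.ofReal (max p (2 * (p - 1)))) (towerMeasure τ μ) ≤
        ENNReal.ofReal (C * (n : ℝ) ^ max (1 / 2) (1 / p)) := by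
    rcases lt_or_ge p 2 with h2 | h2
    · rw [max_eq_left (by linarith), max_eq_right (by
        rw [div_le_div_iff₀ (by norm_num) (by linarith)]; linarith)]
      exact exists_maxBirkhoff_const_of_lt_two hp h2 L γ θ H
    · rw [max_eq_right (by linarith), max_eq_left (by
        rw [div_le_div_iff₀ (by linarith) (by norm_num)]; linarith)]
      exact exists_maxBirkhoff_const_of_two_le h2 L γ θ H
  refine ⟨C, ?_⟩
  intro α E _ μ _ F label τ _ _ _ _ _ _ W B hG hτ hi hH hθ hθ1 hB hW h0 n hn
  rcases hB.eq_or_lt with rfl | hB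
  · have hz : maxBirkhoff (towerMap F τ hτ.pos) (fun q => W q.1) n = 0 := by
      ext q
      refine le_antisymm ((maxBirkhoff_le le_rfl fun q => ?_).trans_eq (mul_zero _))
        maxBirkhoff_nonneg
      simpa using hW.bound q.1.1 q.1.2 q.2
    rw [hz, eLpNorm_zero]
    exact zero_le
  · have h1 := hC hG hτ hi hH hθ hθ1 (W := fun p => B⁻¹ • W p)
      (by simpa [inv_mul_cancel₀ hB.ne'] using hW.smul (c := B⁻¹) (by positivity))
      (by rw [integral_smul, h0, smul_zero]) n hn
    rw [ENNReal.ofReal_mul hB.le]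
    calc _ ≤ eLpNorm (B • maxBirkhoff (towerMap F τ hτ.pos) (fun q => B⁻¹ • W q.1) n)
          (ENNReal.ofReal (max p (2 * (p - 1)))) (towerMeasure τ μ) := by
          refine eLpNorm_mono fun q => ?_
          rw [Real.norm_of_nonneg maxBirkhoff_nonneg, Pi.smul_apply, smul_eq_mul, norm_mul,
            Real.norm_of_nonneg hB.le, Real.norm_of_nonneg maxBirkhoff_nonneg]
          exact maxBirkhoff_le_mul hB n q
      _ ≤ _ := by
          rw [eLpNorm_const_smul, Real.enorm_of_nonneg hB.le]
          gcongr

namespace InducingScheme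

variable {Λ : Type u} [MetricSpace Λ] [MeasurableSpace Λ] [BorelSpace Λ] {T : Λ → Λ}
  {S : InducingScheme T} {μY : Measure S.Y} {D₀ D₁ γ p : ℝ}

lemma IsHyperbolic.integrable_τbar (h : S.IsHyperbolic D₀ D₁ γ p)
    (hμ : S.IsInducedMeasure μY) (hT : Measurable T) (hp : 0 ≤ p) (hD₀ : 0 ≤ D₀) (hD₁ : 0 ≤ D₁)
    (hγ : 0 < γ) (hγ1 : γ < 1) : Integrable (fun x => (S.τbar x : ℝ) ^ p) (μY.map S.proj) := by
  refine ⟨((measurable_from_top (f := fun k : ℕ => (k : ℝ) ^ p)).comp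
    S.measurable_τbar).aestronglyMeasurable, ?_⟩
  unfold HasFiniteIntegral
  refine lt_of_eq_of_lt (lintegral_congr fun x => ?_)
    (h.lintegral_τbar_lt_top hμ hT hp hD₀ hD₁ hγ hγ1)
  rw [Real.enorm_of_nonneg (by positivity)]

lemma IsInducedMeasure.lintegral_τ_ne_top (hμ : S.IsInducedMeasure μY) (hp : 1 ≤ p)
    (hi : Integrable (fun x => (S.τbar x : ℝ) ^ p) (μY.map S.proj)) :
    ∫⁻ y, (S.τ y : ℝ≥0∞) ∂μY ≠ ∞ := by
  have := hμ.isProbabilityMeasure_map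
  have h1 : Integrable (fun x => (S.τbar x : ℝ)) (μY.map S.proj) := by
    simpa using S.isInducingTime.integrable_rpow hp hi
  have h2 := S.isInducingTime.lintegral_ne_top h1
  rwa [lintegral_map_proj (g := fun k => (k : ℝ≥0∞))] at h2

lemma IsInducedMeasure.integral_τbar_eq (_hμ : S.IsInducedMeasure μY) (hp : 0 < p)
    (hi : Integrable (fun x => (S.τbar x : ℝ) ^ p) (μY.map S.proj)) :
    ∫ x, (S.τbar x : ℝ) ^ p ∂(μY.map S.proj) =
      (eLpNorm (fun y => (S.τ y : ℝ)) (ENNReal.ofReal p) μY).toReal ^ p := by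
  have hI : 0 ≤ ∫ x, (S.τbar x : ℝ) ^ p ∂(μY.map S.proj) :=
    integral_nonneg fun x => by positivity
  have h1 : ∫⁻ y, ‖(S.τ y : ℝ)‖ₑ ^ p ∂μY =
      ENNReal.ofReal (∫ x, (S.τbar x : ℝ) ^ p ∂(μY.map S.proj)) := by
    rw [ofReal_integral_eq_lintegral_ofReal hi (.of_forall fun x => by positivity),
      lintegral_map_proj (g := fun k => ENNReal.ofReal ((k : ℝ) ^ p))]
    refine lintegral_congr fun y => ?_
    rw [Real.enorm_of_nonneg (by positivity), ENNReal.ofReal_rpow_of_nonneg (by positivity) hp.le]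
  rw [eLpNorm_eq_lintegral_rpow_enorm_toReal (by simpa using hp) ENNReal.ofReal_ne_top,
    ENNReal.toReal_ofReal hp.le, h1, ← ENNReal.toReal_rpow, ENNReal.toReal_ofReal hI,
    ← Real.rpow_mul hI, one_div, inv_mul_cancel₀ hp.ne', Real.rpow_one]

lemma IsHyperbolic.isHolderData {E : Type*} [NormedAddCommGroup E] {v : Λ → E} {η : ℝ≥0}
    (h : S.IsHyperbolic D₀ D₁ γ p) (hD₀ : 1 ≤ D₀) (hγ : 0 < γ) (hγ1 : γ < 1) (hη : 0 < η)
    (hη1 : η ≤ 1) (hv : IsHolder η v) :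
    IsHolderData S v D₀ D₁ γ p (η : ℝ) (holderNorm η v) (γ ^ ((η : ℝ) / 3)) where
  hyp := h
  one_le_D₀ := hD₀
  γ_pos := hγ
  γ_lt_one := hγ1
  η_pos := hη
  η_le_one := hη1
  θ_pos := by positivity
  θ_lt_one := Real.rpow_lt_one hγ.le hγ1 (by positivity)
  θ_pow := by
    rw [← Real.rpow_natCast, ← Real.rpow_mul hγ.le]
    congr 1
    push_cast
    ring
  norm_le := hv.norm_le
  norm_sub_le := hv.norm_sub_le
  N_nonneg := holderNorm_nonneg

end InducingScheme

/-- The moment bound holds with the constant `C` for all systems with constants `D₀, D₁, γ, K`. -/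
def MomentBound (p : ℝ) (η : ℝ≥0) (D₀ D₁ γ K C : ℝ) : Prop :=
  ∀ (Λ : Type u) [MetricSpace Λ] [MeasurableSpace Λ] [BorelSpace Λ]
    (T : Λ → Λ) (_ : Measurable T) (S : InducingScheme T)
    (_ : S.IsHyperbolic D₀ D₁ γ p) (μY : Measure S.Y) (_ : S.IsInducedMeasure μY)
    (_ : (eLpNorm (fun y => (S.τ y : ℝ)) (ENNReal.ofReal p) μY).toReal = K)
    (d : ℕ) (v : Λ → EuclideanSpace ℝ (Fin d)) (_ : IsHolder η v)
    (_ : ∫ x, v x ∂(S.μΛ μY) = 0) (n : ℕ) (_ : 1 ≤ n),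
    eLpNorm (maxBirkhoff T v n) (ENNReal.ofReal (max p (2 * (p - 1)))) (S.μΛ μY) ≤
      ENNReal.ofReal (C * holderNorm η v * (n : ℝ) ^ max (1 / 2 : ℝ) (1 / p))

lemma MomentBound.mono {p : ℝ} {η : ℝ≥0} {D₀ D₁ γ K C C' : ℝ}
    (h : MomentBound.{u} p η D₀ D₁ γ K C) (hC : C ≤ C') : MomentBound.{u} p η D₀ D₁ γ K C' := by
  intro Λ _ _ _ T hT S hS μY hμ hK d v hv h0 n hn
  refine (h Λ T hT S hS μY hμ hK d v hv h0 n hn).trans (ENNReal.ofReal_le_ofReal ?_)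
  have := holderNorm_nonneg (η := η) (v := v)
  gcongr

/-- The hypotheses become weaker as `D₀, D₁, γ, K` increase, so the constant obtained at the upper
corner serves the whole box of parameters. This local uniformity is the source of the continuity of
the constant. -/
lemma exists_momentBound_of_one_lt {p : ℝ} (hp : 1 < p) {η : ℝ≥0} (hη : 0 < η) (hη1 : η ≤ 1)
    {D₀' D₁' γ' K' : ℝ} (hD₀' : 1 ≤ D₀') (hγ'0 : 0 < γ') (hγ' : γ' < 1) :
    ∃ C : ℝ, 1 ≤ C ∧ ∀ D₀ D₁ γ K : ℝ, 1 ≤ D₀ → 1 ≤ D₁ → 0 < γ → 0 ≤ K → D₀ ≤ D₀' → D₁ ≤ D₁' →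
      γ ≤ γ' → K ≤ K' → MomentBound.{u} p η D₀ D₁ γ K C := by
  set θ' := γ' ^ ((η : ℝ) / 3) with hθ'
  obtain ⟨C, hC⟩ := exists_maxBirkhoff_const.{u, 0} hp (3 * (D₁' / (1 - γ'))) γ' θ' (K' ^ p)
  have hθ'0 : 0 < θ' := by positivity
  have hθ'1 : θ' < 1 := Real.rpow_lt_one hγ'0.le hγ' (by positivity)
  have h1θ' : 0 < 1 - θ' := by linarith
  -- The first summand is the bound on the quotient tower, where the observable has size `4 * D₀' /
  -- (1 - θ') * N`; the second comes from the coboundary `leafCorr` at both ends of the orbit.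
  set A := 4 * D₀' / (1 - θ') * |C| + 2 * (D₀' / (1 - θ')) with hA
  refine ⟨max 1 A, le_max_left _ _, ?_⟩
  intro D₀ D₁ γ K hD₀ hD₁ hγ hK0 hDD₀ hDD₁ hγγ hKK
  refine MomentBound.mono (C := A) ?_ (le_max_right _ _)
  intro Λ _ _ _ T hT S hS μY hμ hK d v hv h0 n hn
  have hγ1 : γ < 1 := hγγ.trans_lt hγ'
  have h1γ : 0 < 1 - γ := by linarith
  have h1γ' : 0 < 1 - γ' := by linarith
  have hprob := hμ.isProbabilityMeasure_map
  have hi := hS.integrable_τbar hμ hT (by linarith) (by linarith) (by linarith) hγ hγ1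
  have hfin := hμ.lintegral_τ_ne_top hp.le hi
  have hH : ∫ x, (S.τbar x : ℝ) ^ p ∂(μY.map S.proj) ≤ K' ^ p := by
    rw [hμ.integral_τbar_eq (by linarith) hi, hK]
    exact Real.rpow_le_rpow hK0 hKK (by linarith)
  have hd := hS.isHolderData hD₀ hγ hγ1 hη hη1 hv
  have hvm : Measurable v := (hv.continuous hη).measurable
  have hN := holderNorm_nonneg (η := η) (v := v)
  set N := holderNorm η v
  set θ := γ ^ ((η : ℝ) / 3)
  have hθθ : θ ≤ θ' := Real.rpow_le_rpow hγ.le hγγ (by positivity)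
  have h1θ : 0 < 1 - θ := by linarith
  have hD₁'0 : 0 ≤ D₁' := by linarith
  have hG := (hS.gibbsMarkov hμ hT (by linarith) (by linarith) (by linarith) hγ hγ1).mono
    (L' := 3 * (D₁' / (1 - γ'))) (by gcongr) hγγ hγ'
  have hW := (hd.isTowerObservable hT hvm).mono (B' := 4 * D₀' / (1 - θ') * N) (θ' := θ')
    (by gcongr) (by positivity) hd.θ_pos.le hθθ
  have hvbar : S.vbar v = fun q => S.quotientObs v q.1 := funext (InducingScheme.vbar_eq v)
  have hz : ∫ q : Tower S.τbar, S.quotientObs v q.1 ∂towerMeasure S.τbar (μY.map S.proj) = 0 := by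
    have := hd.integral_vbar hT hvm hμ hfin
    rw [h0, hvbar] at this
    exact this
  have key := hC hG S.isInducingTime hi hH hθ'0 hθ'1 (by positivity) hW hz n hn
  have hr : 1 ≤ ENNReal.ofReal (max p (2 * (p - 1))) := by
    rw [← ENNReal.ofReal_one]
    exact ENNReal.ofReal_le_ofReal (hp.le.trans (le_max_left _ _))
  have h1 := hd.eLpNorm_maxBirkhoff_le hT hvm hμ hfin n hr
  rw [hvbar] at h1
  refine h1.trans ((add_le_add_left key _).trans ?_)
  have hn1 : (1 : ℝ) ≤ n := by exact_mod_cast hn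
  have hpow : 1 ≤ (n : ℝ) ^ max (1 / 2) (1 / p) :=
    Real.one_le_rpow hn1 (le_trans (by norm_num) (le_max_left _ _))
  set e := (n : ℝ) ^ max (1 / 2) (1 / p)
  calc _ ≤ ENNReal.ofReal (4 * D₀' / (1 - θ') * N * (|C| * e)) +
        ENNReal.ofReal (2 * (N * D₀' / (1 - θ'))) := by
        gcongr
        exact le_abs_self C
    _ = ENNReal.ofReal (4 * D₀' / (1 - θ') * N * (|C| * e) + 2 * (N * D₀' / (1 - θ'))) :=
        (ENNReal.ofReal_add (by positivity) (by positivity)).symm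
    _ ≤ _ := by
        refine ENNReal.ofReal_le_ofReal ?_
        have h2 : 2 * (N * D₀' / (1 - θ')) ≤ 2 * (N * D₀' / (1 - θ')) * e :=
          le_mul_of_one_le_right (by positivity) hpow
        calc _ ≤ 4 * D₀' / (1 - θ') * N * (|C| * e) + 2 * (N * D₀' / (1 - θ')) * e := by gcongr
          _ = _ := by rw [hA]; ring

/-- Both exponents equal one, and the trivial bound of the sums by `n` times the supremum of `v` is
sufficient. -/
lemma momentBound_one {η : ℝ≥0} {D₀ D₁ γ K : ℝ} (hD₀ : 1 ≤ D₀) (hD₁ : 1 ≤ D₁)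
    (hγ : 0 < γ) (hγ1 : γ < 1) : MomentBound.{u} 1 η D₀ D₁ γ K 1 := by
  intro Λ _ _ _ T hT S hS μY hμ hK d v hv h0 n hn
  have := hμ.prob
  have hi := hS.integrable_τbar hμ hT (by linarith) (by linarith) (by linarith) hγ hγ1
  have hfin := hμ.lintegral_τ_ne_top le_rfl hi
  have hprob := isProbabilityMeasure_tower (μ := μY) S.measurable_τ S.τ_pos hfin
  have : IsProbabilityMeasure (S.μΛ μY) :=
    Measure.isProbabilityMeasure_map (InducingScheme.measurable_πΔ hT).aemeasurable
  refine (eLpNorm_le_of_ae_bound (C := n * holderNorm η v) (.of_forall fun x => ?_)).trans_eq ?_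
  · rw [Real.norm_of_nonneg maxBirkhoff_nonneg]
    exact maxBirkhoff_le holderNorm_nonneg hv.norm_le
  · rw [measure_univ, ENNReal.one_rpow, one_mul]
    norm_num
    rw [mul_comm, ENNReal.ofReal_mul holderNorm_nonneg, ENNReal.ofReal_natCast]

lemma exists_momentBound {p : ℝ} (hp : 1 ≤ p) {η : ℝ≥0} (hη : 0 < η) (hη1 : η ≤ 1)
    {D₀' D₁' γ' K' : ℝ} (hD₀' : 1 ≤ D₀') (hγ'0 : 0 < γ') (hγ' : γ' < 1) :
    ∃ C : ℝ, 1 ≤ C ∧ ∀ D₀ D₁ γ K : ℝ, 1 ≤ D₀ → 1 ≤ D₁ → 0 < γ → 0 ≤ K → D₀ ≤ D₀' → D₁ ≤ D₁' →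
      γ ≤ γ' → K ≤ K' → MomentBound.{u} p η D₀ D₁ γ K C := by
  rcases hp.eq_or_lt with rfl | hp
  · exact ⟨1, le_rfl, fun D₀ D₁ γ K hD₀ hD₁ hγ _ _ _ hγγ _ =>
      momentBound_one hD₀ hD₁ hγ (hγγ.trans_lt hγ')⟩
  · exact exists_momentBound_of_one_lt hp hη hη1 hD₀' hγ'0 hγ'

/-- The range of the constants of a nonuniformly hyperbolic transformation. -/
def paramSet : Set (ℝ × ℝ × ℝ × ℝ) := Set.Ici 1 ×ˢ Set.Ici 1 ×ˢ Set.Ioo 0 1 ×ˢ Set.Ici 1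

/-- Admissible constants at a given parameter form an upward closed set, which is convex, and one
constant is admissible near each parameter. A partition of unity on the parameter set then yields a
continuous selection. -/
lemma exists_continuous_momentBound {p : ℝ} (hp : 1 ≤ p) {η : ℝ≥0} (hη : 0 < η) (hη1 : η ≤ 1) :
    ∃ C : C(paramSet, ℝ), ∀ z : paramSet, 1 ≤ C z ∧
      MomentBound.{u} p η z.1.1 z.1.2.1 z.1.2.2.1 z.1.2.2.2 (C z) := by
  refine exists_continuous_forall_mem_convex_of_local_const
    (t := fun z : paramSet => {c : ℝ | 1 ≤ c ∧
      MomentBound.{u} p η z.1.1 z.1.2.1 z.1.2.2.1 z.1.2.2.2 c}) (fun z => ?_) fun z => ?_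
  · refine Set.OrdConnected.convex ⟨fun a ha b _ c hc => ?_⟩
    exact ⟨ha.1.trans hc.1, ha.2.mono hc.1⟩
  · obtain ⟨⟨D₀, D₁, γ, K⟩, hD₀, hD₁, hγ, hK⟩ := z
    have hD₀ : 1 ≤ D₀ := hD₀
    have hγ0 : 0 < γ := hγ.1
    have hγ1 : γ < 1 := hγ.2
    obtain ⟨C, hC1, hC⟩ := exists_momentBound.{u} hp hη hη1 (D₀' := D₀ + 1) (D₁' := D₁ + 1)
      (γ' := (γ + 1) / 2) (K' := K + 1) (by linarith) (by linarith) (by linarith)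
    refine ⟨C, ?_⟩
    have o1 : ∀ᶠ w : ℝ × ℝ × ℝ × ℝ in 𝓝 (D₀, D₁, γ, K), w.1 < D₀ + 1 ∧ w.2.1 < D₁ + 1 ∧
        w.2.2.1 < (γ + 1) / 2 ∧ w.2.2.2 < K + 1 := by
      have c1 : Continuous fun w : ℝ × ℝ × ℝ × ℝ => w.1 := by fun_prop
      have c2 : Continuous fun w : ℝ × ℝ × ℝ × ℝ => w.2.1 := by fun_prop
      have c3 : Continuous fun w : ℝ × ℝ × ℝ × ℝ => w.2.2.1 := by fun_prop
      have c4 : Continuous fun w : ℝ × ℝ × ℝ × ℝ => w.2.2.2 := by fun_prop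
      filter_upwards [c1.continuousAt.eventually_lt_const (by simp : (_ : ℝ) < D₀ + 1),
        c2.continuousAt.eventually_lt_const (by simp : (_ : ℝ) < D₁ + 1),
        c3.continuousAt.eventually_lt_const (by simp; linarith : (_ : ℝ) < (γ + 1) / 2),
        c4.continuousAt.eventually_lt_const (by simp : (_ : ℝ) < K + 1)] with w h1 h2 h3 h4
      exact ⟨h1, h2, h3, h4⟩
    have o2 := continuous_subtype_val.continuousAt (x := (⟨(D₀, D₁, γ, K), hD₀, hD₁, hγ, hK⟩ :
      paramSet)) |>.eventually o1
    filter_upwards [o2] with y hy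
    obtain ⟨⟨E₀, E₁, δ, M⟩, hE₀, hE₁, hδ, hM⟩ := y
    have hM : 1 ≤ M := hM
    exact ⟨hC1, hC E₀ E₁ δ M hE₀ hE₁ hδ.1 (by linarith) hy.1.le hy.2.1.le hy.2.2.1.le hy.2.2.2.le⟩

/-! ### The limiting covariance -/

lemma memLp_birkhoffSum_of_bound {X E : Type*} [MeasurableSpace X] {P : Measure X}
    [IsFiniteMeasure P] {f : X → X} [NormedAddCommGroup E] [MeasurableSpace E] [BorelSpace E]
    [SecondCountableTopology E] {g : X → E} {N : ℝ} (hf : Measurable f) (hg : Measurable g)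
    (hN : ∀ x, ‖g x‖ ≤ N) (n : ℕ) : MemLp (birkhoffSum f g n) 2 P := by
  have hm : Measurable (birkhoffSum f g n) :=
    Finset.measurable_fun_sum _ fun k _ => hg.comp (hf.iterate k)
  refine MemLp.of_bound hm.aestronglyMeasurable (n * N) (.of_forall fun x => ?_)
  refine (norm_sum_le _ _).trans ?_
  simpa using Finset.sum_le_sum (s := Finset.range n) fun k _ => hN (f^[k] x)

lemma covMatrix_apply {X : Type*} [MeasurableSpace X] {d : ℕ} (f : X → X) (P : Measure X)
    (g : X → EuclideanSpace ℝ (Fin d)) (n : ℕ) (i j : Fin d) :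
    covMatrix f P g n i j = (n : ℝ)⁻¹ * ∫ x, inner ℝ (birkhoffSum f g n x)
      (EuclideanSpace.single i 1) * inner ℝ (birkhoffSum f g n x)
        (EuclideanSpace.single j 1) ∂P := by
  simp [covMatrix, EuclideanSpace.inner_single_right]

namespace InducingScheme

variable {Λ : Type u} [MetricSpace Λ] [MeasurableSpace Λ] [BorelSpace Λ] {T : Λ → Λ}
  {S : InducingScheme T} {μY : Measure S.Y} {D₀ D₁ γ p : ℝ}

/-- The limit is found on the quotient tower. Lifted to the full tower, the sums of `v` and of `vbar
v` differ by at most a constant, so the normalised covariances have the same limit. -/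
theorem IsHyperbolic.exists_tendsto_covMatrix {η : ℝ≥0} {d : ℕ}
    {v : Λ → EuclideanSpace ℝ (Fin d)} (hS : S.IsHyperbolic D₀ D₁ γ p) (hp : 2 ≤ p)
    (hT : Measurable T) (hD₀ : 1 ≤ D₀) (hD₁ : 1 ≤ D₁) (hγ : 0 < γ) (hγ1 : γ < 1) (hη : 0 < η)
    (hη1 : η ≤ 1) (hμ : S.IsInducedMeasure μY) (hv : IsHolder η v)
    (h0 : ∫ x, v x ∂(S.μΛ μY) = 0) :
    ∃ Sig : Matrix (Fin d) (Fin d) ℝ, Tendsto (covMatrix T (S.μΛ μY) v) atTop (𝓝 Sig) ∧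
      Tendsto (covMatrix S.fbar (S.μΔbar μY) (S.vbar v)) atTop (𝓝 Sig) := by
  have := hμ.prob
  have := hμ.isProbabilityMeasure_map
  have hi := hS.integrable_τbar hμ hT (by linarith) (by linarith) (by linarith) hγ hγ1
  have hi2 : Integrable (fun x => (S.τbar x : ℝ) ^ 2) (μY.map S.proj) := by
    simpa using S.isInducingTime.integrable_rpow hp hi
  have hfin := hμ.lintegral_τ_ne_top (by linarith) hi
  have hprob := isProbabilityMeasure_tower (μ := μY) S.measurable_τ S.τ_pos hfin
  have hπ := measurable_πΔ (S := S) hT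
  have hd := hS.isHolderData hD₀ hγ hγ1 hη hη1 hv
  have hvm : Measurable v := (hv.continuous hη).measurable
  have hG := hS.gibbsMarkov hμ hT (by linarith) (by linarith) (by linarith) hγ hγ1
  have hW := hd.isTowerObservable hT hvm
  have hN := hd.N_nonneg
  have h1θ : 0 < 1 - γ ^ ((η : ℝ) / 3) := by linarith [hd.θ_lt_one]
  have hvbar : S.vbar v = fun q => S.quotientObs v q.1 := funext (vbar_eq v)
  have hz : ∫ q : Tower S.τbar, S.quotientObs v q.1 ∂towerMeasure S.τbar (μY.map S.proj) = 0 := by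
    have := hd.integral_vbar hT hvm hμ hfin
    rw [h0, hvbar] at this
    exact this
  obtain ⟨σ, hσ⟩ := hG.exists_covariance S.isInducingTime hi2 hd.θ_pos hd.θ_lt_one
    (by positivity) hW hz
  rw [← hvbar] at hσ
  have hproj := measurePreserving_towerProj (S := S) (μY := μY)
  have hfbar : Measurable S.fbar :=
    measurable_towerMap (S.measurable_Fbar hT) S.measurable_τbar S.τbar_pos
  have hvb : Measurable (S.vbar v) := hd.measurable_vbar hT hvm
  have hmb (n : ℕ) : Measurable (birkhoffSum S.fbar (S.vbar v) n) :=
    Finset.measurable_fun_sum _ fun k _ => hvb.comp (hfbar.iterate k)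
  have hmv (n : ℕ) : Measurable (birkhoffSum T v n) :=
    Finset.measurable_fun_sum _ fun k _ => hvm.comp (hT.iterate k)
  have hprob' : IsProbabilityMeasure (S.μΛ μY) :=
    Measure.isProbabilityMeasure_map hπ.aemeasurable
  have hB (n : ℕ) : MemLp (fun q => birkhoffSum T v n (S.πΔ q)) 2 (towerMeasure S.τ μY) :=
    (memLp_birkhoffSum_of_bound hT hvm hd.norm_le n).comp_of_map (μ := towerMeasure S.τ μY)
      hπ.aemeasurable
  set c := 2 * (holderNorm η v * D₀ / (1 - γ ^ ((η : ℝ) / 3))) with hc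
  have hsub := hd.norm_birkhoffSum_sub_le
  have hD (n : ℕ) : MemLp (fun q => birkhoffSum T v n (S.πΔ q) -
      birkhoffSum S.fbar (S.vbar v) n (S.towerProj q)) 2 (towerMeasure S.τ μY) :=
    MemLp.of_bound (((hmv n).comp hπ).sub ((hmb n).comp hproj.measurable)).aestronglyMeasurable
      c (.of_forall (hsub n))
  have hA (n : ℕ) : MemLp (fun q => birkhoffSum S.fbar (S.vbar v) n (S.towerProj q)) 2
      (towerMeasure S.τ μY) := by
    refine ((hB n).sub (hD n)).ae_eq (.of_forall fun q => ?_)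
    simp
  have hlim : Tendsto (fun n : ℕ => (n : ℝ)⁻¹ * ∫ q, ‖birkhoffSum T v n (S.πΔ q) -
      birkhoffSum S.fbar (S.vbar v) n (S.towerProj q)‖ ^ 2 ∂towerMeasure S.τ μY)
      atTop (𝓝 0) := by
    have h1 : Tendsto (fun n : ℕ => (n : ℝ)⁻¹ * c ^ 2) atTop (𝓝 0) := by
      simpa using (tendsto_inv_atTop_nhds_zero_nat (𝕜 := ℝ)).mul_const (c ^ 2)
    refine squeeze_zero (fun n => mul_nonneg (by positivity)
      (integral_nonneg fun q => by positivity)) (fun n => ?_) h1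
    refine mul_le_mul_of_nonneg_left ?_ (by positivity)
    calc _ ≤ ∫ _, c ^ 2 ∂towerMeasure S.τ μY :=
          integral_mono (hD n).integrable_norm_pow' (integrable_const _) fun q =>
            pow_le_pow_left₀ (norm_nonneg _) (hsub n q) 2
      _ = c ^ 2 := by simp
  have hσ' (u w : EuclideanSpace ℝ (Fin d)) := by
    refine tendsto_covariance_of_sub hA hB (σ := σ) (fun u w => ?_) hlim u w
    refine (hσ u w).congr fun n => ?_
    have h1 : AEStronglyMeasurable (fun q => inner ℝ (birkhoffSum S.fbar (S.vbar v) n q) u *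
        inner ℝ (birkhoffSum S.fbar (S.vbar v) n q) w)
        ((towerMeasure S.τ μY).map S.towerProj) :=
      (((hmb n).inner_const).mul ((hmb n).inner_const)).aestronglyMeasurable
    have h2 := integral_map hproj.measurable.aemeasurable h1
    rw [hproj.map_eq] at h2
    exact congrArg _ h2
  refine ⟨Matrix.of fun i j => σ (EuclideanSpace.single i 1) (EuclideanSpace.single j 1),
    tendsto_pi_nhds.2 fun i => tendsto_pi_nhds.2 fun j => ?_,
    tendsto_pi_nhds.2 fun i => tendsto_pi_nhds.2 fun j => ?_⟩
  · simp_rw [covMatrix_apply]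
    refine (hσ' (EuclideanSpace.single i 1) (EuclideanSpace.single j 1)).congr fun n => ?_
    rw [μΛ, integral_map hπ.aemeasurable]
    exact (((hmv n).inner_const).mul ((hmv n).inner_const)).aestronglyMeasurable
  · simp_rw [covMatrix_apply]
    exact hσ _ _

/-- Places the last argument of the constant inside the parameter range on which the constant was
constructed. -/
lemma IsHyperbolic.one_le_eLpNorm_τ (hS : S.IsHyperbolic D₀ D₁ γ p) (hp : 1 ≤ p)
    (hT : Measurable T) (hD₀ : 1 ≤ D₀) (hD₁ : 1 ≤ D₁) (hγ : 0 < γ) (hγ1 : γ < 1)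
    (hμ : S.IsInducedMeasure μY) :
    1 ≤ (eLpNorm (fun y => (S.τ y : ℝ)) (ENNReal.ofReal p) μY).toReal := by
  have := hμ.isProbabilityMeasure_map
  have hi := hS.integrable_τbar hμ hT (by linarith) (by linarith) (by linarith) hγ hγ1
  have h1 : 1 ≤ ∫ x, (S.τbar x : ℝ) ^ p ∂(μY.map S.proj) := by
    calc (1 : ℝ) = ∫ _, (1 : ℝ) ∂(μY.map S.proj) := by simp
      _ ≤ _ := integral_mono (integrable_const _) hi fun x =>
        Real.one_le_rpow (S.isInducingTime.one_le x) (by linarith)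
  rw [hμ.integral_τbar_eq (by linarith) hi] at h1
  by_contra! h
  exact absurd (Real.rpow_lt_one ENNReal.toReal_nonneg h (by linarith : 0 < p)) (not_lt.2 h1)

end InducingScheme

end NUH

theorem mainTheorem12 (p : ℝ) (hp : 1 ≤ p) (η : ℝ≥0) (hη : 0 < η) (hη1 : η ≤ 1) :
    (∃ C : ℝ → ℝ → ℝ → ℝ → ℝ,
      ContinuousOn (fun z : ℝ × ℝ × ℝ × ℝ => C z.1 z.2.1 z.2.2.1 z.2.2.2)
        (Set.Ici 1 ×ˢ Set.Ici 1 ×ˢ Set.Ioo 0 1 ×ˢ Set.Ici 1) ∧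
      (∀ D₀ D₁ γ K : ℝ, 1 ≤ D₀ → 1 ≤ D₁ → 0 < γ → γ < 1 → 1 ≤ K → 1 ≤ C D₀ D₁ γ K) ∧
      ∀ (Λ : Type u) [MetricSpace Λ] [MeasurableSpace Λ] [BorelSpace Λ]
        (T : Λ → Λ) (_ : Measurable T) (S : NUH.InducingScheme T)
        (D₀ D₁ γ : ℝ) (_ : 1 ≤ D₀) (_ : 1 ≤ D₁) (_ : 0 < γ) (_ : γ < 1)
        (_ : S.IsHyperbolic D₀ D₁ γ p) (μY : Measure S.Y) (_ : S.IsInducedMeasure μY)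
        (d : ℕ) (v : Λ → EuclideanSpace ℝ (Fin d)) (_ : NUH.IsHolder η v)
        (_ : ∫ x, v x ∂(S.μΛ μY) = 0) (n : ℕ) (_ : 1 ≤ n),
        eLpNorm (NUH.maxBirkhoff T v n) (ENNReal.ofReal (max p (2 * (p - 1)))) (S.μΛ μY) ≤
          ENNReal.ofReal
            (C D₀ D₁ γ (eLpNorm (fun y => (S.τ y : ℝ)) (ENNReal.ofReal p) μY).toReal *
              NUH.holderNorm η v * (n : ℝ) ^ max (1 / 2 : ℝ) (1 / p))) ∧
    (2 ≤ p →
      ∀ (Λ : Type u) [MetricSpace Λ] [MeasurableSpace Λ] [BorelSpace Λ]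
        (T : Λ → Λ) (_ : Measurable T) (S : NUH.InducingScheme T)
        (D₀ D₁ γ : ℝ) (_ : 1 ≤ D₀) (_ : 1 ≤ D₁) (_ : 0 < γ) (_ : γ < 1)
        (_ : S.IsHyperbolic D₀ D₁ γ p) (μY : Measure S.Y) (_ : S.IsInducedMeasure μY)
        (d : ℕ) (v : Λ → EuclideanSpace ℝ (Fin d)) (_ : NUH.IsHolder η v)
        (_ : ∫ x, v x ∂(S.μΛ μY) = 0),
        ∃ Sig : Matrix (Fin d) (Fin d) ℝ,
          Tendsto (NUH.covMatrix T (S.μΛ μY) v) atTop (𝓝 Sig) ∧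
          Tendsto (NUH.covMatrix S.fbar (S.μΔbar μY) (S.vbar v)) atTop (𝓝 Sig)) := by
  obtain ⟨C, hC⟩ := NUH.exists_continuous_momentBound.{u} hp hη hη1
  classical
  -- The value 1 outside the parameter range is a default that plays no role.
  refine ⟨⟨fun D₀ D₁ γ K => if h : (D₀, D₁, γ, K) ∈ NUH.paramSet then C ⟨_, h⟩ else 1, ?_, ?_, ?_⟩,
    ?_⟩
  · refine continuousOn_iff_continuous_domRestrict.2 (C.continuous.congr fun z => ?_)
    exact (dif_pos (c := (z : ℝ × ℝ × ℝ × ℝ) ∈ NUH.paramSet) (t := fun h => C ⟨z, h⟩)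
      (e := fun _ => 1) z.2).symm
  · intro D₀ D₁ γ K h1 h2 h3 h4 h5
    have h : (D₀, D₁, γ, K) ∈ NUH.paramSet := ⟨h1, h2, ⟨h3, h4⟩, h5⟩
    simp only [dif_pos h]
    exact (hC _).1
  · intro Λ _ _ _ T hT S D₀ D₁ γ h1 h2 h3 h4 hS μY hμ d v hv h0 n hn
    have h : (D₀, D₁, γ, (eLpNorm (fun y => (S.τ y : ℝ)) (ENNReal.ofReal p) μY).toReal) ∈
        NUH.paramSet := ⟨h1, h2, ⟨h3, h4⟩, hS.one_le_eLpNorm_τ hp hT h1 h2 h3 h4 hμ⟩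
    simp only [dif_pos h]
    exact (hC ⟨_, h⟩).2 Λ T hT S hS μY hμ rfl d v hv h0 n hn
  · intro hp2 Λ _ _ _ T hT S D₀ D₁ γ h1 h2 h3 h4 hS μY hμ d v hv h0
    exact hS.exists_tendsto_covMatrix hp2 hT h1 h2 h3 h4 hη hη1 hμ hv h0
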